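/- **Setting.** A subset of $\mathbb R^n$ is semi-algebraic if it is a finite union of sets given by finitely many polynomial equalities and inequalities. For open semi-algebraic $X\subseteq\mathbb R^n$, a Nash function on $X$ is an analytic function $X\to\mathbb R$ with semi-algebraic graph; $\mathcal N(X)$ is the ring of these; a map is Nash if its components are. Inputs are finite sequences $u=(\alpha_1,t_1)\cdots(\alpha_k,t_k)$ with $\alpha_i\in U\subseteq\mathbb R^m$, $t_i\ge 0$, $T_u=\sum_i t_i$; $uv$ is concatenation. A set $\mathcal A$ of inputs is admissible if it contains the empty input, it contains $(\alpha_1,t_1)\cdots(\alpha_{i-1},t_{i-1})(\alpha_i,s)$ whenever $(\alpha_1,t_1)\cdots(\alpha_k,t_k)\in\mathcal A$ and $0\le s\le t_i$, for all $u\in\mathcal A$, $\alpha\in U$ there is $t>0$ with $u(\alpha,t)\in\mathcal A$, and for each $(\alpha_1,t_1)\cdots(\alpha_k,t_k)\in\mathcal A$ there is $\delta>0$ with $(\alpha_1,\bar t_1)\cdots(\alpha_k,\bar t_k)\in\mathcal A$ for all $\bar t_i\in[0,t_i+\delta]$. A response map is a map $p:\mathcal A\to\mathbb R^r$, $\mathcal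 A$ admissible, such that for all $k>0$ and $\alpha_1,\dots,\alpha_k\in U$ the map $(t_1,\dots,t_k)\mapsto p((\alpha_1,t_1)\cdots(\alpha_k,t_k))$ is analytic on the set of $t\in[0,\infty)^k$ where it is defined. For $u\in\mathcal A$, $p_u$ is the map $v\mapsto p(uv)$ on $\{v\in\mathcal A: uv\in\mathcal A\}$. A Nash system $\Sigma=(X,f,h,x_0)$ consists of an open connected semi-algebraic $X\subseteq\mathbb R^n$, Nash maps $f_\alpha:X\to\mathbb R^n$ ($\alpha\in U$) and $h:X\to\mathbb R^r$, and $x_0\in X$. Let $\mathcal A(\Sigma)$ be the largest admissible set of inputs $u$ for which there is a unique trajectory $x_\Sigma(\cdot\,;x_0,u):[0,T_u]\to X$ of $\dot x=f(x,u)$, $x(0)=x_0$, and let $\mathcal R(x_0)=\{x_\Sigma(T_u;x_0,u):u\in\mathcal A(\Sigma)\}$. $\Sigma$ is semi-algebraically reachable if every $g\in\mathcal N(X)$ vanishing on $\mathcal R(x_0)$ is $0$. $\Sigma$ is a local Nash realization of $p:\mathcal A\to\mathbb R^r$ if $p$ is a response map and $p(u)=h(x_\Sigma(T_u;x_0,u))$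 for all $u\in\mathcal A\cap\mathcal A(\Sigma)$. **Theorem (correctness of the reachability reduction).** Let $\Sigma=(X,f,h,x_0)$, $X\subseteq\mathbb R^n$, be a local Nash realization of a response map $p:\mathcal A\to\mathbb R^r$, and let $\varepsilon>0$. Let $I\subseteq\mathcal N(X)$ be the ideal of functions vanishing on $\mathcal R(x_0)$, and write $x_u=x_\Sigma(T_u;x_0,u)$. Then each of the following steps can be carried out, whatever was chosen in the earlier ones. 1. There are $d\in\mathbb N$ and $\Phi=(\varphi_1,\dots,\varphi_d)$, $\varphi_i\in\mathcal N(X)$, whose classes form a transcendence basis of $\mathcal N(X)/I$ over $\mathbb R$. 2. For $i=1,\dots,n$ there is a non-zero $Q_i\in\mathbb R[T,T_1,\dots,T_d]$ with $Q_i(\pi_i,\Phi)=0$ on $\mathcal R(x_0)$ ($\pi_i$ the $i$-th coordinate function) and of smallest possible degree with this property (all statements hold both for the total degree and for the degree in $T$); and for any such $Q_1,\dots,Q_n$ there is $u\in\mathcal A\cap\mathcal A(\Sigma)$ with $T_u<\varepsilon$ and $\frac{\partial Q_i}{\partial T}(\pi_i(x_u),\Phi(x_u))\neq0$ for all $i$.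 3. There are open semi-algebraic sets $V\subseteq\mathbb R^d$, $V$ connected, and $W\subseteq X$, and a Nash map $G:V\to W$ such that (a) $\Phi(x_u)\in V$ and $x_u\in W$; (b) $\Phi(x_{uv})\in V$ and $G(\Phi(x_{uv}))=x_{uv}$ for every $v$ with $uv\in\mathcal A(\Sigma)$ and $x_\Sigma(T_u+t;x_0,uv)\in W$ for all $t\in[0,T_v]$. Moreover they can be chosen such that $G$ is the solution of the implicit equations: for $z\in V$, $q\in W$ one has $Q_i(q_i,z)=0$ for $i=1,\dots,n$ if and only if $q=G(z)$. 4. For all $V,W,G$ as in 3 satisfying (a) and (b), the system $\Sigma_V=(V,f^V,h^V,x_0^V)$ with $f^V_\alpha(z)=D\Phi(G(z))f_\alpha(G(z))$, $h^V(z)=h(G(z))$ and $x^V_0=\Phi(x_u)$ is a Nash system, is semi-algebraically reachable, and is a local Nash realization of $p_u$. -/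

import Mathlib

open Set
open scoped NNReal

namespace NashReach

/-! ### Semi-algebraic sets and Nash functions -/

/-- A semi-algebraic subset of `ℝⁿ`: a finite union of sets, each given by finitely many polynomial
equations `P = 0` and strict inequalities `Q > 0`. -/
def IsSemialgebraic {n : ℕ} (S : Set (Fin n → ℝ)) : Prop :=
  ∃ C : Finset (Finset (MvPolynomial (Fin n) ℝ) × Finset (MvPolynomial (Fin n) ℝ)),
    S = {x | ∃ c ∈ C, (∀ P ∈ c.1, MvPolynomial.eval x P = 0) ∧
      (∀ Q ∈ c.2, 0 < MvPolynomial.eval x Q)}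

/-- The graph of `g|_X`, as a subset of `ℝⁿ⁺¹` (the last coordinate is the value). -/
def graphOver {n : ℕ} (X : Set (Fin n → ℝ)) (g : (Fin n → ℝ) → ℝ) : Set (Fin (n + 1) → ℝ) :=
  {z | Fin.init z ∈ X ∧ z (Fin.last n) = g (Fin.init z)}

/-- `g` is a Nash function on the (open semi-algebraic) set `X`: analytic and semi-algebraic.
The values of `g` outside `X` are irrelevant. -/
def IsNash {n : ℕ} (X : Set (Fin n → ℝ)) (g : (Fin n → ℝ) → ℝ) : Prop :=
  AnalyticOnNhd ℝ g X ∧ IsSemialgebraic (graphOver X g)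

/-- A Nash map `X → ℝᵏ`: every component is a Nash function. -/
def IsNashMap {n k : ℕ} (X : Set (Fin n → ℝ)) (g : (Fin n → ℝ) → (Fin k → ℝ)) : Prop :=
  ∀ i, IsNash X (fun x => g x i)

/-- The ring `N(X)` of Nash functions, inside the algebra of all functions `X → ℝ`. (Nash functions
are closed under sums and products by the Tarski-Seidenberg theorem, so passing to the
generated subalgebra adds no functions.) -/
def nashRing {n : ℕ} (X : Set (Fin n → ℝ)) : Subalgebra ℝ (X → ℝ) :=
  Algebra.adjoin ℝ {g | ∃ g' : (Fin n → ℝ) → ℝ, IsNash X g' ∧ g = fun x : X => g' x}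

/-- A Nash function as an element of `N(X)`. -/
def IsNash.toRing {n : ℕ} {X : Set (Fin n → ℝ)} {g : (Fin n → ℝ) → ℝ} (hg : IsNash X g) :
    nashRing X :=
  ⟨fun x => g x, Algebra.subset_adjoin ⟨g, hg, rfl⟩⟩

/-- The ideal of `N(X)` of the functions which vanish on `R`. -/
def vanishingIdeal {n : ℕ} (X R : Set (Fin n → ℝ)) : Ideal (nashRing X) where
  carrier := {g | ∀ x : X, (x : Fin n → ℝ) ∈ R → (g : X → ℝ) x = 0}
  add_mem' := by
    intro a b ha hb x hx
    simp [ha x hx, hb x hx]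
  zero_mem' := by
    intro x _
    simp
  smul_mem' := by
    intro c a ha x hx
    simp [ha x hx]

/-! ### Piecewise-constant inputs -/

/-- Piecewise-constant inputs `(α₁,t₁)⋯(α_k,t_k)` with values in `U ⊆ ℝᵐ` and times `tᵢ ≥ 0`.
Concatenation is `++` and the empty input is `[]`. -/
abbrev Input {m : ℕ} (U : Set (Fin m → ℝ)) : Type := List (U × ℝ≥0)

variable {m n r d : ℕ} {U : Set (Fin m → ℝ)}

/-- The duration `T_u` of an input. -/
def duration (u : Input U) : ℝ := (u.map fun a => (a.2 : ℝ)).sum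

/-- Admissible sets of inputs: sets containing the empty input, closed under restriction of an input
to an initial time interval, allowing a short prolongation by every input value, and allowing
all switching times to be shortened at will and to be slightly lengthened. -/
structure IsAdmissible (A : Set (Input U)) : Prop where
  empty_mem : ([] : Input U) ∈ A
  restrict_mem : ∀ (w v : Input U) (α : U) (s t : ℝ≥0),
    w ++ (α, t) :: v ∈ A → s ≤ t → w ++ [(α, s)] ∈ A
  extend_mem : ∀ u ∈ A, ∀ α : U, ∃ t : ℝ≥0, 0 < t ∧ u ++ [(α, t)] ∈ A
  perturb_mem : ∀ u ∈ A, ∃ δ : ℝ≥0, 0 < δ ∧ ∀ v : Input U,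
    List.Forall₂ (fun a b => b.1 = a.1 ∧ b.2 ≤ a.2 + δ) u v → v ∈ A

/-- The input `(α₁,t₁)⋯(α_k,t_k)`, for `t` with nonnegative entries. -/
noncomputable def word {k : ℕ} (α : Fin k → U) (t : Fin k → ℝ) : Input U :=
  List.ofFn fun i => (α i, (t i).toNNReal)

/-- `p : A → ℝʳ` is a response map: each component is analytic in the switching times, on the set of
all `t ∈ [0,∞)ᵏ` for which `(α₁,t₁)⋯(α_k,t_k)` is in `A`. Values of `p` outside `A` are irrelevant. -/
def IsResponseMap (A : Set (Input U)) (p : Input U → Fin r → ℝ) : Prop :=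
  ∀ (k : ℕ), 0 < k → ∀ (α : Fin k → U) (j : Fin r),
    AnalyticOn ℝ (fun t : Fin k → ℝ => p (word α t) j) {t | (∀ i, 0 ≤ t i) ∧ word α t ∈ A}

/-- The domain of the shifted response map `p_u`. -/
def shiftDomain (A : Set (Input U)) (u : Input U) : Set (Input U) := {v | v ∈ A ∧ u ++ v ∈ A}

/-- The shifted response map `p_u`, `p_u(v) = p(uv)`. -/
def shift (p : Input U → Fin r → ℝ) (u : Input U) : Input U → Fin r → ℝ := fun v => p (u ++ v)

/-! ### Nash systems -/

/-- The data `(X, f, h, x₀)` of a control system with state space `X ⊆ ℝⁿ`, input values in `U`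
and outputs in `ℝʳ`. Only the values of `f α` and `h` on `X` matter. -/
structure ControlSystem {m : ℕ} (U : Set (Fin m → ℝ)) (n r : ℕ) where
  X : Set (Fin n → ℝ)
  f : U → (Fin n → ℝ) → (Fin n → ℝ)
  h : (Fin n → ℝ) → (Fin r → ℝ)
  x₀ : Fin n → ℝ

namespace ControlSystem

/-- `(X, f, h, x₀)` is a Nash system. -/
structure IsNashSystem (S : ControlSystem U n r) : Prop where
  isOpen : IsOpen S.X
  isConnected : IsConnected S.X
  isSemialgebraic : IsSemialgebraic S.X
  nash_f : ∀ α, IsNashMap S.X (S.f α)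
  nash_h : IsNashMap S.X S.h
  mem_x₀ : S.x₀ ∈ S.X

/-- `x : [0, T_u] → X` is a trajectory for the input `u`: it is continuous, starts at `x₀` and
satisfies `ẋ = f(x, αᵢ)` on the open time interval on which `u` takes its `i`-th value. -/
structure IsTrajectory (S : ControlSystem U n r) (u : Input U) (x : ℝ → (Fin n → ℝ)) : Prop where
  init : x 0 = S.x₀
  cont : ContinuousOn x (Icc 0 (duration u))
  mem : ∀ t ∈ Icc 0 (duration u), x t ∈ S.X
  deriv : ∀ (i : ℕ) (hi : i < u.length),
    ∀ t ∈ Ioo (duration (u.take i)) (duration (u.take (i + 1))),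
      HasDerivAt x (S.f (u[i]).1 (x t)) t

/-- There is exactly one trajectory `[0, T_u] → X` for the input `u`. -/
def HasUniqueTrajectory (S : ControlSystem U n r) (u : Input U) : Prop :=
  ∃ x, S.IsTrajectory u x ∧ ∀ y, S.IsTrajectory u y → EqOn y x (Icc 0 (duration u))

/-- The set of inputs of the system: the largest admissible set of inputs all of which have a unique
trajectory (a union of admissible sets is admissible). -/
def inputs (S : ControlSystem U n r) : Set (Input U) :=
  ⋃₀ {A | IsAdmissible A ∧ ∀ u ∈ A, S.HasUniqueTrajectory u}

open Classical in
/-- The state `x(t; x₀, u)` at time `t ∈ [0, T_u]`, for `u` having a trajectory. -/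
noncomputable def traj (S : ControlSystem U n r) (u : Input U) : ℝ → (Fin n → ℝ) :=
  if hx : ∃ x, S.IsTrajectory u x then hx.choose else fun _ => S.x₀

/-- The state `x(T_u; x₀, u)` reached by the input `u`. -/
noncomputable def endState (S : ControlSystem U n r) (u : Input U) : Fin n → ℝ :=
  S.traj u (duration u)

/-- The set of states reachable from `x₀`. -/
def reachable (S : ControlSystem U n r) : Set (Fin n → ℝ) := {x | ∃ u ∈ S.inputs, x = S.endState u}

/-- Semi-algebraic reachability: a Nash function vanishing on all reachable states is zero. -/
def IsSemialgReachable (S : ControlSystem U n r) : Prop :=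
  ∀ g : (Fin n → ℝ) → ℝ, IsNash S.X g → (∀ x ∈ S.reachable, g x = 0) → ∀ x ∈ S.X, g x = 0

/-- `S` is a local Nash realization of the response map `p : A → ℝʳ`. -/
structure IsLocalRealization (S : ControlSystem U n r) (A : Set (Input U))
    (p : Input U → Fin r → ℝ) : Prop where
  admissible : IsAdmissible A
  response : IsResponseMap A p
  nash : S.IsNashSystem
  realizes : ∀ u ∈ A ∩ S.inputs, p u = S.h (S.endState u)

/-! ### The steps of the reachability reduction -/

/-- Step 1: the components `φ₁, …, φ_d` of `Φ` are Nash functions on `X` whose classes form a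
transcendence basis of `N(X)/I` over `ℝ`, where `I` is the ideal of Nash functions vanishing on the
reachable set. -/
def StepOne (S : ControlSystem U n r) (Φ : (Fin n → ℝ) → (Fin d → ℝ)) : Prop :=
  ∃ hΦ : IsNashMap S.X Φ,
    IsTranscendenceBasis ℝ fun i : Fin d =>
      Ideal.Quotient.mk (vanishingIdeal S.X S.reachable) (hΦ i).toRing

/-- `Q ∈ ℝ[T, T₁, …, T_d]` (with `T` the variable of index `0`) is non-zero and `Q(πᵢ, Φ)` vanishes
on the reachable set. -/
def IsRelation (S : ControlSystem U n r) (Φ : (Fin n → ℝ) → (Fin d → ℝ)) (i : Fin n)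
    (Q : MvPolynomial (Fin (d + 1)) ℝ) : Prop :=
  Q ≠ 0 ∧ ∀ x ∈ S.reachable, MvPolynomial.eval (Fin.cons (x i) (Φ x) : Fin (d + 1) → ℝ) Q = 0

/-- Step 2, polynomials: each `Qᵢ` is a relation as above of the smallest possible degree, where the
degree is measured by `deg`. -/
def StepTwoPoly (S : ControlSystem U n r) (Φ : (Fin n → ℝ) → (Fin d → ℝ))
    (deg : MvPolynomial (Fin (d + 1)) ℝ → ℕ) (Q : Fin n → MvPolynomial (Fin (d + 1)) ℝ) : Prop :=
  ∀ i, S.IsRelation Φ i (Q i) ∧ ∀ Q', S.IsRelation Φ i Q' → deg (Q i) ≤ deg Q'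

/-- Step 2, input: `u` is an input of the system lying in the domain `A` of the response map, with
`T_u < ε` and `(∂Qᵢ/∂T)(πᵢ, Φ) ≠ 0` at the state reached by `u`, for all `i`. -/
structure StepTwoInput (S : ControlSystem U n r) (A : Set (Input U))
    (Φ : (Fin n → ℝ) → (Fin d → ℝ)) (Q : Fin n → MvPolynomial (Fin (d + 1)) ℝ) (ε : ℝ)
    (u : Input U) : Prop where
  mem : u ∈ A ∩ S.inputs
  duration_lt : duration u < ε
  pderiv_ne : ∀ i, MvPolynomial.eval
    (Fin.cons (S.endState u i) (Φ (S.endState u)) : Fin (d + 1) → ℝ)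
      (MvPolynomial.pderiv 0 (Q i)) ≠ 0

/-- Step 3: open semi-algebraic sets `V` (connected) and `W ⊆ X`, and a Nash map `G : V → W`, with
`Φ(x(T_u)) ∈ V`, `x(T_u) ∈ W`, and `G(Φ(x(T_{uv}; x₀, uv))) = x(T_{uv}; x₀, uv)` for every `v` such
that the trajectory for `uv` stays in `W` after time `T_u`. -/
structure StepThree (S : ControlSystem U n r) (Φ : (Fin n → ℝ) → (Fin d → ℝ)) (u : Input U)
    (V : Set (Fin d → ℝ)) (W : Set (Fin n → ℝ)) (G : (Fin d → ℝ) → (Fin n → ℝ)) : Prop where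
  isOpen_V : IsOpen V
  isSemialgebraic_V : IsSemialgebraic V
  isConnected_V : IsConnected V
  isOpen_W : IsOpen W
  isSemialgebraic_W : IsSemialgebraic W
  subset_W : W ⊆ S.X
  nash_G : IsNashMap V G
  mapsTo_G : MapsTo G V W
  mem_V : Φ (S.endState u) ∈ V
  mem_W : S.endState u ∈ W
  section_G : ∀ v : Input U, u ++ v ∈ S.inputs →
    (∀ t ∈ Icc 0 (duration v), S.traj (u ++ v) (duration u + t) ∈ W) →
      Φ (S.endState (u ++ v)) ∈ V ∧ G (Φ (S.endState (u ++ v))) = S.endState (u ++ v)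

/-- On `V × W`, the map `G` is the solution of the implicit equations `Qᵢ(qᵢ, z) = 0`, `i = 1,…,n`. -/
def IsImplicitSolution (Q : Fin n → MvPolynomial (Fin (d + 1)) ℝ) (V : Set (Fin d → ℝ))
    (W : Set (Fin n → ℝ)) (G : (Fin d → ℝ) → (Fin n → ℝ)) : Prop :=
  ∀ z ∈ V, ∀ q ∈ W,
    (∀ i, MvPolynomial.eval (Fin.cons (q i) z : Fin (d + 1) → ℝ) (Q i) = 0) ↔ q = G z

/-- Step 4: the reduced system `(V, f^V, h^V, x₀^V)` with `f^V_α(z) = DΦ(G(z)) f_α(G(z))`,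
`h^V(z) = h(G(z))` and `x₀^V = Φ(x(T_u; x₀, u))`. -/
noncomputable def reduced (S : ControlSystem U n r) (Φ : (Fin n → ℝ) → (Fin d → ℝ)) (u : Input U)
    (V : Set (Fin d → ℝ)) (G : (Fin d → ℝ) → (Fin n → ℝ)) : ControlSystem U d r where
  X := V
  f α z := fderiv ℝ Φ (G z) (S.f α (G z))
  h z := S.h (G z)
  x₀ := Φ (S.endState u)

end ControlSystem

end NashReach

/-! Everything rests on one density principle, `eq_zero_on_reachable`. If an analytic function
vanishes at the states reached from `x_u` by a family of continuations that contains the empty one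
and is closed under short prolongations (`IsProlongable`), then differentiating along the
prolongations shows that all its iterated Lie derivatives along the `f α` vanish at `x_u`.
Trajectories of analytic vector fields are analytic in time, so this property propagates along every
arc, forwards and backwards: from `x_u` back to `x₀` and on to every reachable state. The family may
be very small, for instance the short inputs in `A`, or the inputs that keep the state in a given
open set.

Consequences for steps 1 to 3: the ideal `I` is prime. A semi-algebraic function satisfies a
polynomial equation over the polynomials, so `N(X)/I` has a finite transcendence basis, chosen among
the coordinates. By algebraic independence `∂Q/∂T` is non-zero, and its degree is smaller than that
of `Q`, so by minimality it does not vanish on all reachable states. By primality neither does the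
product of the `n` derivatives, and by density it is non-zero after some short input in `A`. There
the implicit function theorem solves for the coordinates one by one, and the solution `G` inverts
`Φ` on nearby reachable states.

For step 4, as long as a trajectory stays in `W`, its image under `Φ` solves the reduced equation. A
non-zero Nash function on `V` has its zeros among those of a non-zero polynomial, and no non-zero
polynomial in `Φ` vanishes on the reachable set. Hence these images are dense enough for
semi-algebraic reachability. On such inputs the output identity is immediate; analyticity in the
switching times carries it to all other inputs common to `p_u` and the reduced system (`eq_output`).

Two tools are built beforehand: Tarski-Seidenberg by the Cohen-Hörmander method
(`exists_finset_sign_transfer`), which closes Nash functions under composition and partial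
derivatives, and analyticity of solutions up to the end points of their interval
(`analyticWithinAt_of_ode`). -/

namespace NashReach

/-! ### Elimination of one real variable -/

section Elimination

open Polynomial

variable {R : Type*} [CommRing R]

theorem natDegree_lt_of_coeff_eq_zero {p : R[X]} {m : ℕ} (hm : 0 < m) (hp : p.natDegree ≤ m)
    (h0 : p.coeff m = 0) : p.natDegree < m := by
  refine lt_of_le_of_ne hp fun h => ?_
  rw [← h, coeff_natDegree, leadingCoeff_eq_zero] at h0
  simp [h0] at h
  omega

/-- Pseudo-division with an even power of the leading coefficient of the divisor. -/
theorem exists_pseudoRemainder (q : R[X]) (hq : 0 < q.natDegree) (p : R[X]) :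
    ∃ r s : R[X], ∃ k : ℕ, C (q.leadingCoeff ^ (2 * k)) * p = s * q + r ∧
      r.natDegree < q.natDegree := by
  induction h : p.natDegree using Nat.strong_induction_on generalizing p with
  | _ m ih =>
    by_cases hlt : p.natDegree < q.natDegree
    · exact ⟨p, 0, 0, by simp, hlt⟩
    push Not at hlt
    have hm : 0 < m := by omega
    -- The additional factor `q.leadingCoeff` makes each reduction multiply `p` by a square. At a
    -- root of `q` the remainder then has the same sign as `p`.
    set p₁ : R[X] := C (q.leadingCoeff) * (C q.leadingCoeff * p
      - C p.leadingCoeff * X ^ (p.natDegree - q.natDegree) * q) with hp₁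
    have hdeg : p₁.natDegree < m := by
      refine natDegree_lt_of_coeff_eq_zero hm ?_ ?_
      · refine (natDegree_C_mul_le _ _).trans ((natDegree_sub_le _ _).trans (max_le ?_ ?_))
        · exact (natDegree_C_mul_le _ _).trans h.le
        · refine natDegree_mul_le.trans ?_
          have := natDegree_C_mul_X_pow_le p.leadingCoeff (p.natDegree - q.natDegree)
          omega
      · have : (C p.leadingCoeff * X ^ (p.natDegree - q.natDegree) * q).coeff m
            = p.leadingCoeff * q.leadingCoeff := by
          rw [mul_assoc, coeff_C_mul, coeff_X_pow_mul', if_pos (by omega)]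
          congr 1
          rw [leadingCoeff]
          congr 1
          omega
        rw [hp₁, coeff_C_mul, coeff_sub, coeff_C_mul, this, ← h, coeff_natDegree]
        ring
    obtain ⟨r, s, k, hrs, hr⟩ := ih _ hdeg p₁ rfl
    refine ⟨r, s + C (q.leadingCoeff ^ (2 * k)) * C q.leadingCoeff * C p.leadingCoeff *
      X ^ (p.natDegree - q.natDegree), k + 1, ?_, hr⟩
    rw [add_mul, add_right_comm, ← hrs, hp₁, show 2 * (k + 1) = 2 * k + 2 by ring, pow_add]
    simp only [map_mul, map_pow]
    ring

/-- A remainder of `p` under pseudo-division by `q`. -/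
noncomputable def pseudoRemainder (p q : R[X]) : R[X] :=
  if hq : 0 < q.natDegree then (exists_pseudoRemainder q hq p).choose else 0

theorem pseudoRemainder_spec {p q : R[X]} (hq : 0 < q.natDegree) :
    ∃ s : R[X], ∃ k : ℕ, C (q.leadingCoeff ^ (2 * k)) * p = s * q + pseudoRemainder p q := by
  rw [pseudoRemainder, dif_pos hq]
  obtain ⟨s, k, h⟩ := (exists_pseudoRemainder q hq p).choose_spec
  exact ⟨s, k, h.1⟩

theorem natDegree_pseudoRemainder_lt {p q : R[X]} (hq : 0 < q.natDegree) :
    (pseudoRemainder p q).natDegree < q.natDegree := by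
  rw [pseudoRemainder, dif_pos hq]
  obtain ⟨s, k, h⟩ := (exists_pseudoRemainder q hq p).choose_spec
  exact h.2

/-- `F` is closed under truncation, differentiation and pseudo-remainders, as far as polynomials of
degree at least `k` are concerned. -/
structure ClosedAbove (k : ℕ) (F : Finset R[X]) : Prop where
  eraseLead_mem : ∀ p ∈ F, k ≤ p.natDegree → 0 < p.natDegree → p.eraseLead ∈ F
  derivative_mem : ∀ p ∈ F, k ≤ p.natDegree → 0 < p.natDegree → derivative p ∈ F
  pseudoRemainder_mem : ∀ p ∈ F, ∀ q ∈ F, k ≤ q.natDegree → 0 < q.natDegree →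
    q.natDegree ≤ p.natDegree → pseudoRemainder p q ∈ F

theorem natDegree_eraseLead_lt' {p : R[X]} (hp : 0 < p.natDegree) :
    p.eraseLead.natDegree < p.natDegree := by
  have := eraseLead_natDegree_le p
  omega

/-- Each of the three operations lowers the degree, so the closure is built from the top degree
downwards. Closing at level `k` adds only polynomials of degree less than `k`, which leaves the
levels already treated intact; after finitely many levels the process ends. -/
theorem exists_closedAbove_zero (D : Finset R[X]) : ∃ F : Finset R[X], D ⊆ F ∧ ClosedAbove 0 F := by
  classical
  set N := D.sup natDegree
  suffices H : ∀ j, ∃ F : Finset R[X], D ⊆ F ∧ (∀ p ∈ F, p.natDegree ≤ N) ∧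
      ClosedAbove (N + 1 - j) F by
    obtain ⟨F, hD, -, hF⟩ := H (N + 1)
    exact ⟨F, hD, by simpa using hF⟩
  intro j
  induction j with
  | zero =>
    have hN : ∀ p ∈ D, p.natDegree ≤ N := fun p hp => Finset.le_sup (f := natDegree) hp
    refine ⟨D, Finset.Subset.refl _, hN, ?_, ?_, ?_⟩
    · intro p hp h
      have := hN p hp
      omega
    · intro p hp h
      have := hN p hp
      omega
    · intro p _ q hq h
      have := hN q hq
      omega
  | succ j ih =>
    obtain ⟨F, hD, hN, hF⟩ := ih
    by_cases hj : N + 1 ≤ j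
    · exact ⟨F, hD, hN, by rwa [show N + 1 - (j + 1) = N + 1 - j by omega]⟩
    set k := N + 1 - (j + 1) with hk
    rw [show N + 1 - j = k + 1 by omega] at hF
    set P := F.filter (fun p => p.natDegree = k ∧ 0 < k) with hP
    set F' := F ∪ P.image eraseLead ∪ P.image derivative ∪
      (F ×ˢ P).image (fun x => pseudoRemainder x.1 x.2) with hF'
    have hmem : ∀ p, p ∈ F' → p ∈ F ∨ p.natDegree < k := by
      intro p hp
      simp only [hF', hP, Finset.mem_union, Finset.mem_image, Finset.mem_filter, Finset.mem_product,
        Prod.exists] at hp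
      rcases hp with ((hp | ⟨q, ⟨_, h1, h2⟩, rfl⟩) | ⟨q, ⟨_, h1, h2⟩, rfl⟩) | ⟨a, q, ⟨_, _, h1, h2⟩, rfl⟩
      · exact Or.inl hp
      · exact Or.inr (h1 ▸ natDegree_eraseLead_lt' (by omega))
      · exact Or.inr (h1 ▸ natDegree_derivative_lt (by omega))
      · exact Or.inr (h1 ▸ natDegree_pseudoRemainder_lt (by omega))
    have hFF' : F ⊆ F' := fun p hp => by simp [hF', hp]
    refine ⟨F', hD.trans hFF', ?_, ?_, ?_, ?_⟩
    · intro p hp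
      rcases hmem p hp with h | h
      · exact hN p h
      · omega
    · intro p hp h h0
      rcases hmem p hp with hp | hp
      · rcases h.eq_or_lt with h | h
        · have : p ∈ P := by simp [hP, hp, h, h0]
          simp only [hF', Finset.mem_union]
          exact Or.inl (Or.inl (Or.inr (Finset.mem_image_of_mem _ this)))
        · exact hFF' (hF.eraseLead_mem p hp h h0)
      · omega
    · intro p hp h h0
      rcases hmem p hp with hp | hp
      · rcases h.eq_or_lt with h | h
        · have : p ∈ P := by simp [hP, hp, h, h0]
          simp only [hF', Finset.mem_union]
          exact Or.inl (Or.inr (Finset.mem_image_of_mem _ this))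
        · exact hFF' (hF.derivative_mem p hp h h0)
      · omega
    · intro p hp q hq h h0 hpq
      rcases hmem p hp with hp | hp
      · rcases hmem q hq with hq | hq
        · rcases h.eq_or_lt with h | h
          · have : q ∈ P := by simp [hP, hq, h, h0]
            simp only [hF', Finset.mem_union]
            exact Or.inr (Finset.mem_image.2 ⟨(p, q), by simp [hp, this], rfl⟩)
          · exact hFF' (hF.pseudoRemainder_mem p hp q hq h h0 hpq)
        · omega
      · omega

/-! ### Matching the sign tables of two specializations -/

/-- Two polynomials have matching signs at two points, under two specializations. -/
def SameSign (σ τ : R →+* ℝ) (p : R[X]) (a a' : ℝ) : Prop :=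
  SignType.sign (p.eval₂ σ a) = SignType.sign (p.eval₂ τ a')

/-- The sign tables of the polynomials of `B` under two specializations agree on two open intervals:
the intervals can be subdivided at corresponding roots. -/
inductive Similar (σ τ : R →+* ℝ) (B : Set R[X]) : ℝ → ℝ → ℝ → ℝ → Prop
  | gap {lo hi lo' hi' : ℝ} (hlt : lo < hi) (hlt' : lo' < hi')
      (h : ∀ p ∈ B, ∃ s : SignType, (∀ y ∈ Ioo lo hi, SignType.sign (p.eval₂ σ y) = s) ∧
        ∀ y ∈ Ioo lo' hi', SignType.sign (p.eval₂ τ y) = s) : Similar σ τ B lo hi lo' hi'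
  | split {lo hi lo' hi' a a' : ℝ} (hs : ∀ p ∈ B, SameSign σ τ p a a')
      (hr : ∃ q ∈ B, q.eval₂ σ a = 0) (h₁ : Similar σ τ B lo a lo' a')
      (h₂ : Similar σ τ B a hi a' hi') : Similar σ τ B lo hi lo' hi'

namespace Similar

variable {σ τ : R →+* ℝ} {B : Set R[X]} {lo hi lo' hi' : ℝ}

theorem lt' (h : Similar σ τ B lo hi lo' hi') : lo' < hi' := by
  induction h with
  | gap _ h => exact h
  | split _ _ _ _ h₁ h₂ => exact h₁.trans h₂

theorem exists_sameSign (h : Similar σ τ B lo hi lo' hi') {y : ℝ} (hy : y ∈ Ioo lo hi) :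
    ∃ y' ∈ Ioo lo' hi', ∀ p ∈ B, SameSign σ τ p y y' := by
  induction h with
  | gap hlt hlt' h =>
    refine ⟨_, ⟨left_lt_add_div_two.2 hlt', add_div_two_lt_right.2 hlt'⟩, fun p hp => ?_⟩
    obtain ⟨s, h₁, h₂⟩ := h p hp
    rw [SameSign, h₁ _ hy, h₂ _ ⟨left_lt_add_div_two.2 hlt', add_div_two_lt_right.2 hlt'⟩]
  | @split lo hi lo' hi' a a' hs hr h₁ h₂ ih₁ ih₂ =>
    rcases lt_trichotomy y a with h | rfl | h
    · obtain ⟨y', hy', H⟩ := ih₁ ⟨hy.1, h⟩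
      exact ⟨y', ⟨hy'.1, hy'.2.trans h₂.lt'⟩, H⟩
    · exact ⟨a', ⟨h₁.lt', h₂.lt'⟩, hs⟩
    · obtain ⟨y', hy', H⟩ := ih₂ ⟨h, hy.2⟩
      exact ⟨y', ⟨h₁.lt'.trans hy'.1, hy'.2⟩, H⟩

theorem insert_of_forall (h : Similar σ τ B lo hi lo' hi') {p : R[X]} {s : SignType}
    (hσ : ∀ y, SignType.sign (p.eval₂ σ y) = s) (hτ : ∀ y, SignType.sign (p.eval₂ τ y) = s) :
    Similar σ τ (insert p B) lo hi lo' hi' := by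
  induction h with
  | gap hlt hlt' h =>
    refine .gap hlt hlt' fun q hq => ?_
    rcases hq with rfl | hq
    · exact ⟨s, fun y _ => hσ y, fun y _ => hτ y⟩
    · exact h q hq
  | split hs hr h₁ h₂ ih₁ ih₂ =>
    refine .split ?_ ?_ ih₁ ih₂
    · rintro q (rfl | hq)
      · rw [SameSign, hσ, hτ]
      · exact hs q hq
    · obtain ⟨q, hq, h⟩ := hr
      exact ⟨q, Or.inr hq, h⟩

end Similar

theorem sign_alternatives_of_strictMonoOn {F : ℝ → ℝ} {lo hi : ℝ} (hlt : lo < hi)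
    (hc : ContinuousOn F (Icc lo hi)) (hF : StrictMonoOn F (Icc lo hi)) :
    (0 ≤ F lo → ∀ y ∈ Ioo lo hi, 0 < F y) ∧ (F hi ≤ 0 → ∀ y ∈ Ioo lo hi, F y < 0) ∧
    (F lo < 0 → 0 < F hi → ∃ c ∈ Ioo lo hi, F c = 0 ∧ (∀ y ∈ Ioo lo c, F y < 0) ∧
      ∀ y ∈ Ioo c hi, 0 < F y) := by
  have hl : lo ∈ Icc lo hi := left_mem_Icc.2 hlt.le
  have hr : hi ∈ Icc lo hi := right_mem_Icc.2 hlt.le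
  refine ⟨fun h y hy => h.trans_lt (hF hl (Ioo_subset_Icc_self hy) hy.1),
    fun h y hy => (hF (Ioo_subset_Icc_self hy) hr hy.2).trans_le h, fun h1 h2 => ?_⟩
  obtain ⟨c, hcm, hc0⟩ := intermediate_value_Ioo hlt.le hc ⟨h1, h2⟩
  refine ⟨c, hcm, hc0, fun y hy => ?_, fun y hy => ?_⟩
  · rw [← hc0]
    exact hF ⟨hy.1.le, hy.2.le.trans hcm.2.le⟩ (Ioo_subset_Icc_self hcm) hy.2
  · rw [← hc0]
    exact hF (Ioo_subset_Icc_self hcm) ⟨hcm.1.le.trans hy.1.le, hy.2.le⟩ hy.1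

/-- A strictly increasing continuous function has either constant sign on the open interval or
exactly one zero there, and the signs at the two end points decide which case occurs. Equal end
signs therefore force equal sign patterns. -/
theorem sign_match_of_strictMonoOn {F G : ℝ → ℝ} {lo hi lo' hi' : ℝ} (hlt : lo < hi)
    (hlt' : lo' < hi') (hFc : ContinuousOn F (Icc lo hi)) (hGc : ContinuousOn G (Icc lo' hi'))
    (hF : StrictMonoOn F (Icc lo hi)) (hG : StrictMonoOn G (Icc lo' hi'))
    (h₁ : SignType.sign (F lo) = SignType.sign (G lo'))
    (h₂ : SignType.sign (F hi) = SignType.sign (G hi')) :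
    (∃ s : SignType, (∀ y ∈ Ioo lo hi, SignType.sign (F y) = s) ∧
      ∀ y ∈ Ioo lo' hi', SignType.sign (G y) = s) ∨
    ∃ c ∈ Ioo lo hi, ∃ c' ∈ Ioo lo' hi', F c = 0 ∧ G c' = 0 ∧
      ∃ s t : SignType, (∀ y ∈ Ioo lo c, SignType.sign (F y) = s) ∧
      (∀ y ∈ Ioo lo' c', SignType.sign (G y) = s) ∧ (∀ y ∈ Ioo c hi, SignType.sign (F y) = t) ∧
      (∀ y ∈ Ioo c' hi', SignType.sign (G y) = t) := by
  obtain ⟨a1, a2, a3⟩ := sign_alternatives_of_strictMonoOn hlt hFc hF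
  obtain ⟨b1, b2, b3⟩ := sign_alternatives_of_strictMonoOn hlt' hGc hG
  have e1 : F lo < 0 ↔ G lo' < 0 := by rw [← sign_eq_neg_one_iff, h₁, sign_eq_neg_one_iff]
  have e2 : 0 < F hi ↔ 0 < G hi' := by rw [← sign_eq_one_iff, h₂, sign_eq_one_iff]
  by_cases c1 : F lo < 0
  · by_cases c2 : 0 < F hi
    · obtain ⟨c, hc, hc0, hl, hr⟩ := a3 c1 c2
      obtain ⟨c', hc', hc0', hl', hr'⟩ := b3 (e1.1 c1) (e2.1 c2)
      exact Or.inr ⟨c, hc, c', hc', hc0, hc0', -1, 1, fun y hy => sign_neg (hl y hy),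
        fun y hy => sign_neg (hl' y hy), fun y hy => sign_pos (hr y hy),
        fun y hy => sign_pos (hr' y hy)⟩
    · exact Or.inl ⟨-1, fun y hy => sign_neg (a2 (not_lt.1 c2) y hy),
        fun y hy => sign_neg (b2 (not_lt.1 (mt e2.2 c2)) y hy)⟩
  · exact Or.inl ⟨1, fun y hy => sign_pos (a1 (not_lt.1 c1) y hy),
      fun y hy => sign_pos (b1 (not_lt.1 (mt e1.2 c1)) y hy)⟩

theorem sign_match_of_strictAntiOn {F G : ℝ → ℝ} {lo hi lo' hi' : ℝ} (hlt : lo < hi)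
    (hlt' : lo' < hi') (hFc : ContinuousOn F (Icc lo hi)) (hGc : ContinuousOn G (Icc lo' hi'))
    (hF : StrictAntiOn F (Icc lo hi)) (hG : StrictAntiOn G (Icc lo' hi'))
    (h₁ : SignType.sign (F lo) = SignType.sign (G lo'))
    (h₂ : SignType.sign (F hi) = SignType.sign (G hi')) :
    (∃ s : SignType, (∀ y ∈ Ioo lo hi, SignType.sign (F y) = s) ∧
      ∀ y ∈ Ioo lo' hi', SignType.sign (G y) = s) ∨
    ∃ c ∈ Ioo lo hi, ∃ c' ∈ Ioo lo' hi', F c = 0 ∧ G c' = 0 ∧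
      ∃ s t : SignType, (∀ y ∈ Ioo lo c, SignType.sign (F y) = s) ∧
      (∀ y ∈ Ioo lo' c', SignType.sign (G y) = s) ∧ (∀ y ∈ Ioo c hi, SignType.sign (F y) = t) ∧
      (∀ y ∈ Ioo c' hi', SignType.sign (G y) = t) := by
  have key := sign_match_of_strictMonoOn (F := fun y => -F y) (G := fun y => -G y) hlt hlt'
    hFc.neg hGc.neg hF.neg hG.neg (by simp [Left.sign_neg, h₁]) (by simp [Left.sign_neg, h₂])
  simp only [Left.sign_neg, neg_eq_iff_eq_neg, neg_zero] at key
  rcases key with ⟨s, a, b⟩ | ⟨c, hc, c', hc', h, h', s, t, a1, a2, a3, a4⟩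
  · exact Or.inl ⟨-s, a, b⟩
  · exact Or.inr ⟨c, hc, c', hc', h, h', -s, -t, a1, a2, a3, a4⟩

theorem exists_mem_Ioo_eval₂_ne_zero {σ : R →+* ℝ} {d : R[X]} (hd : d.map σ ≠ 0) {lo hi : ℝ}
    (hlt : lo < hi) : ∃ y ∈ Ioo lo hi, d.eval₂ σ y ≠ 0 := by
  by_contra! H
  refine hd (eq_zero_of_infinite_isRoot _ ((Ioo_infinite hlt).mono fun y hy => ?_))
  simp [IsRoot, eval_map, H y hy]

/-- On a gap of the table the derivative of `p`, represented by `d`, has one constant sign, non-zero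
because `d.map σ ≠ 0`. So `p` is strictly monotone there under both specializations and contributes
at most one new root, the same way on both sides. At old subdivision points the sign of `p` comes
from `H`; this is why `split` records that such a point is a root of a member of `B`. -/
theorem Similar.insert {σ τ : R →+* ℝ} {B : Set R[X]} {lo hi lo' hi' : ℝ}
    (h : Similar σ τ B lo hi lo' hi') {p d : R[X]}
    (hd : d ∈ B) (hdσ : d.map σ = derivative (p.map σ)) (hdτ : d.map τ = derivative (p.map τ))
    (hd0 : d.map σ ≠ 0)
    (H : ∀ a a', (∀ b ∈ B, SameSign σ τ b a a') → (∃ q ∈ B, q.eval₂ σ a = 0) → SameSign σ τ p a a')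
    (h₁ : SameSign σ τ p lo lo') (h₂ : SameSign σ τ p hi hi') :
    Similar σ τ (insert p B) lo hi lo' hi' := by
  induction h with
  | @gap lo hi lo' hi' hlt hlt' h =>
    obtain ⟨s, ha, hb⟩ := h d hd
    have hs : s ≠ 0 := by
      rintro rfl
      obtain ⟨y, hy, hne⟩ := exists_mem_Ioo_eval₂_ne_zero hd0 hlt
      exact hne (sign_eq_zero_iff.1 (ha y hy))
    have hcont : ∀ (ρ : R →+* ℝ) (s : Set ℝ), ContinuousOn (fun y => p.eval₂ ρ y) s := by
      intro ρ s
      simp only [← eval_map]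
      exact (p.map ρ).continuous.continuousOn
    have hder : ∀ ρ : R →+* ℝ, d.map ρ = derivative (p.map ρ) → ∀ y,
        deriv (fun y => p.eval₂ ρ y) y = d.eval₂ ρ y := by
      intro ρ hρ y
      simp only [← eval_map]
      rw [hρ, Polynomial.deriv]
    have key : (∃ s : SignType, (∀ y ∈ Ioo lo hi, SignType.sign (p.eval₂ σ y) = s) ∧
        ∀ y ∈ Ioo lo' hi', SignType.sign (p.eval₂ τ y) = s) ∨
      ∃ c ∈ Ioo lo hi, ∃ c' ∈ Ioo lo' hi', p.eval₂ σ c = 0 ∧ p.eval₂ τ c' = 0 ∧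
        ∃ s t : SignType, (∀ y ∈ Ioo lo c, SignType.sign (p.eval₂ σ y) = s) ∧
        (∀ y ∈ Ioo lo' c', SignType.sign (p.eval₂ τ y) = s) ∧
        (∀ y ∈ Ioo c hi, SignType.sign (p.eval₂ σ y) = t) ∧
        (∀ y ∈ Ioo c' hi', SignType.sign (p.eval₂ τ y) = t) := by
      cases s with
      | zero => exact absurd rfl hs
      | pos =>
        refine sign_match_of_strictMonoOn hlt hlt' (hcont σ _) (hcont τ _) ?_ ?_ h₁ h₂
        · refine strictMonoOn_of_deriv_pos (convex_Icc _ _) (hcont σ _) fun y hy => ?_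
          rw [interior_Icc] at hy
          rw [hder σ hdσ]
          exact sign_eq_one_iff.1 (ha y hy)
        · refine strictMonoOn_of_deriv_pos (convex_Icc _ _) (hcont τ _) fun y hy => ?_
          rw [interior_Icc] at hy
          rw [hder τ hdτ]
          exact sign_eq_one_iff.1 (hb y hy)
      | neg =>
        refine sign_match_of_strictAntiOn hlt hlt' (hcont σ _) (hcont τ _) ?_ ?_ h₁ h₂
        · refine strictAntiOn_of_deriv_neg (convex_Icc _ _) (hcont σ _) fun y hy => ?_
          rw [interior_Icc] at hy
          rw [hder σ hdσ]
          exact sign_eq_neg_one_iff.1 (ha y hy)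
        · refine strictAntiOn_of_deriv_neg (convex_Icc _ _) (hcont τ _) fun y hy => ?_
          rw [interior_Icc] at hy
          rw [hder τ hdτ]
          exact sign_eq_neg_one_iff.1 (hb y hy)
    rcases key with ⟨s, h₁, h₂⟩ | ⟨c, hc, c', hc', h0, h0', s, t, k₁, k₂, k₃, k₄⟩
    · refine .gap hlt hlt' ?_
      rintro q (rfl | hq)
      · exact ⟨s, h₁, h₂⟩
      · exact h q hq
    · refine .split (a := c) (a' := c') ?_ ⟨p, Or.inl rfl, h0⟩ (.gap hc.1 hc'.1 ?_)
        (.gap hc.2 hc'.2 ?_)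
      · rintro q (rfl | hq)
        · rw [SameSign, h0, h0']
        · obtain ⟨s, ha, hb⟩ := h q hq
          rw [SameSign, ha c hc, hb c' hc']
      · rintro q (rfl | hq)
        · exact ⟨s, k₁, k₂⟩
        · obtain ⟨s, ha, hb⟩ := h q hq
          exact ⟨s, fun y hy => ha y ⟨hy.1, hy.2.trans hc.2⟩, fun y hy => hb y ⟨hy.1, hy.2.trans hc'.2⟩⟩
      · rintro q (rfl | hq)
        · exact ⟨t, k₃, k₄⟩
        · obtain ⟨s, ha, hb⟩ := h q hq
          exact ⟨s, fun y hy => ha y ⟨hc.1.trans hy.1, hy.2⟩, fun y hy => hb y ⟨hc'.1.trans hy.1, hy.2⟩⟩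
  | @split lo hi lo' hi' a a' hs hr k₁ k₂ ih₁ ih₂ =>
    have := H a a' hs hr
    refine .split ?_ ?_ (ih₁ h₁ this) (ih₂ this h₂)
    · rintro q (rfl | hq)
      · exact this
      · exact hs q hq
    · obtain ⟨q, hq, h⟩ := hr
      exact ⟨q, Or.inr hq, h⟩

/-- Truncation to a polynomial whose leading coefficient survives the specializations. -/
theorem ClosedAbove.exists_reduced {F : Finset R[X]} (hF : ClosedAbove 0 F) {σ τ : R →+* ℝ}
    (hlc : ∀ p ∈ F, σ p.leadingCoeff = 0 ↔ τ p.leadingCoeff = 0) {p : R[X]} (hp : p ∈ F) :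
    ∃ p', (p' = 0 ∨ p' ∈ F ∧ σ p'.leadingCoeff ≠ 0) ∧ p'.natDegree ≤ p.natDegree ∧
      p'.map σ = p.map σ ∧ p'.map τ = p.map τ := by
  induction h : p.natDegree using Nat.strong_induction_on generalizing p with
  | _ m ih =>
    by_cases hl : σ p.leadingCoeff = 0
    · have hred : ∀ ρ : R →+* ℝ, ρ p.leadingCoeff = 0 → p.map ρ = p.eraseLead.map ρ := by
        intro ρ h0
        have e := congrArg (Polynomial.map ρ) p.eraseLead_add_C_mul_X_pow
        rw [Polynomial.map_add, Polynomial.map_mul, Polynomial.map_C, h0, C_0, zero_mul,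
          add_zero] at e
        exact e.symm
      rcases Nat.eq_zero_or_pos p.natDegree with h0 | h0
      · refine ⟨0, Or.inl rfl, by simp, ?_, ?_⟩
        · rw [hred σ hl, eq_C_of_natDegree_eq_zero h0]; simp
        · rw [hred τ ((hlc p hp).1 hl), eq_C_of_natDegree_eq_zero h0]; simp
      · obtain ⟨p', h1, h2, h3, h4⟩ := ih _ (h ▸ natDegree_eraseLead_lt' h0)
          (hF.eraseLead_mem p hp (Nat.zero_le _) h0) rfl
        refine ⟨p', h1, ?_, h3.trans (hred σ hl).symm, h4.trans (hred τ ((hlc p hp).1 hl)).symm⟩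
        have := natDegree_eraseLead_lt' h0
        omega
    · exact ⟨p, Or.inr ⟨hp, hl⟩, h.le, rfl, rfl⟩

theorem eventually_atTop_sign_eval {P : ℝ[X]} (hP : P ≠ 0) :
    ∀ᶠ y in Filter.atTop, SignType.sign (P.eval y) = SignType.sign P.leadingCoeff := by
  rcases Nat.eq_zero_or_pos P.natDegree with h | h
  · rw [eq_C_of_natDegree_eq_zero h]
    simp
  · have hdeg : 0 < P.degree := natDegree_pos_iff_degree_pos.1 h
    rcases lt_or_gt_of_ne (leadingCoeff_ne_zero.2 hP) with hl | hl
    · filter_upwards [(P.tendsto_atBot_of_leadingCoeff_nonpos hdeg hl.le).eventually_lt_atBot 0]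
        with y hy
      rw [sign_neg hy, sign_neg hl]
    · filter_upwards [(P.tendsto_atTop_of_leadingCoeff_nonneg hdeg hl.le).eventually_gt_atTop 0]
        with y hy
      rw [sign_pos hy, sign_pos hl]

theorem eventually_atTop_sign_eval_neg {P : ℝ[X]} (hP : P ≠ 0) :
    ∀ᶠ y in Filter.atTop, SignType.sign (P.eval (-y)) =
      SignType.sign (P.leadingCoeff * (-1) ^ P.natDegree) := by
  have h := eventually_atTop_sign_eval (P := P.comp (-X)) (by
    intro h0
    apply hP
    have := congrArg (fun P : ℝ[X] => P.comp (-X)) h0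
    simpa [comp_assoc] using this)
  simpa [leadingCoeff_comp (q := -X) (p := P) (by simp), mul_comm] using h

theorem map_ne_zero_of_leadingCoeff {σ : R →+* ℝ} {p : R[X]} (h : σ p.leadingCoeff ≠ 0) :
    p.map σ ≠ 0 := fun h0 => h (by rw [leadingCoeff, ← coeff_map, h0, coeff_zero])

/-- The members of `F` whose leading coefficient survives the specialization `σ`. -/
def survivors (σ : R →+* ℝ) (F : Finset R[X]) : Set R[X] := {p | p ∈ F ∧ σ p.leadingCoeff ≠ 0}

/-- Far out on either side the leading term decides all signs, so the comparison of sign tables can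
be confined to a bounded interval. -/
theorem eventually_sign_survivors (σ : R →+* ℝ) (F : Finset R[X]) :
    ∀ᶠ M in Filter.atTop, ∀ p ∈ survivors σ F,
      SignType.sign (p.eval₂ σ M) = SignType.sign (σ p.leadingCoeff) ∧
      SignType.sign (p.eval₂ σ (-M)) =
        SignType.sign (σ p.leadingCoeff) * (-1) ^ p.natDegree := by
  have : ∀ p ∈ F, ∀ᶠ M in Filter.atTop, σ p.leadingCoeff ≠ 0 →
      SignType.sign (p.eval₂ σ M) = SignType.sign (σ p.leadingCoeff) ∧
      SignType.sign (p.eval₂ σ (-M)) = SignType.sign (σ p.leadingCoeff) * (-1) ^ p.natDegree := by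
    intro p _
    by_cases h : σ p.leadingCoeff = 0
    · simp [h]
    have hlc := leadingCoeff_map_of_leadingCoeff_ne_zero σ h
    have hdeg := natDegree_map_of_leadingCoeff_ne_zero σ h
    filter_upwards [eventually_atTop_sign_eval (map_ne_zero_of_leadingCoeff h),
      eventually_atTop_sign_eval_neg (map_ne_zero_of_leadingCoeff h)] with M h1 h2 _
    rw [eval_map, hlc] at h1
    rw [eval_map, hlc, hdeg, sign_mul, sign_pow, Left.sign_neg, sign_one] at h2
    exact ⟨h1, h2⟩
  filter_upwards [(Finset.eventually_all F).2 this] with M hM p hp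
  exact hM p hp.1 hp.2

/-- The Cohen-Hörmander induction: the polynomials enter the table by increasing degree. The
derivative of a new `p`, truncated to its surviving part, is already present. At a root of a present
`q`, the sign of `p` is that of its pseudo-remainder by `q`, whose truncation has smaller degree
than `q` and is present as well. -/
theorem ClosedAbove.similar_survivors {F : Finset R[X]} (hF : ClosedAbove 0 F) {σ τ : R →+* ℝ}
    (hlc : ∀ p ∈ F, SignType.sign (σ p.leadingCoeff) = SignType.sign (τ p.leadingCoeff))
    {lo hi lo' hi' : ℝ} (hlt : lo < hi) (hlt' : lo' < hi')
    (h₁ : ∀ p ∈ survivors σ F, SameSign σ τ p lo lo')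
    (h₂ : ∀ p ∈ survivors σ F, SameSign σ τ p hi hi') :
    Similar σ τ (survivors σ F) lo hi lo' hi' := by
  classical
  have hlc' : ∀ p ∈ F, σ p.leadingCoeff = 0 ↔ τ p.leadingCoeff = 0 := by
    intro p hp
    rw [← sign_eq_zero_iff, hlc p hp, sign_eq_zero_iff]
  have heval : ∀ (ρ : R →+* ℝ) (p q : R[X]), p.map ρ = q.map ρ → ∀ y, p.eval₂ ρ y = q.eval₂ ρ y := by
    intro ρ p q h y
    rw [← eval_map, h, eval_map]
  suffices key : ∀ k, Similar σ τ {p | p ∈ survivors σ F ∧ p.natDegree < k} lo hi lo' hi' by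
    convert key (F.sup natDegree + 1) using 1
    ext p
    simp only [mem_ofPred_eq, iff_self_and]
    exact fun hp => Nat.lt_succ_of_le (Finset.le_sup (f := natDegree) hp.1)
  intro k
  induction k with
  | zero => exact .gap hlt hlt' (by simp)
  | succ k ih =>
    -- Polynomials of equal degree are inserted one at a time. A root in the table may belong to
    -- another polynomial of degree `k`, which is harmless since remainders still have degree less
    -- than `k`.
    suffices key : ∀ T : Finset R[X], (∀ p ∈ T, p ∈ survivors σ F ∧ p.natDegree = k) →
        Similar σ τ ({p | p ∈ survivors σ F ∧ p.natDegree < k} ∪ T) lo hi lo' hi' by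
      convert key (F.filter fun p => σ p.leadingCoeff ≠ 0 ∧ p.natDegree = k) (by
        intro p hp
        simp only [Finset.mem_filter] at hp
        exact ⟨⟨hp.1, hp.2.1⟩, hp.2.2⟩) using 1
      ext p
      simp only [survivors, mem_ofPred_eq, Order.lt_add_one_iff, ne_eq, Finset.coe_filter, mem_union,
        le_iff_lt_or_eq]
      tauto
    intro T
    induction T using Finset.induction_on with
    | empty => intro _; simpa using ih
    | insert p T hpT ihT =>
      intro hT
      have hB := ihT fun q hq => hT q (Finset.mem_insert_of_mem hq)
      obtain ⟨⟨hpF, hpσ⟩, hpk⟩ := hT p (Finset.mem_insert_self _ _)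
      rw [Finset.coe_insert, union_insert]
      rcases Nat.eq_zero_or_pos k with rfl | hk
      · have hp := eq_C_of_natDegree_eq_zero hpk
        refine hB.insert_of_forall (s := SignType.sign (σ p.leadingCoeff)) (fun y => ?_) fun y => ?_
        · rw [leadingCoeff, hpk]
          conv_lhs => rw [hp]
          simp
        · rw [hlc p hpF, leadingCoeff, hpk]
          conv_lhs => rw [hp]
          simp
      have hsub : ∀ q ∈ ({p | p ∈ survivors σ F ∧ p.natDegree < k} ∪ T : Set R[X]),
          q ∈ survivors σ F ∧ q.natDegree ≤ k := by
        rintro q (hq | hq)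
        · exact ⟨hq.1, hq.2.le⟩
        · have := hT q (Finset.mem_insert_of_mem hq)
          exact ⟨this.1, this.2.le⟩
      obtain ⟨d, hd, hdle, hdσ, hdτ⟩ := hF.exists_reduced hlc'
        (hF.derivative_mem p hpF (Nat.zero_le _) (by omega))
      have hdne : d.map σ ≠ 0 := by
        rw [hdσ, ← derivative_map]
        intro h0
        have := derivative_eq_zero.1 h0
        rw [natDegree_map_of_leadingCoeff_ne_zero σ hpσ] at this
        omega
      have hdS : d ∈ survivors σ F := by
        rcases hd with rfl | hd
        · simp at hdne
        · exact hd
      have hdk : d.natDegree < k := by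
        have := natDegree_derivative_lt (p := p) (by omega)
        omega
      refine hB.insert (d := d) (Or.inl ⟨hdS, hdk⟩) (by rw [hdσ, derivative_map])
        (by rw [hdτ, derivative_map]) hdne ?_ (h₁ p ⟨hpF, hpσ⟩) (h₂ p ⟨hpF, hpσ⟩)
      rintro a a' hsign ⟨q, hq, hqa⟩
      obtain ⟨⟨hqF, hqσ⟩, hqk⟩ := hsub q hq
      have hqa' : q.eval₂ τ a' = 0 := by
        have := hsign q hq
        rwa [SameSign, hqa, sign_zero, eq_comm, sign_eq_zero_iff] at this
      -- A constant whose leading coefficient survives `σ` has no root.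
      have hq0 : 0 < q.natDegree := by
        rcases Nat.eq_zero_or_pos q.natDegree with h | h
        · exfalso
          apply hqσ
          rw [eq_C_of_natDegree_eq_zero h, eval₂_C] at hqa
          rwa [leadingCoeff, h]
        · exact h
      obtain ⟨s, j, hj⟩ := pseudoRemainder_spec (p := p) hq0
      obtain ⟨r, hr, hrle, hrσ, hrτ⟩ := hF.exists_reduced hlc'
        (hF.pseudoRemainder_mem p hpF q hqF (Nat.zero_le _) hq0 (by omega))
      have hrk : r.natDegree < k := by
        have := natDegree_pseudoRemainder_lt (p := p) hq0
        omega
      have hrs : SameSign σ τ r a a' := by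
        rcases hr with rfl | hr
        · simp [SameSign]
        · exact hsign r (Or.inl ⟨hr, hrk⟩)
      have hsgn : ∀ (ρ : R →+* ℝ) (b : ℝ), ρ q.leadingCoeff ≠ 0 → q.eval₂ ρ b = 0 →
          r.map ρ = (pseudoRemainder p q).map ρ →
          SignType.sign (p.eval₂ ρ b) = SignType.sign (r.eval₂ ρ b) := by
        intro ρ b hρ hb hrρ
        have := congrArg (eval₂ ρ b) hj
        rw [eval₂_mul, eval₂_add, eval₂_mul, hb, mul_zero, zero_add, ← heval ρ _ _ hrρ, eval₂_C,
          map_pow, pow_mul] at this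
        rw [← this, sign_mul, sign_pos (a := (ρ q.leadingCoeff ^ 2) ^ j) (by positivity), one_mul]
      rw [SameSign, hsgn σ a hqσ hqa hrσ, hrs, hsgn τ a' (mt (hlc' q hqF).2 hqσ) hqa' hrτ]

/-- **Elimination of a real variable**: the sign conditions which a finite family of polynomials in
one variable can realize depend only on the signs of finitely many expressions in the
coefficients. -/
theorem exists_finset_sign_transfer (D : Finset R[X]) : ∃ D' : Finset R, ∀ σ τ : R →+* ℝ,
    (∀ c ∈ D', SignType.sign (σ c) = SignType.sign (τ c)) →
      ∀ y, ∃ y', ∀ p ∈ D, SameSign σ τ p y y' := by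
  classical
  obtain ⟨F, hDF, hF⟩ := exists_closedAbove_zero D
  -- The signs of the leading coefficients determine which members of `F` survive, their signs near
  -- `±∞`, and by the induction on degree the whole sign table.
  refine ⟨F.image leadingCoeff, fun σ τ hστ y => ?_⟩
  have hlc : ∀ p ∈ F, SignType.sign (σ p.leadingCoeff) = SignType.sign (τ p.leadingCoeff) :=
    fun p hp => hστ _ (Finset.mem_image_of_mem _ hp)
  have hlc' : ∀ p ∈ F, σ p.leadingCoeff = 0 ↔ τ p.leadingCoeff = 0 := by
    intro p hp
    rw [← sign_eq_zero_iff, hlc p hp, sign_eq_zero_iff]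
  suffices key : ∃ y', ∀ p ∈ survivors σ F, SameSign σ τ p y y' by
    obtain ⟨y', hy'⟩ := key
    refine ⟨y', fun p hp => ?_⟩
    obtain ⟨r, hr, -, hrσ, hrτ⟩ := hF.exists_reduced hlc' (hDF hp)
    rw [SameSign, ← eval_map, ← hrσ, ← eval_map, ← hrτ, eval_map, eval_map]
    rcases hr with rfl | hr
    · simp
    · exact hy' r hr
  have hS : survivors τ F = survivors σ F := by
    ext p
    simp only [survivors, mem_ofPred_eq, and_congr_right_iff]
    exact fun hp => (hlc' p hp).symm.not
  obtain ⟨M, hM⟩ := Filter.eventually_atTop.1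
    ((eventually_sign_survivors σ F).and (eventually_sign_survivors τ F))
  rw [hS] at hM
  set N := max M 1 with hN
  have hNM : M ≤ N := le_max_left _ _
  have hN1 : 1 ≤ N := le_max_right _ _
  -- Beyond `±N` no survivor changes sign, so `±N` itself can serve as the matching point.
  have htop : ∀ y, N ≤ y → ∀ p ∈ survivors σ F, SameSign σ τ p y N := by
    intro y hy p hp
    rw [SameSign, ((hM y (hNM.trans hy)).1 p hp).1, ((hM N hNM).2 p hp).1, hlc p hp.1]
  have hbot : ∀ y, y ≤ -N → ∀ p ∈ survivors σ F, SameSign σ τ p y (-N) := by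
    intro y hy p hp
    have := ((hM (-y) (by linarith)).1 p hp).2
    rw [neg_neg] at this
    rw [SameSign, this, ((hM N hNM).2 p hp).2, hlc p hp.1]
  rcases le_or_gt N y with h | h
  · exact ⟨N, htop y h⟩
  rcases le_or_gt y (-N) with h' | h'
  · exact ⟨-N, hbot y h'⟩
  have := hF.similar_survivors hlc (lo := -N) (hi := N) (lo' := -N) (hi' := N) (by linarith)
    (by linarith) (hbot _ le_rfl) (htop _ le_rfl)
  obtain ⟨y', -, hy'⟩ := this.exists_sameSign ⟨h', h⟩
  exact ⟨y', hy'⟩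

end Elimination

/-! ### Semi-algebraic sets, described by sign conditions -/

/-- `f` is a polynomial function. -/
def PolyFun {ι : Type} (f : (ι → ℝ) → ℝ) : Prop :=
  ∃ P : MvPolynomial ι ℝ, ∀ x, f x = MvPolynomial.eval x P

namespace PolyFun

variable {ι : Type} {f g : (ι → ℝ) → ℝ}

theorem coord (i : ι) : PolyFun fun x => x i := ⟨MvPolynomial.X i, by simp⟩

theorem const (c : ℝ) : PolyFun fun _ : ι → ℝ => c := ⟨MvPolynomial.C c, by simp⟩

theorem add (hf : PolyFun f) (hg : PolyFun g) : PolyFun fun x => f x + g x := by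
  obtain ⟨P, hP⟩ := hf
  obtain ⟨Q, hQ⟩ := hg
  exact ⟨P + Q, by simp [hP, hQ]⟩

theorem sub (hf : PolyFun f) (hg : PolyFun g) : PolyFun fun x => f x - g x := by
  obtain ⟨P, hP⟩ := hf
  obtain ⟨Q, hQ⟩ := hg
  exact ⟨P - Q, by simp [hP, hQ]⟩

theorem mul (hf : PolyFun f) (hg : PolyFun g) : PolyFun fun x => f x * g x := by
  obtain ⟨P, hP⟩ := hf
  obtain ⟨Q, hQ⟩ := hg
  exact ⟨P * Q, by simp [hP, hQ]⟩

theorem pow (hf : PolyFun f) (k : ℕ) : PolyFun fun x => f x ^ k := by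
  obtain ⟨P, hP⟩ := hf
  exact ⟨P ^ k, by simp [hP]⟩

theorem eval_comp {κ : Type} {F : κ → (ι → ℝ) → ℝ} (hF : ∀ j, PolyFun (F j))
    (P : MvPolynomial κ ℝ) : PolyFun fun x => MvPolynomial.eval (fun j => F j x) P := by
  choose G hG using hF
  refine ⟨MvPolynomial.bind₁ G P, fun x => ?_⟩
  simp only [hG]
  exact (MvPolynomial.eval₂Hom_bind₁ (RingHom.id ℝ) x G P).symm

end PolyFun

/-- Membership in `S` depends only on the signs of finitely many polynomials. -/
def DefinedBySigns {ι : Type} (S : Set (ι → ℝ)) : Prop :=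
  ∃ D : Finset (MvPolynomial ι ℝ), ∀ x x' : ι → ℝ,
    (∀ P ∈ D, SignType.sign (MvPolynomial.eval x P) = SignType.sign (MvPolynomial.eval x' P)) →
      x ∈ S → x' ∈ S

namespace DefinedBySigns

variable {ι κ : Type}

theorem forall_fintype {α : Type} [Fintype α] {p : α → (ι → ℝ) → Prop}
    (h : ∀ a, DefinedBySigns {x | p a x}) : DefinedBySigns {x | ∀ a, p a x} := by
  classical
  choose D hD using h
  refine ⟨Finset.univ.biUnion D, fun x x' hx hp a => hD a x x' (fun P hP => hx P ?_) (hp a)⟩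
  exact Finset.mem_biUnion.2 ⟨a, Finset.mem_univ a, hP⟩

theorem not {p : (ι → ℝ) → Prop} (h : DefinedBySigns {x | p x}) : DefinedBySigns {x | ¬ p x} := by
  obtain ⟨D, hD⟩ := h
  exact ⟨D, fun x x' hx hp hp' => hp (hD x' x (fun P hP => (hx P hP).symm) hp')⟩

theorem and {p q : (ι → ℝ) → Prop} (hp : DefinedBySigns {x | p x})
    (hq : DefinedBySigns {x | q x}) : DefinedBySigns {x | p x ∧ q x} := by
  classical
  obtain ⟨D, hD⟩ := hp
  obtain ⟨E, hE⟩ := hq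
  exact ⟨D ∪ E, fun x x' hx h =>
    ⟨hD x x' (fun P hP => hx P (Finset.mem_union_left _ hP)) h.1,
      hE x x' (fun P hP => hx P (Finset.mem_union_right _ hP)) h.2⟩⟩

theorem imp {p q : (ι → ℝ) → Prop} (hp : DefinedBySigns {x | p x})
    (hq : DefinedBySigns {x | q x}) : DefinedBySigns {x | p x → q x} := by
  convert (hp.and hq.not).not using 3
  tauto

theorem lt {f g : (ι → ℝ) → ℝ} (hf : PolyFun f) (hg : PolyFun g) :
    DefinedBySigns {x | f x < g x} := by
  obtain ⟨P, hP⟩ := hg.sub hf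
  refine ⟨{P}, fun x x' hx h => ?_⟩
  have := hx P (by simp)
  rw [← hP, ← hP] at this
  simp only [mem_ofPred_eq] at h ⊢
  rw [← sub_pos, ← sign_eq_one_iff] at h ⊢
  rwa [← this]

theorem le {f g : (ι → ℝ) → ℝ} (hf : PolyFun f) (hg : PolyFun g) :
    DefinedBySigns {x | f x ≤ g x} := by
  simpa only [not_lt] using (lt hg hf).not

theorem eq {f g : (ι → ℝ) → ℝ} (hf : PolyFun f) (hg : PolyFun g) :
    DefinedBySigns {x | f x = g x} := by
  simpa only [le_antisymm_iff] using (le hf hg).and (le hg hf)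

theorem preimage {S : Set (κ → ℝ)} (hS : DefinedBySigns S) {F : κ → (ι → ℝ) → ℝ}
    (hF : ∀ j, PolyFun (F j)) : DefinedBySigns {x | (fun j => F j x) ∈ S} := by
  classical
  obtain ⟨D, hD⟩ := hS
  choose G hG using fun P => PolyFun.eval_comp hF P
  beta_reduce at hG
  refine ⟨D.image G, fun x x' hx h => hD _ _ (fun P hP => ?_) h⟩
  rw [hG, hG]
  exact hx _ (Finset.mem_image_of_mem _ hP)

/-- **Tarski-Seidenberg** for one variable. -/
theorem ex {p : (ι → ℝ) → ℝ → Prop}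
    (h : DefinedBySigns {z : Option ι → ℝ | p (fun i => z (some i)) (z none)}) :
    DefinedBySigns {x | ∃ y, p x y} := by
  classical
  obtain ⟨D, hD⟩ := h
  obtain ⟨D', hD'⟩ := exists_finset_sign_transfer (D.image (MvPolynomial.optionEquivLeft ℝ ι))
  refine ⟨D', fun x x' hx => ?_⟩
  rintro ⟨y, hy⟩
  obtain ⟨y', hy'⟩ := hD' (MvPolynomial.eval x) (MvPolynomial.eval x') hx y
  refine ⟨y', hD (fun o => o.elim y x) (fun o => o.elim y' x') (fun P hP => ?_) hy⟩
  have := hy' _ (Finset.mem_image_of_mem _ hP)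
  rwa [SameSign, ← Polynomial.eval_map, ← Polynomial.eval_map,
    ← MvPolynomial.optionEquivLeft_elim_eval, ← MvPolynomial.optionEquivLeft_elim_eval] at this

theorem all {p : (ι → ℝ) → ℝ → Prop}
    (h : DefinedBySigns {z : Option ι → ℝ | p (fun i => z (some i)) (z none)}) :
    DefinedBySigns {x | ∀ y, p x y} := by
  simpa only [not_exists, not_not] using (ex (p := fun x y => ¬ p x y) h.not).not

/-- **Tarski-Seidenberg** for finitely many variables. -/
theorem ex_fin {k : ℕ} {ι : Type} {p : (ι → ℝ) → (Fin k → ℝ) → Prop}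
    (h : DefinedBySigns {z : ι ⊕ Fin k → ℝ | p (fun i => z (.inl i)) fun j => z (.inr j)}) :
    DefinedBySigns {x | ∃ q, p x q} := by
  induction k generalizing ι with
  | zero =>
    have := h.preimage (F := fun (s : ι ⊕ Fin 0) (x : ι → ℝ) => Sum.elim x (fun j => j.elim0) s) (by
      rintro (i | j)
      · exact .coord i
      · exact j.elim0)
    convert this using 3 with x
    simp only [mem_ofPred_eq, Sum.elim_inl]
    exact ⟨fun ⟨q, hq⟩ => by convert hq, fun hq => ⟨_, hq⟩⟩
  | succ k ih =>
    simp only [Fin.exists_fin_succ_pi]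
    refine ex (ih ?_)
    have := h.preimage (F := fun (s : ι ⊕ Fin (k + 1)) (z : Option ι ⊕ Fin k → ℝ) =>
      Sum.elim (fun i => z (.inl (some i)))
        (Fin.cons (z (.inl none)) (fun j => z (.inr j)) : Fin (k + 1) → ℝ) s) (by
      rintro (i | j)
      · exact .coord (Sum.inl (some i) : Option ι ⊕ Fin k)
      · refine Fin.cases ?_ (fun j => ?_) j
        · exact .coord (Sum.inl none : Option ι ⊕ Fin k)
        · exact .coord (Sum.inr j : Option ι ⊕ Fin k))
    exact this

end DefinedBySigns

/-- Finitely many polynomials have finitely many sign vectors, and a set defined by signs is the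
union of the cells of the vectors it attains; a negative sign is written `0 < -P`. Descriptions by
signs make Boolean operations and projections immediate, without normal forms. -/
theorem isSemialgebraic_iff {n : ℕ} {S : Set (Fin n → ℝ)} :
    IsSemialgebraic S ↔ DefinedBySigns S := by
  classical
  constructor
  · rintro ⟨C, rfl⟩
    refine ⟨C.biUnion fun c => c.1 ∪ c.2, fun x x' hx => ?_⟩
    rintro ⟨c, hc, h1, h2⟩
    refine ⟨c, hc, fun P hP => ?_, fun P hP => ?_⟩
    · have := hx P (Finset.mem_biUnion.2 ⟨c, hc, Finset.mem_union_left _ hP⟩)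
      rwa [h1 P hP, sign_zero, eq_comm, sign_eq_zero_iff] at this
    · have := hx P (Finset.mem_biUnion.2 ⟨c, hc, Finset.mem_union_right _ hP⟩)
      rwa [sign_pos (h2 P hP), eq_comm, sign_eq_one_iff] at this
  · rintro ⟨D, hD⟩
    set T : (Fin n → ℝ) → (D → SignType) := fun x P => SignType.sign (MvPolynomial.eval x P.1)
    have hfin : (T '' S).Finite := Set.toFinite _
    refine ⟨hfin.toFinset.image fun s =>
      (Finset.univ.filter (fun P => s P = 0) |>.image Subtype.val,
        (Finset.univ.filter (fun P => s P = 1) |>.image Subtype.val) ∪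
        (Finset.univ.filter (fun P => s P = -1) |>.image fun P => -P.1)), ?_⟩
    ext x
    simp only [mem_ofPred_eq, Finset.mem_image, Finite.mem_toFinset, mem_image]
    constructor
    · intro hx
      refine ⟨_, ⟨_, ⟨x, hx, rfl⟩, rfl⟩, ?_, ?_⟩
      · intro P hP
        obtain ⟨Q, hQ, rfl⟩ := Finset.mem_image.1 hP
        exact sign_eq_zero_iff.1 (Finset.mem_filter.1 hQ).2
      · intro P hP
        rcases Finset.mem_union.1 hP with hP | hP
        · obtain ⟨Q, hQ, rfl⟩ := Finset.mem_image.1 hP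
          exact sign_eq_one_iff.1 (Finset.mem_filter.1 hQ).2
        · obtain ⟨Q, hQ, rfl⟩ := Finset.mem_image.1 hP
          rw [map_neg, neg_pos]
          exact sign_eq_neg_one_iff.1 (Finset.mem_filter.1 hQ).2
    · rintro ⟨_, ⟨_, ⟨y, hy, rfl⟩, rfl⟩, h1, h2⟩
      refine hD y x (fun P hP => ?_) hy
      rcases h : SignType.sign (MvPolynomial.eval y P) with _ | _ | _
      · refine (sign_eq_zero_iff.2 (h1 P (Finset.mem_image.2 ⟨⟨P, hP⟩, ?_, rfl⟩))).symm
        simpa [T] using h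
      · refine (sign_eq_neg_one_iff.2 ?_).symm
        rw [← neg_pos, ← map_neg]
        refine h2 _ (Finset.mem_union_right _ (Finset.mem_image.2 ⟨⟨P, hP⟩, ?_, rfl⟩))
        simpa [T] using h
      · refine (sign_eq_one_iff.2 (h2 P (Finset.mem_union_left _
          (Finset.mem_image.2 ⟨⟨P, hP⟩, ?_, rfl⟩)))).symm
        simpa [T] using h

/-! ### Nash functions -/

section Nash

variable {n k : ℕ} {X : Set (Fin n → ℝ)} {Y : Set (Fin k → ℝ)}

theorem DefinedBySigns.mem {ι : Type} (hX : IsSemialgebraic X) {F : Fin n → (ι → ℝ) → ℝ}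
    (hF : ∀ j, PolyFun (F j)) : DefinedBySigns {x | (fun j => F j x) ∈ X} :=
  (isSemialgebraic_iff.1 hX).preimage hF

theorem DefinedBySigns.mem_graph {ι : Type} {g : (Fin n → ℝ) → ℝ}
    (hg : IsSemialgebraic (graphOver X g)) {F : Fin n → (ι → ℝ) → ℝ}
    (hF : ∀ j, PolyFun (F j)) {a : (ι → ℝ) → ℝ} (ha : PolyFun a) :
    DefinedBySigns {x | (fun j => F j x) ∈ X ∧ a x = g fun j => F j x} := by
  have := (isSemialgebraic_iff.1 hg).preimage
    (F := fun (j : Fin (n + 1)) x => (Fin.snoc (fun j => F j x) (a x) : Fin (n + 1) → ℝ) j) (by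
      intro j
      refine Fin.lastCases ?_ (fun j => ?_) j
      · simpa using ha
      · simpa using hF j)
  simpa [graphOver] using this

theorem isSemialgebraic_graphOver {g : (Fin n → ℝ) → ℝ}
    (h : DefinedBySigns {z : Fin (n + 1) → ℝ | (fun j => z (Fin.castSucc j)) ∈ X ∧
      z (Fin.last n) = g fun j => z (Fin.castSucc j)}) : IsSemialgebraic (graphOver X g) :=
  isSemialgebraic_iff.2 h

/-- The domain is the projection of the graph. -/
theorem IsNash.isSemialgebraic {g : (Fin n → ℝ) → ℝ} (hg : IsNash X g) : IsSemialgebraic X := by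
  refine isSemialgebraic_iff.2 ?_
  have := DefinedBySigns.ex (ι := Fin n) (p := fun x y => x ∈ X ∧ y = g x)
    (.mem_graph hg.2 (fun j => .coord _) (.coord _))
  simpa using this

theorem isNash_eval (hX : IsSemialgebraic X) (P : MvPolynomial (Fin n) ℝ) :
    IsNash X fun x => MvPolynomial.eval x P :=
  ⟨(AnalyticOnNhd.eval_mvPolynomial P).mono (subset_univ _), isSemialgebraic_graphOver
    ((DefinedBySigns.mem hX fun _ => .coord _).and
      (.eq (.coord _) (PolyFun.eval_comp (fun _ => .coord _) P)))⟩

theorem isNash_coord (hX : IsSemialgebraic X) (i : Fin n) : IsNash X fun x => x i := by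
  simpa using isNash_eval hX (MvPolynomial.X i)

theorem IsNashMap.analyticOnNhd {G : (Fin n → ℝ) → (Fin k → ℝ)} (hG : IsNashMap X G) :
    AnalyticOnNhd ℝ G X := analyticOnNhd_pi_iff.2 fun i => (hG i).1

/-- The graph of the composite is the projection of the set of all `(x, y, q)` with `q = G x` and `y
= h q`, to which Tarski-Seidenberg applies. -/
theorem IsNash.comp {h : (Fin k → ℝ) → ℝ} {G : (Fin n → ℝ) → (Fin k → ℝ)} (hh : IsNash Y h)
    (hG : IsNashMap X G) (hX : IsSemialgebraic X) (hXY : MapsTo G X Y) :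
    IsNash X fun x => h (G x) := by
  refine ⟨hh.1.comp hG.analyticOnNhd hXY, isSemialgebraic_graphOver ?_⟩
  have := DefinedBySigns.ex_fin (k := k) (ι := Fin (n + 1))
    (p := fun z q => (∀ i, (fun j => z (Fin.castSucc j)) ∈ X ∧
      q i = G (fun j => z (Fin.castSucc j)) i) ∧ (fun j => q j) ∈ Y ∧ z (Fin.last n) = h fun j => q j)
    ((DefinedBySigns.forall_fintype fun i =>
      .mem_graph (hG i).2 (fun j => .coord _) (.coord _)).and
      (.mem_graph hh.2 (fun j => .coord _) (.coord _)))
  -- Membership in `X` is imposed separately, because for `k = 0` the conditions on the components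
  -- of `G` are empty and would not imply it.
  convert (DefinedBySigns.mem hX fun j => .coord (Fin.castSucc j)).and this using 3 with z
  refine and_congr_right fun hz => ?_
  constructor
  · intro hq
    exact ⟨G fun j => z (Fin.castSucc j), fun i => ⟨hz, rfl⟩, hXY hz, hq⟩
  · rintro ⟨q, h1, -, h2⟩
    rw [h2]
    congr 1
    exact funext fun i => (h1 i).2

theorem IsNash.add {f g : (Fin n → ℝ) → ℝ} (hf : IsNash X f) (hg : IsNash X g) :
    IsNash X fun x => f x + g x := by
  have := (isNash_eval (X := univ) (isSemialgebraic_iff.2 ⟨∅, by simp⟩)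
    (MvPolynomial.X 0 + MvPolynomial.X 1 : MvPolynomial (Fin 2) ℝ)).comp (X := X)
    (G := fun x => ![f x, g x]) (by
      intro i
      fin_cases i
      · exact hf
      · exact hg) hf.isSemialgebraic (mapsTo_univ _ _)
  simpa using this

theorem IsNash.mul {f g : (Fin n → ℝ) → ℝ} (hf : IsNash X f) (hg : IsNash X g) :
    IsNash X fun x => f x * g x := by
  have := (isNash_eval (X := univ) (isSemialgebraic_iff.2 ⟨∅, by simp⟩)
    (MvPolynomial.X 0 * MvPolynomial.X 1 : MvPolynomial (Fin 2) ℝ)).comp (X := X)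
    (G := fun x => ![f x, g x]) (by
      intro i
      fin_cases i
      · exact hf
      · exact hg) hf.isSemialgebraic (mapsTo_univ _ _)
  simpa using this

theorem IsNash.sum {α : Type} (s : Finset α) {f : α → (Fin n → ℝ) → ℝ} (hX : IsSemialgebraic X)
    (hf : ∀ a ∈ s, IsNash X (f a)) : IsNash X fun x => ∑ a ∈ s, f a x := by
  classical
  induction s using Finset.induction_on with
  | empty => simpa using isNash_eval hX 0
  | insert a s ha ih =>
    simp only [Finset.sum_insert ha]
    exact (hf a (by simp)).add (ih fun b hb => hf b (by simp [hb]))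

/-- The partial derivative in direction `j`. -/
noncomputable def partialDeriv (j : Fin n) (g : (Fin n → ℝ) → ℝ) (x : Fin n → ℝ) : ℝ :=
  fderiv ℝ g x (Pi.single j 1)

theorem hasDerivAt_single {g : (Fin n → ℝ) → ℝ} {x : Fin n → ℝ} (hg : AnalyticAt ℝ g x)
    (j : Fin n) : HasDerivAt (fun t : ℝ => g (x + t • Pi.single j 1)) (partialDeriv j g x) 0 := by
  have h1 : HasDerivAt (fun t : ℝ => x + t • (Pi.single j 1 : Fin n → ℝ)) (Pi.single j 1) 0 := by
    simpa using ((hasDerivAt_id (0 : ℝ)).smul_const (Pi.single j 1 : Fin n → ℝ)).const_add x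
  have h2 : HasFDerivAt g (fderiv ℝ g x) (x + (0 : ℝ) • (Pi.single j 1 : Fin n → ℝ)) := by
    simpa using hg.differentiableAt.hasFDerivAt
  exact h2.comp_hasDerivAt 0 h1

/-- The `ε`-`δ` definition of the derivative in a form fit for quantifier elimination: squares
replace absolute values, and the values of `g` are replaced by variables `a`, `b` tied to its graph.
All atomic conditions are then polynomial inequalities or memberships in semi-algebraic sets. -/
theorem eq_partialDeriv_iff (hX : IsOpen X) {g : (Fin n → ℝ) → ℝ} (hg : AnalyticOnNhd ℝ g X)
    {x : Fin n → ℝ} (hx : x ∈ X) (j : Fin n) (y : ℝ) :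
    y = partialDeriv j g x ↔ ∀ ε : ℝ, 0 < ε → ∃ δ : ℝ, 0 < δ ∧ ∀ t : ℝ, t ^ 2 < δ ^ 2 →
      ∃ a b : ℝ, ((fun i => x i + t * (Pi.single j 1 : Fin n → ℝ) i) ∈ X ∧
        a = g fun i => x i + t * (Pi.single j 1 : Fin n → ℝ) i) ∧ (x ∈ X ∧ b = g x) ∧
        (a - b - t * y) ^ 2 ≤ (ε * t) ^ 2 := by
  have hfun : ∀ t : ℝ, (fun i => x i + t * (Pi.single j 1 : Fin n → ℝ) i) =
      x + t • Pi.single j 1 := fun t => by ext i; simp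
  simp only [hfun]
  have hder := hasDerivAt_single (hg x hx) j
  have hcont : Filter.Tendsto (fun t : ℝ => x + t • (Pi.single j 1 : Fin n → ℝ)) (nhds 0) (nhds x) := by
    have : Continuous (fun t : ℝ => x + t • (Pi.single j 1 : Fin n → ℝ)) := by fun_prop
    simpa using this.tendsto 0
  have key : y = partialDeriv j g x ↔
      HasDerivAt (fun t : ℝ => g (x + t • Pi.single j 1)) y 0 :=
    ⟨fun h => h ▸ hder, fun h => h.unique hder⟩
  rw [key, hasDerivAt_iff_isLittleO, Asymptotics.isLittleO_iff]
  constructor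
  · intro H ε hε
    have h2 := (H hε).and (hcont.eventually (hX.mem_nhds hx))
    obtain ⟨δ, hδ, hball⟩ := Metric.eventually_nhds_iff.1 h2
    refine ⟨δ, hδ, fun t ht => ?_⟩
    obtain ⟨h3, h4⟩ := hball (y := t) (by
      rw [dist_zero_right, Real.norm_eq_abs]
      exact abs_lt_of_sq_lt_sq ht hδ.le)
    refine ⟨_, _, ⟨h4, rfl⟩, ⟨hx, rfl⟩, ?_⟩
    rw [sq_le_sq, abs_mul, abs_of_pos hε]
    simpa using h3
  · intro H ε hε
    obtain ⟨δ, hδ, h⟩ := H ε hε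
    filter_upwards [Metric.ball_mem_nhds (0 : ℝ) hδ] with t ht
    rw [mem_ball_zero_iff, Real.norm_eq_abs] at ht
    obtain ⟨a, b, ⟨-, rfl⟩, ⟨-, rfl⟩, h3⟩ := h t (by rw [sq_lt_sq, abs_of_pos hδ]; exact ht)
    rw [sq_le_sq, abs_mul, abs_of_pos hε] at h3
    simpa using h3

theorem IsNash.partialDeriv (hX : IsOpen X) {g : (Fin n → ℝ) → ℝ} (hg : IsNash X g) (j : Fin n) :
    IsNash X (partialDeriv j g) := by
  refine ⟨fun x hx =>
    ((ContinuousLinearMap.apply ℝ ℝ (Pi.single j 1 : Fin n → ℝ)).analyticAt _).comp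
      (hg.1 x hx).fderiv,
    isSemialgebraic_graphOver ?_⟩
  have hS := hg.isSemialgebraic
  have : DefinedBySigns {z : Fin (n + 1) → ℝ | (fun j => z (Fin.castSucc j)) ∈ X ∧
      ∀ ε : ℝ, 0 < ε → ∃ δ : ℝ, 0 < δ ∧ ∀ t : ℝ, t ^ 2 < δ ^ 2 →
      ∃ a b : ℝ, ((fun i => z (Fin.castSucc i) + t * (Pi.single j 1 : Fin n → ℝ) i) ∈ X ∧
        a = g fun i => z (Fin.castSucc i) + t * (Pi.single j 1 : Fin n → ℝ) i) ∧
        ((fun j => z (Fin.castSucc j)) ∈ X ∧ b = g fun j => z (Fin.castSucc j)) ∧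
        (a - b - t * z (Fin.last n)) ^ 2 ≤ (ε * t) ^ 2} := by
    refine (DefinedBySigns.mem hS fun j => .coord _).and (.all (.imp (.lt (.const _) (.coord _))
      (.ex (.and (.lt (.const _) (.coord _)) (.all (.imp (.lt (.pow (.coord _) 2)
        (.pow (.coord _) 2)) (.ex (.ex (.and (.mem_graph hg.2 (fun i => ?_) (.coord _))
          (.and (.mem_graph hg.2 (fun i => .coord _) (.coord _)) (.le ?_ ?_)))))))))))
    · exact (PolyFun.coord _).add ((PolyFun.coord _).mul (.const _))
    · exact (((PolyFun.coord _).sub (.coord _)).sub ((PolyFun.coord _).mul (.coord _))).pow 2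
    · exact ((PolyFun.coord _).mul (.coord _)).pow 2
  convert this using 3 with z
  exact and_congr_right fun hz => eq_partialDeriv_iff hX hg.1 hz j _

end Nash

/-! ### Analyticity of solutions of analytic differential equations -/

section Superposition

open ContinuousMultilinearMap

variable {E F : Type*} [NormedAddCommGroup E] [NormedSpace ℝ E] [NormedAddCommGroup F]
  [NormedSpace ℝ F]

/-- Pointwise application of a continuous multilinear map to continuous functions. -/
noncomputable def superpose {k : ℕ} (m : ContinuousMultilinearMap ℝ (fun _ : Fin k => E) F) :
    ContinuousMultilinearMap ℝ (fun _ : Fin k => C(unitInterval, E)) C(unitInterval, F) :=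
  MultilinearMap.mkContinuous
    { toFun := fun v => ⟨fun s => m fun i => v i s, by fun_prop⟩
      map_update_add' := by
        intro _ v i x y
        ext s
        have : ∀ z : C(unitInterval, E), (fun j => Function.update v i z j s) =
            Function.update (fun j => v j s) i (z s) := by
          intro z
          ext j
          by_cases h : j = i
          · subst h; simp
          · simp [h]
        simp [this]
      map_update_smul' := by
        intro _ v i c x
        ext s
        have : ∀ z : C(unitInterval, E), (fun j => Function.update v i z j s) =
            Function.update (fun j => v j s) i (z s) := by
          intro z
          ext j
          by_cases h : j = i
          · subst h; simp
          · simp [h]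
        simp [this] } ‖m‖ (by
    intro v
    refine (ContinuousMap.norm_le _ (by positivity)).2 fun s => (m.le_opNorm _).trans ?_
    gcongr
    exact (v _).norm_coe_le_norm s)

/-- The power series of `f` is applied pointwise. The norm of `superpose (p k)` is at most that of
`p k`, so the radius of convergence does not shrink and `v ↦ f (x₀ + v ·)` is analytic on continuous
functions. -/
theorem exists_analyticAt_superposition [CompleteSpace F] {f : E → F} {x₀ : E}
    (hf : AnalyticAt ℝ f x₀) :
    ∃ N : C(unitInterval, E) → C(unitInterval, F), AnalyticAt ℝ N 0 ∧ ∃ r : ℝ, 0 < r ∧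
      ∀ v : C(unitInterval, E), ‖v‖ < r → ∀ s, N v s = f (x₀ + v s) := by
  obtain ⟨p, ρ, hp⟩ := hf
  set Q : FormalMultilinearSeries ℝ C(unitInterval, E) C(unitInterval, F) :=
    fun k => superpose (p k) with hQ
  have hrad : p.radius ≤ Q.radius := FormalMultilinearSeries.radius_le_of_le fun k =>
    MultilinearMap.mkContinuous_norm_le _ (norm_nonneg _) _
  have hρ : ρ ≤ Q.radius := hp.r_le.trans hrad
  have hQpos : 0 < Q.radius := hp.r_pos.trans_le hρ
  have hball := FormalMultilinearSeries.hasFPowerSeriesOnBall Q hQpos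
  obtain ⟨r, hr0, hr⟩ : ∃ r : ℝ≥0, 0 < r ∧ (r : ENNReal) ≤ ρ := by
    obtain ⟨r, h1, h2⟩ := ENNReal.lt_iff_exists_nnreal_btwn.1 hp.r_pos
    exact ⟨r, by simpa using h1, h2.le⟩
  refine ⟨Q.sum, hball.analyticAt, r, by exact_mod_cast hr0, fun v hv s => ?_⟩
  have hvr : v ∈ Metric.eball (0 : C(unitInterval, E)) Q.radius := by
    rw [Metric.mem_eball, edist_zero_right]
    refine lt_of_lt_of_le ?_ (hr.trans hρ)
    rw [← ofReal_norm, ENNReal.ofReal_lt_coe_iff (norm_nonneg _)]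
    exact hv
  have h1 := hball.hasSum hvr
  rw [zero_add] at h1
  have h2 : HasSum (fun k => (Q k fun _ => v) s) (Q.sum v s) :=
    h1.map (ContinuousMap.evalCLM ℝ s : C(unitInterval, F) →L[ℝ] F)
      (ContinuousMap.evalCLM ℝ s : C(unitInterval, F) →L[ℝ] F).continuous
  have hvs : v s ∈ Metric.eball (0 : E) ρ := by
    rw [Metric.mem_eball, edist_zero_right]
    refine lt_of_lt_of_le ?_ hr
    rw [← ofReal_norm, ENNReal.ofReal_lt_coe_iff (norm_nonneg _)]
    exact (v.norm_coe_le_norm s).trans_lt hv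
  exact h2.unique (hp.hasSum hvs)

end Superposition

section Integration

variable {E : Type*} [NormedAddCommGroup E] [NormedSpace ℝ E]

/-- The operator which maps `v` to its primitive vanishing at `0`. -/
noncomputable def primitive : C(unitInterval, E) →L[ℝ] C(unitInterval, E) :=
  LinearMap.mkContinuous
    { toFun := fun v => ⟨fun s => ∫ t in (0 : ℝ)..s, IccExtend zero_le_one v t,
        (intervalIntegral.continuous_primitive
          (fun a b => (v.continuous.Icc_extend' (h := zero_le_one)).intervalIntegrable a b) 0).comp
          continuous_subtype_val⟩
      map_add' := by
        intro v w
        ext s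
        exact intervalIntegral.integral_add
          ((v.continuous.Icc_extend' (h := zero_le_one)).intervalIntegrable _ _)
          ((w.continuous.Icc_extend' (h := zero_le_one)).intervalIntegrable _ _)
      map_smul' := by
        intro c v
        ext s
        exact intervalIntegral.integral_smul c _ } 1 (by
    intro v
    rw [one_mul]
    refine (ContinuousMap.norm_le _ (norm_nonneg _)).2 fun s => ?_
    refine (intervalIntegral.norm_integral_le_of_norm_le_const (C := ‖v‖)
      fun t _ => v.norm_coe_le_norm _).trans ?_
    rw [sub_zero, abs_of_nonneg s.2.1]
    exact mul_le_of_le_one_right (norm_nonneg _) s.2.2)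

theorem primitive_apply (v : C(unitInterval, E)) (s : unitInterval) :
    primitive v s = ∫ t in (0 : ℝ)..s, IccExtend zero_le_one v t := rfl

/-- After rescaling time, `v T s = x (c + s T) - x c` satisfies `v T = T • primitive (N (v T))` for
small `T`. This equation is analytic in `(T, v)`, and its derivative in `v` at `(0, 0)` is the
identity. By the implicit function theorem its solution is analytic in `T`; evaluation at `s = 1`
gives `x`. The argument treats an end point `c` like an interior one. -/
theorem analyticWithinAt_of_ode [CompleteSpace E] {f : E → E} {x : ℝ → E} {a b c : ℝ} (hc : c ∈ Icc a b)
    (hx : ContinuousOn x (Icc a b)) (hd : ∀ t ∈ Ioo a b, HasDerivAt x (f (x t)) t)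
    (hf : AnalyticAt ℝ f (x c)) : AnalyticWithinAt ℝ x (Icc a b) c := by
  have hab : a ≤ b := hc.1.trans hc.2
  obtain ⟨N, hN, r, hr, hNf⟩ := exists_analyticAt_superposition hf
  -- Extending `x` by constants makes `v T` a continuous function for every `T`, also where `c + T`
  -- leaves `[a, b]`.
  set y : ℝ → E := IccExtend hab (domRestrict (Icc a b) x) with hy
  have hyc : Continuous y := (continuousOn_iff_continuous_domRestrict.1 hx).Icc_extend'
  have hyx : ∀ t ∈ Icc a b, y t = x t := fun t ht => by
    rw [hy, IccExtend_of_mem _ _ ht]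
    rfl
  set v : ℝ → C(unitInterval, E) := fun T =>
    (ContinuousMap.curry ⟨fun q : ℝ × unitInterval => y (c + q.2 * q.1) - x c, by fun_prop⟩) T with hv
  have hvc : Continuous v := ContinuousMap.continuous _
  have hvapp : ∀ T s, v T s = y (c + s * T) - x c := fun T s => rfl
  have hv0 : v 0 = 0 := by
    ext s
    simp [hvapp, hyx c hc]
  set P : ℝ × C(unitInterval, E) → C(unitInterval, E) :=
    fun q => q.2 - q.1 • primitive (N q.2) with hP
  have hPan : AnalyticAt ℝ P (0, 0) := by
    have h2 : AnalyticAt ℝ (fun q : ℝ × C(unitInterval, E) => N q.2) (0, 0) :=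
      AnalyticAt.comp (f := Prod.snd) (x := ((0 : ℝ), (0 : C(unitInterval, E)))) hN analyticAt_snd
    have h3 : AnalyticAt ℝ (fun q : ℝ × C(unitInterval, E) => primitive (N q.2)) (0, 0) :=
      ((primitive (E := E)).analyticAt (N 0)).comp (f := fun q : ℝ × C(unitInterval, E) => N q.2) h2
    exact analyticAt_snd.sub (analyticAt_fst.smul h3)
  have hP0 : P (0, 0) = 0 := by simp [hP]
  have hinv : (fderiv ℝ P (0, 0) ∘L .inr ℝ ℝ C(unitInterval, E)).IsInvertible := by
    have h1 : HasFDerivAt (fun w => P ((ContinuousLinearMap.inr ℝ ℝ C(unitInterval, E)) w))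
        (fderiv ℝ P (0, 0) ∘L .inr ℝ ℝ C(unitInterval, E)) 0 := by
      refine HasFDerivAt.comp (g := P) (x := (0 : C(unitInterval, E))) ?_
        (ContinuousLinearMap.inr ℝ ℝ C(unitInterval, E)).hasFDerivAt
      simpa using hPan.differentiableAt.hasFDerivAt
    have h2 : (fun w => P ((ContinuousLinearMap.inr ℝ ℝ C(unitInterval, E)) w)) = id := by
      ext w : 1
      simp [hP]
    rw [h2] at h1
    rw [h1.unique (hasFDerivAt_id 0)]
    exact ⟨ContinuousLinearEquiv.refl ℝ _, rfl⟩
  have hcd : ContDiffAt ℝ ⊤ P (0, 0) := hPan.contDiffAt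
  set ψ := hcd.implicitFunction (by simp) hinv
  have hψ : AnalyticAt ℝ ψ 0 := (hcd.contDiffAt_implicitFunction (by simp) hinv).analyticAt
  have hiff := hcd.eventually_apply_eq_iff_implicitFunction (by simp) hinv
  have htend : Filter.Tendsto (fun T => (T, v T)) (nhds 0) (nhds (0, 0)) := by
    have : Continuous fun T => (T, v T) := by fun_prop
    simpa [hv0] using this.tendsto 0
  have hsmall : ∀ᶠ T in nhds 0, ‖v T‖ < r := by
    have : Continuous fun T => ‖v T‖ := by fun_prop
    exact this.continuousAt.eventually_lt continuousAt_const (by simpa [hv0] using hr)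
  have hsol : ∀ T, ‖v T‖ < r → c + T ∈ Icc a b → P (T, v T) = 0 := by
    intro T hT hcT
    rw [hP, sub_eq_zero]
    ext s
    have hmem : ∀ t ∈ Icc (0 : ℝ) 1, c + t * T ∈ Icc a b := by
      intro t ht
      have := (convex_Icc a b).add_smul_mem hc hcT ht
      simpa using this
    have hint : primitive (N (v T)) s = ∫ t in (0 : ℝ)..s, f (y (c + t * T)) := by
      rw [primitive_apply]
      refine intervalIntegral.integral_congr fun t ht => ?_
      rw [uIcc_of_le s.2.1] at ht
      have ht1 : t ∈ Icc (0 : ℝ) 1 := ⟨ht.1, ht.2.trans s.2.2⟩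
      rw [IccExtend_of_mem _ _ ht1, hNf _ hT, hvapp]
      simp
    rw [ContinuousMap.smul_apply, hint, ← intervalIntegral.integral_smul,
      intervalIntegral.integral_eq_sub_of_hasDerivAt_of_le (f := v T ∘ projIcc 0 1 zero_le_one) s.2.1]
    · rw [Function.comp_apply, Function.comp_apply, projIcc_val, projIcc_left]
      simp [hvapp, hyx c hc]
    · fun_prop
    · intro t ht
      have ht1 : t ∈ Ioo (0 : ℝ) 1 := ⟨ht.1, ht.2.trans_le s.2.2⟩
      have heq : (fun t => x (c + t * T) - x c) =ᶠ[nhds t] v T ∘ projIcc 0 1 zero_le_one := by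
        filter_upwards [isOpen_Ioo.mem_nhds ht1] with t' ht'
        rw [Function.comp_apply, hvapp, projIcc_of_mem _ (Ioo_subset_Icc_self ht'),
          hyx _ (hmem _ (Ioo_subset_Icc_self ht'))]
      refine HasDerivAt.congr_of_eventuallyEq ?_ heq.symm
      rw [hyx _ (hmem _ (Ioo_subset_Icc_self ht1))]
      -- For `T = 0` the point `c + t * T` is `c`, possibly an end point, where the equation is not
      -- assumed; the curve is then constant.
      rcases eq_or_ne T 0 with rfl | hT0
      · simpa using hasDerivAt_const t (x c - x c)
      have hin : c + t * T ∈ Ioo a b := by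
        rcases hT0.lt_or_gt with h | h
        · constructor <;> nlinarith [ht1.1, ht1.2, hcT.1, hcT.2, hc.1, hc.2]
        · constructor <;> nlinarith [ht1.1, ht1.2, hcT.1, hcT.2, hc.1, hc.2]
      have h1 : HasDerivAt (fun t : ℝ => c + t * T) T t := by
        simpa using ((hasDerivAt_id t).mul_const T).const_add c
      exact ((hd _ hin).scomp t h1).sub_const _
    · refine ContinuousOn.intervalIntegrable ?_
      rw [uIcc_of_le s.2.1]
      refine ContinuousOn.congr (f := fun t => T • IccExtend zero_le_one (N (v T)) t) ?_ ?_
      · exact ((N (v T)).continuous.Icc_extend' (h := zero_le_one)).continuousOn.const_smul T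
      · intro t ht
        have ht1 : t ∈ Icc (0 : ℝ) 1 := ⟨ht.1, ht.2.trans s.2.2⟩
        beta_reduce
        rw [IccExtend_of_mem _ _ ht1, hNf _ hT, hvapp]
        simp
  have hfin : ∀ᶠ T in nhds 0, c + T ∈ Icc a b → x (c + T) = x c + ψ T 1 := by
    filter_upwards [htend.eventually hiff, hsmall] with T h1 h2 h3
    rw [hP0] at h1
    have h4 : ψ T = v T := h1.1 (hsol T h2 h3)
    rw [h4, hvapp]
    simp [hyx _ h3]
  have hx' : AnalyticAt ℝ (fun t => x c + ψ (t - c) 1) c := by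
    refine analyticAt_const.add ?_
    have h1 : AnalyticAt ℝ (fun t => ψ (t - c)) c := by
      refine AnalyticAt.comp (g := ψ) (f := fun t => t - c) ?_ (analyticAt_id.sub analyticAt_const)
      simpa using hψ
    exact ((ContinuousMap.evalCLM ℝ (1 : unitInterval) :
      C(unitInterval, E) →L[ℝ] E).analyticAt _).comp h1
  have hev : ∀ᶠ t in nhds c, t ∈ Icc a b → x t = x c + ψ (t - c) 1 := by
    have ht : Filter.Tendsto (fun t => t - c) (nhds c) (nhds 0) := by
      have : Continuous fun t : ℝ => t - c := by fun_prop
      simpa using this.tendsto c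
    filter_upwards [ht.eventually hfin] with t h h'
    simpa using h (by simpa using h')
  refine hx'.analyticWithinAt.congr_of_eventuallyEq ?_ (hev.self_of_nhds hc)
  rw [Filter.EventuallyEq, eventually_nhdsWithin_iff]
  exact hev

end Integration

/-! ### Solutions of analytic differential equations on an interval -/

section Tower

/-- Each application of the mean value inequality, starting at the common zero `c`, gains one factor
`|t - c|`. -/
theorem tower_bound {a b c : ℝ} (hc : c ∈ Icc a b) {g : ℕ → ℝ → ℝ}
    (hg : ∀ j, ∀ t ∈ Icc a b, HasDerivWithinAt (g j) (g (j + 1) t) (Icc a b) t)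
    (h0 : ∀ j, g j c = 0) (m : ℕ) :
    ∀ j, ∃ C, 0 ≤ C ∧ ∀ t ∈ Icc a b, |g j t| ≤ C * |t - c| ^ m := by
  induction m with
  | zero =>
    intro j
    obtain ⟨C, hC⟩ := isCompact_Icc.exists_bound_of_continuousOn
      (fun t ht => (hg j t ht).continuousWithinAt)
    refine ⟨max C 0, le_max_right _ _, fun t ht => ?_⟩
    rw [pow_zero, mul_one]
    exact (hC t ht).trans (le_max_left _ _)
  | succ m ih =>
    intro j
    obtain ⟨C, hC0, hC⟩ := ih (j + 1)
    refine ⟨C, hC0, fun t ht => ?_⟩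
    have hsub : uIcc c t ⊆ Icc a b := uIcc_subset_Icc hc ht
    have := (convex_uIcc c t).norm_image_sub_le_of_norm_hasDerivWithin_le
      (f := g j) (f' := g (j + 1)) (C := C * |t - c| ^ m) (fun s hs => (hg j s (hsub hs)).mono hsub)
      (fun s hs => (hC s (hsub hs)).trans (mul_le_mul_of_nonneg_left
        (pow_le_pow_left₀ (abs_nonneg _) (abs_sub_left_of_mem_uIcc hs) m) hC0)) left_mem_uIcc right_mem_uIcc
    rw [h0, sub_zero, Real.norm_eq_abs, Real.norm_eq_abs] at this
    rw [pow_succ, ← mul_assoc]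
    exact this

theorem nhdsWithin_Icc_diff_neBot {a b c : ℝ} (hab : a < b) (hc : c ∈ Icc a b) :
    (nhdsWithin c (Ioo a b \ {c})).NeBot := by
  rw [← mem_closure_iff_nhdsWithin_neBot]
  have h1 : closure (Ioo a b) ⊆ closure (Ioo a b \ {c}) := by
    have : Dense ({c}ᶜ : Set ℝ) := dense_compl_singleton c
    have h2 := this.open_subset_closure_inter (isOpen_Ioo (a := a) (b := b))
    rw [sdiff_eq]
    exact closure_minimal h2 isClosed_closure
  rw [closure_Ioo hab.ne] at h1
  exact h1 hc

/-- An analytic function all of whose derivatives vanish at a point is zero. -/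
theorem eq_zero_of_tower {a b c : ℝ} (hab : a < b) (hc : c ∈ Icc a b) {g : ℕ → ℝ → ℝ}
    (hg : ∀ j, ∀ t ∈ Icc a b, HasDerivWithinAt (g j) (g (j + 1) t) (Icc a b) t)
    (h0 : ∀ j, g j c = 0) (han : AnalyticOn ℝ (g 0) (Icc a b)) : ∀ t ∈ Icc a b, g 0 t = 0 := by
  obtain ⟨G, hG, hGan⟩ := analyticWithinAt_iff_exists_analyticAt.1 (han c hc)
  rw [insert_eq_of_mem hc] at hG
  have hNB := nhdsWithin_Icc_diff_neBot hab hc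
  have hle : nhdsWithin c (Ioo a b \ {c}) ≤ nhdsWithin c (Icc a b) :=
    nhdsWithin_mono _ (sdiff_subset.trans Ioo_subset_Icc_self)
  have hG0 : ∀ᶠ t in nhds c, G t = 0 := by
    by_contra H
    -- Otherwise `G t = (t - c) ^ k • u t` near `c` with `u c ≠ 0`, which contradicts the bound of
    -- order `k + 1`.
    obtain ⟨k, u, hu, hu0, hGu⟩ := hGan.exists_eventuallyEq_pow_smul_nonzero_iff.2 H
    obtain ⟨C, hC0, hC⟩ := tower_bound hc hg h0 (k + 1) 0
    have hev : ∀ᶠ t in nhdsWithin c (Ioo a b \ {c}), |u t| ≤ C * |t - c| := by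
      filter_upwards [hle hG, nhdsWithin_le_nhds hGu, self_mem_nhdsWithin] with t h1 h2 h3
      have h4 := hC t (Ioo_subset_Icc_self h3.1)
      have hpos : 0 < |t - c| := abs_pos.2 (sub_ne_zero.2 h3.2)
      rw [h1, h2, smul_eq_mul, abs_mul, abs_pow, pow_succ, mul_left_comm] at h4
      exact le_of_mul_le_mul_left h4 (by positivity)
    have h1 : Filter.Tendsto (fun t => |u t|) (nhdsWithin c (Ioo a b \ {c})) (nhds |u c|) :=
      (hu.continuousAt.tendsto.mono_left nhdsWithin_le_nhds).abs
    have h2 : Filter.Tendsto (fun t => C * |t - c|) (nhdsWithin c (Ioo a b \ {c})) (nhds 0) := by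
      have : Continuous fun t : ℝ => C * |t - c| := by fun_prop
      simpa using (this.tendsto c).mono_left nhdsWithin_le_nhds
    have := le_of_tendsto_of_tendsto h1 h2 hev
    exact hu0 (abs_eq_zero.1 (le_antisymm this (abs_nonneg _)))
  have hg0 : ∀ᶠ t in nhdsWithin c (Icc a b), g 0 t = 0 := by
    filter_upwards [hG, nhdsWithin_le_nhds hG0] with t h1 h2
    rw [h1, h2]
  obtain ⟨O, hO, hcO, hOg⟩ := mem_nhdsWithin.1 hg0
  obtain ⟨z, hzO, hz⟩ : ∃ z ∈ O, z ∈ Ioo a b := by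
    have : c ∈ closure (Ioo a b) := by rwa [closure_Ioo hab.ne]
    exact mem_closure_iff.1 this O hO hcO
  have hin : EqOn (g 0) 0 (Ioo a b) := by
    refine AnalyticOnNhd.eqOn_zero_of_preconnected_of_eventuallyEq_zero
      ((isOpen_Ioo.analyticOn_iff_analyticOnNhd).1 (han.mono Ioo_subset_Icc_self))
      isPreconnected_Ioo hz ?_
    filter_upwards [hO.mem_nhds hzO, isOpen_Ioo.mem_nhds hz] with t h1 h2
    exact hOg ⟨h1, Ioo_subset_Icc_self h2⟩
  have hcl : EqOn (g 0) 0 (Icc a b) :=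
    hin.of_subset_closure han.continuousOn continuousOn_const Ioo_subset_Icc_self
      (by rw [closure_Ioo hab.ne])
  exact hcl

end Tower

/-! ### Uniqueness and local existence of solutions -/

section Solution

variable {E : Type*} [NormedAddCommGroup E] [NormedSpace ℝ E]

/-- `x` is a solution of `ẋ = f(x)` on `[a, b]` with values in `X`. -/
structure IsSolution (f : E → E) (X : Set E) (x : ℝ → E) (a b : ℝ) : Prop where
  cont : ContinuousOn x (Icc a b)
  mem : ∀ t ∈ Icc a b, x t ∈ X
  deriv : ∀ t ∈ Ioo a b, HasDerivAt x (f (x t)) t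

variable [CompleteSpace E] {f : E → E} {X : Set E} {x y : ℝ → E} {a b : ℝ}

theorem IsSolution.analyticOn (hx : IsSolution f X x a b) (hf : AnalyticOnNhd ℝ f X) :
    AnalyticOn ℝ x (Icc a b) := fun t ht =>
  analyticWithinAt_of_ode ht hx.cont hx.deriv (hf _ (hx.mem t ht))

/-- `IsSolution` imposes the equation only on the open interval. The one-sided derivatives at the
end points come from the integral equation, whose integrand is continuous on the closed interval. -/
theorem IsSolution.hasDerivWithinAt (hx : IsSolution f X x a b) (hf : AnalyticOnNhd ℝ f X)
    {t : ℝ} (ht : t ∈ Icc a b) : HasDerivWithinAt x (f (x t)) (Icc a b) t := by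
  have hab : a ≤ b := ht.1.trans ht.2
  have hfx : ContinuousOn (fun t => f (x t)) (Icc a b) :=
    hf.continuousOn.comp hx.cont hx.mem
  set F : ℝ → E := IccExtend hab (domRestrict (Icc a b) fun t => f (x t)) with hF
  have hFc : Continuous F := (continuousOn_iff_continuous_domRestrict.1 hfx).Icc_extend'
  have hFx : ∀ t ∈ Icc a b, F t = f (x t) := fun t ht => by
    rw [hF, IccExtend_of_mem _ _ ht]
    rfl
  have hint : ∀ t ∈ Icc a b, x t = x a + ∫ s in a..t, F s := by
    intro t ht
    rw [intervalIntegral.integral_eq_sub_of_hasDerivAt_of_le (f := x) ht.1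
      (hx.cont.mono (Icc_subset_Icc_right ht.2)) ?_ (hFc.intervalIntegrable _ _)]
    · abel
    · intro s hs
      have hs' : s ∈ Ioo a b := ⟨hs.1, hs.2.trans_le ht.2⟩
      rw [hFx s (Ioo_subset_Icc_self hs')]
      exact hx.deriv s hs'
  have hd : HasDerivAt (fun t => x a + ∫ s in a..t, F s) (F t) t :=
    (intervalIntegral.integral_hasDerivAt_right (hFc.intervalIntegrable _ _)
      (hFc.stronglyMeasurableAtFilter _ _) hFc.continuousAt).const_add _
  rw [← hFx t ht]
  exact hd.hasDerivWithinAt.congr hint (hint t ht)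

/-- The two curves cover a compact subset of `X`, and a locally Lipschitz map is Lipschitz on a
compact set, so the usual uniqueness theorem applies. -/
theorem IsSolution.eqOn (hx : IsSolution f X x a b) (hy : IsSolution f X y a b)
    (hf : AnalyticOnNhd ℝ f X) (h : x a = y a) : EqOn x y (Icc a b) := by
  set K := x '' Icc a b ∪ y '' Icc a b
  have hK : IsCompact K :=
    (isCompact_Icc.image_of_continuousOn hx.cont).union (isCompact_Icc.image_of_continuousOn hy.cont)
  have hKX : K ⊆ X := by
    rintro z (⟨t, ht, rfl⟩ | ⟨t, ht, rfl⟩)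
    · exact hx.mem t ht
    · exact hy.mem t ht
  have hL : LocallyLipschitzOn K f := by
    intro z hz
    obtain ⟨L, s, hs, hLs⟩ := (hf z (hKX hz)).contDiffAt (n := 1) |>.exists_lipschitzOnWith
    exact ⟨L, s, mem_nhdsWithin_of_mem_nhds hs, hLs⟩
  obtain ⟨L, hL⟩ := hL.exists_lipschitzOnWith_of_compact hK
  refine ODE_solution_unique_of_mem_Icc_right (v := fun _ => f) (s := fun _ => K) (K := L)
    (fun _ _ => hL) hx.cont (fun t ht => ?_) (fun t ht => Or.inl ⟨t, Ico_subset_Icc_self ht, rfl⟩)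
    hy.cont (fun t ht => ?_) (fun t ht => Or.inr ⟨t, Ico_subset_Icc_self ht, rfl⟩) h
  · exact (hx.hasDerivWithinAt hf (Ico_subset_Icc_self ht)).mono_of_mem_nhdsWithin
      (Icc_mem_nhdsGE_of_mem ht)
  · exact (hy.hasDerivWithinAt hf (Ico_subset_Icc_self ht)).mono_of_mem_nhdsWithin
      (Icc_mem_nhdsGE_of_mem ht)

/-- Picard-Lindelöf. The fixed point itself is kept, because it lives among curves confined to the
closed ball; this confinement is what lets arcs be joined under a distance bound. -/
theorem exists_isSolution [ProperSpace E] {z : E} {ρ M : ℝ≥0} {T : ℝ}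
    (hT : 0 ≤ T) (hf : AnalyticOnNhd ℝ f (Metric.closedBall z ρ))
    (hb : ∀ w ∈ Metric.closedBall z ρ, ‖f w‖ ≤ M) (hMT : M * T ≤ ρ) :
    ∃ x, x 0 = z ∧ IsSolution f (Metric.closedBall z ρ) x 0 T := by
  obtain ⟨K, hK⟩ := ContDiffOn.exists_lipschitzOnWith (n := 1)
    (fun w hw => (hf w hw).contDiffAt.contDiffWithinAt) one_ne_zero (convex_closedBall z ρ)
    (isCompact_closedBall z ρ)
  have hPL : IsPicardLindelof (fun _ => f) (⟨0, left_mem_Icc.2 hT⟩ : Icc 0 T) z ρ 0 M K :=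
    IsPicardLindelof.of_time_independent hb hK (by simpa [hT] using hMT)
  obtain ⟨α, hα⟩ := ODE.FunSpace.exists_isFixedPt_next hPL
    (Metric.mem_closedBall_self (x := z) le_rfl)
  have hd : ∀ t ∈ Icc 0 T, HasDerivWithinAt α.compProj (f (α.compProj t)) (Icc 0 T) t := by
    intro t ht
    apply ODE.hasDerivWithinAt_picard_Icc (left_mem_Icc.2 hT) hPL.continuousOn_uncurry
      α.continuous_compProj.continuousOn (fun _ ht' ↦ α.compProj_mem_closedBall hPL.mul_max_le)
      z ht |>.congr_of_mem _ ht
    intro t' ht'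
    nth_rw 1 [← hα]
    rw [ODE.FunSpace.compProj_of_mem ht', ODE.FunSpace.next_apply]
  refine ⟨α.compProj, ?_, ⟨fun t ht => (hd t ht).continuousWithinAt,
    fun t _ => α.compProj_mem_closedBall hPL.mul_max_le, fun t ht => ?_⟩⟩
  · have := ODE.FunSpace.compProj_val (t₀ := (⟨0, left_mem_Icc.2 hT⟩ : Icc 0 T)) (α := α)
      (t := ⟨0, left_mem_Icc.2 hT⟩)
    rw [this, ← hα, ODE.FunSpace.next_apply₀]
  · exact (hd t (Ioo_subset_Icc_self ht)).hasDerivAt (Icc_mem_nhds ht.1 ht.2)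

end Solution

variable {m n r d : ℕ} {U : Set (Fin m → ℝ)}

/-! ### Inputs -/

theorem duration_append (u v : Input U) : duration (u ++ v) = duration u + duration v := by
  simp [duration]

theorem duration_nil : duration ([] : Input U) = 0 := rfl

theorem duration_singleton (α : U) (t : ℝ≥0) : duration [(α, t)] = t := by simp [duration]

theorem duration_nonneg (u : Input U) : 0 ≤ duration u := by
  refine List.sum_nonneg ?_
  simp only [List.mem_map]
  rintro _ ⟨a, -, rfl⟩
  exact a.2.2

namespace IsAdmissible

variable {A B : Set (Input U)}

theorem prefix_mem (hA : IsAdmissible A) {u v : Input U} (h : u ++ v ∈ A) : u ∈ A := by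
  rcases List.eq_nil_or_concat u with rfl | ⟨w, ⟨β, t⟩, rfl⟩
  · exact hA.empty_mem
  · simp only [List.concat_eq_append, List.append_assoc, List.singleton_append] at h ⊢
    exact hA.restrict_mem w v β t t h le_rfl

theorem exists_extend (hA : IsAdmissible A) {u : Input U} (hu : u ∈ A) (α : U) :
    ∃ t : ℝ≥0, 0 < t ∧ ∀ s ≤ t, u ++ [(α, s)] ∈ A := by
  obtain ⟨t, ht, h⟩ := hA.extend_mem u hu α
  exact ⟨t, ht, fun s hs => hA.restrict_mem u [] α s t h hs⟩

theorem inter (hA : IsAdmissible A) (hB : IsAdmissible B) : IsAdmissible (A ∩ B) where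
  empty_mem := ⟨hA.empty_mem, hB.empty_mem⟩
  restrict_mem w v α s t h hs := ⟨hA.restrict_mem w v α s t h.1 hs, hB.restrict_mem w v α s t h.2 hs⟩
  extend_mem u hu α := by
    obtain ⟨t, ht, h⟩ := hA.exists_extend hu.1 α
    obtain ⟨t', ht', h'⟩ := hB.exists_extend hu.2 α
    exact ⟨min t t', lt_min ht ht', h _ (min_le_left _ _), h' _ (min_le_right _ _)⟩
  perturb_mem u hu := by
    obtain ⟨δ, hδ, h⟩ := hA.perturb_mem u hu.1
    obtain ⟨δ', hδ', h'⟩ := hB.perturb_mem u hu.2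
    refine ⟨min δ δ', lt_min hδ hδ', fun v hv => ⟨h v ?_, h' v ?_⟩⟩
    · exact hv.imp fun a b hab => ⟨hab.1, hab.2.trans (by gcongr; exact min_le_left _ _)⟩
    · exact hv.imp fun a b hab => ⟨hab.1, hab.2.trans (by gcongr; exact min_le_right _ _)⟩

theorem sUnion {𝒜 : Set (Set (Input U))} (hne : 𝒜.Nonempty) (h : ∀ A ∈ 𝒜, IsAdmissible A) :
    IsAdmissible (⋃₀ 𝒜) where
  empty_mem := by
    obtain ⟨A, hA⟩ := hne
    exact ⟨A, hA, (h A hA).empty_mem⟩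
  restrict_mem := by
    rintro w v α s t ⟨A, hA, hm⟩ hs
    exact ⟨A, hA, (h A hA).restrict_mem w v α s t hm hs⟩
  extend_mem := by
    rintro u ⟨A, hA, hm⟩ α
    obtain ⟨t, ht, h'⟩ := (h A hA).extend_mem u hm α
    exact ⟨t, ht, A, hA, h'⟩
  perturb_mem := by
    rintro u ⟨A, hA, hm⟩
    obtain ⟨δ, hδ, h'⟩ := (h A hA).perturb_mem u hm
    exact ⟨δ, hδ, fun v hv => ⟨A, hA, h' v hv⟩⟩

theorem shift_preimage (hA : IsAdmissible A) {u : Input U} (hu : u ∈ A) :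
    IsAdmissible {v | u ++ v ∈ A} where
  empty_mem := by simpa using hu
  restrict_mem w v α s t h hs := by
    have := hA.restrict_mem (u ++ w) v α s t (by simpa using h) hs
    simpa using this
  extend_mem v hv α := by
    obtain ⟨t, ht, h⟩ := hA.extend_mem _ hv α
    exact ⟨t, ht, by simpa using h⟩
  perturb_mem v hv := by
    obtain ⟨δ, hδ, h⟩ := hA.perturb_mem _ hv
    refine ⟨δ, hδ, fun w hw => h _ (List.rel_append ?_ hw)⟩
    exact List.forall₂_same.2 fun a _ => ⟨rfl, by simp⟩

theorem shiftDomain (hA : IsAdmissible A) {u : Input U} (hu : u ∈ A) :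
    IsAdmissible (shiftDomain A u) := hA.inter (hA.shift_preimage hu)

end IsAdmissible

/-- `E` contains the empty input and is closed under short prolongations by all input values. -/
structure IsProlongable (E : Set (Input U)) : Prop where
  nil_mem : [] ∈ E
  exists_prolong : ∀ v ∈ E, ∀ α : U, ∃ t : ℝ≥0, 0 < t ∧ ∀ s ≤ t, v ++ [(α, s)] ∈ E

theorem IsAdmissible.isProlongable {A : Set (Input U)} (hA : IsAdmissible A) : IsProlongable A :=
  ⟨hA.empty_mem, fun _ hv α => hA.exists_extend hv α⟩

theorem IsProlongable.inter {E F : Set (Input U)} (hE : IsProlongable E) (hF : IsProlongable F) :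
    IsProlongable (E ∩ F) where
  nil_mem := ⟨hE.nil_mem, hF.nil_mem⟩
  exists_prolong v hv α := by
    obtain ⟨t, ht, h⟩ := hE.exists_prolong v hv.1 α
    obtain ⟨t', ht', h'⟩ := hF.exists_prolong v hv.2 α
    exact ⟨min t t', lt_min ht ht', fun s hs =>
      ⟨h s (hs.trans (min_le_left _ _)), h' s (hs.trans (min_le_right _ _))⟩⟩

/-! ### Trajectories -/

section

variable {E : Type*} [NormedAddCommGroup E] [NormedSpace ℝ E] {f : E → E} {X : Set E} {x y : ℝ → E}
  {a b c : ℝ}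

theorem IsSolution.congr (hx : IsSolution f X x a b) (h : EqOn y x (Icc a b)) :
    IsSolution f X y a b where
  cont := hx.cont.congr h
  mem t ht := h ht ▸ hx.mem t ht
  deriv t ht := by
    rw [h (Ioo_subset_Icc_self ht)]
    refine (hx.deriv t ht).congr_of_eventuallyEq ?_
    filter_upwards [isOpen_Ioo.mem_nhds ht] with s hs
    exact h (Ioo_subset_Icc_self hs)

theorem IsSolution.mono (hx : IsSolution f X x a b) (hc : c ≤ b) : IsSolution f X x a c where
  cont := hx.cont.mono (Icc_subset_Icc_right hc)
  mem t ht := hx.mem t (Icc_subset_Icc_right hc ht)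
  deriv t ht := hx.deriv t (Ioo_subset_Ioo_right hc ht)

theorem IsSolution.mono_set {Y : Set E} (hx : IsSolution f X x a b) (hXY : X ⊆ Y) :
    IsSolution f Y x a b := ⟨hx.cont, fun t ht => hXY (hx.mem t ht), hx.deriv⟩

theorem IsSolution.comp_add (hx : IsSolution f X x (a + c) (b + c)) :
    IsSolution f X (fun t => x (t + c)) a b where
  cont := hx.cont.comp (by fun_prop) fun t ht => ⟨by linarith [ht.1], by linarith [ht.2]⟩
  mem t ht := hx.mem _ ⟨by linarith [ht.1], by linarith [ht.2]⟩
  deriv t ht := (hx.deriv (t + c) ⟨by linarith [ht.1], by linarith [ht.2]⟩).comp_add_const t c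

end

namespace ControlSystem

variable {S : ControlSystem U n r} {u v : Input U} {x y : ℝ → Fin n → ℝ}

/-- Nothing is required of the derivative at a switching time, so a trajectory splits into its arcs
of constant input; this permits induction on the input from the right. -/
theorem isTrajectory_append_singleton {α : U} {t : ℝ≥0} :
    S.IsTrajectory (u ++ [(α, t)]) x ↔
      S.IsTrajectory u x ∧ IsSolution (S.f α) S.X x (duration u) (duration u + t) := by
  have hdur : duration (u ++ [(α, t)]) = duration u + t := by
    rw [duration_append, duration_singleton]
  have ht : duration u ≤ duration u + t := by simp
  have htake : ∀ i ≤ u.length, (u ++ [(α, t)]).take i = u.take i := fun i hi =>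
    List.take_append_of_le_length hi
  constructor
  · intro h
    refine ⟨⟨h.init, h.cont.mono ?_, fun s hs => h.mem s ?_, fun i hi s hs => ?_⟩, ?_, ?_, ?_⟩
    · rw [hdur]; exact Icc_subset_Icc_right ht
    · rw [hdur]; exact Icc_subset_Icc_right ht hs
    · have := h.deriv i (by simp; omega) s (by rwa [htake i hi.le, htake _ hi])
      rwa [List.getElem_append_left hi] at this
    · refine h.cont.mono ?_
      rw [hdur]; exact Icc_subset_Icc_left (duration_nonneg u)
    · intro s hs
      refine h.mem s ?_
      rw [hdur]; exact Icc_subset_Icc_left (duration_nonneg u) hs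
    · intro s hs
      have := h.deriv u.length (by simp) s (by
        rw [htake _ le_rfl, List.take_length, List.take_of_length_le (by simp), hdur]
        exact hs)
      simpa using this
  · rintro ⟨h1, h2⟩
    have hun : Icc 0 (duration u + t) = Icc 0 (duration u) ∪ Icc (duration u) (duration u + t) :=
      (Icc_union_Icc_eq_Icc (duration_nonneg u) ht).symm
    refine ⟨h1.init, ?_, ?_, fun i hi s hs => ?_⟩
    · rw [hdur, hun]
      exact h1.cont.union_of_isClosed h2.cont isClosed_Icc isClosed_Icc
    · rw [hdur, hun]
      rintro s (hs | hs)
      · exact h1.mem s hs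
      · exact h2.mem s hs
    · have hi' : i < u.length + 1 := by simpa using hi
      rcases Nat.lt_succ_iff_lt_or_eq.1 hi' with hi' | rfl
      · rw [htake i hi'.le, htake _ hi'] at hs
        have := h1.deriv i hi' s hs
        rwa [List.getElem_append_left hi']
      · rw [htake _ le_rfl, List.take_length, List.take_of_length_le (by simp), hdur] at hs
        simpa using h2.deriv s hs

theorem isTrajectory_nil : S.IsTrajectory ([] : Input U) x ↔ x 0 = S.x₀ ∧ S.x₀ ∈ S.X := by
  constructor
  · intro h
    exact ⟨h.init, h.init ▸ h.mem 0 (by simp [duration_nil])⟩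
  · rintro ⟨h1, h2⟩
    refine ⟨h1, ?_, ?_, fun i hi => by simp at hi⟩
    · rw [duration_nil, Icc_self]; exact continuousOn_singleton x 0
    · rw [duration_nil, Icc_self]
      rintro t rfl
      rwa [h1]

theorem IsTrajectory.of_append (h : S.IsTrajectory (u ++ v) x) : S.IsTrajectory u x := by
  induction v using List.reverseRecOn with
  | nil => simpa using h
  | append_singleton v a ih =>
    rw [← List.append_assoc] at h
    exact ih (isTrajectory_append_singleton.1 h).1

theorem IsTrajectory.congr (h : S.IsTrajectory u x) (hxy : EqOn y x (Icc 0 (duration u))) :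
    S.IsTrajectory u y := by
  induction u using List.reverseRecOn with
  | nil =>
    rw [isTrajectory_nil] at h ⊢
    exact ⟨(hxy (by simp [duration_nil])).trans h.1, h.2⟩
  | append_singleton u a ih =>
    rw [duration_append, duration_singleton] at hxy
    rw [isTrajectory_append_singleton] at h ⊢
    have h1 : duration u ≤ duration u + a.2 := by simp
    exact ⟨ih h.1 (hxy.mono (Icc_subset_Icc_right h1)),
      h.2.congr (hxy.mono (Icc_subset_Icc_left (duration_nonneg u)))⟩

theorem IsTrajectory.eqOn (hf : ∀ α, AnalyticOnNhd ℝ (S.f α) S.X) (hx : S.IsTrajectory u x)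
    (hy : S.IsTrajectory u y) : EqOn x y (Icc 0 (duration u)) := by
  induction u using List.reverseRecOn with
  | nil =>
    rw [duration_nil, Icc_self]
    rintro t rfl
    rw [hx.init, hy.init]
  | append_singleton u a ih =>
    rw [isTrajectory_append_singleton] at hx hy
    have h1 := ih hx.1 hy.1
    have ht : duration u ≤ duration u + a.2 := by simp
    have h2 := hx.2.eqOn hy.2 (hf _) (h1 (right_mem_Icc.2 (duration_nonneg u)))
    rw [duration_append, duration_singleton, ← Icc_union_Icc_eq_Icc (duration_nonneg u) ht]
    exact h1.union h2

theorem IsTrajectory.hasUniqueTrajectory (hf : ∀ α, AnalyticOnNhd ℝ (S.f α) S.X)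
    (hx : S.IsTrajectory u x) : S.HasUniqueTrajectory u := ⟨x, hx, fun _ hy => hy.eqOn hf hx⟩

theorem IsTrajectory.glue {α : U} {t : ℝ≥0} (hx : S.IsTrajectory u x)
    (hy : IsSolution (S.f α) S.X y 0 t) (h : y 0 = x (duration u)) :
    ∃ z, S.IsTrajectory (u ++ [(α, t)]) z ∧ z (duration u + t) = y t := by
  classical
  set z : ℝ → Fin n → ℝ := fun s => if s ≤ duration u then x s else y (s - duration u) with hz
  have h1 : EqOn z x (Icc 0 (duration u)) := fun s hs => by simp [hz, hs.2]
  have h2 : EqOn z (fun s => y (s + -duration u)) (Icc (duration u) (duration u + t)) := by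
    intro s hs
    rcases hs.1.eq_or_lt with rfl | hlt
    · simp [hz, h]
    · simp [hz, hlt, sub_eq_add_neg]
  refine ⟨z, isTrajectory_append_singleton.2 ⟨hx.congr h1, ?_⟩, ?_⟩
  · refine IsSolution.congr (IsSolution.comp_add ?_) h2
    simpa using hy
  · rw [h2 ⟨by simp, le_rfl⟩]
    simp

end ControlSystem

/-! ### Existence of inputs -/

/-- An upper bound for the distance covered under the input `u`, for speed bounds `M`. -/
noncomputable def cost (M : U → ℝ≥0) (u : Input U) : ℝ≥0 := (u.map fun a => M a.1 * a.2).sum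

/-- An explicit admissible set, small enough for trajectories to exist on all of it. Cost grows with
the times and is linear in them, which leaves room for prolongations and perturbations under a
strict bound. -/
theorem isAdmissible_cost_lt (M : U → ℝ≥0) {ρ : ℝ≥0} (hρ : 0 < ρ) :
    IsAdmissible {u : Input U | cost M u < ρ} where
  empty_mem := by simpa [cost] using hρ
  restrict_mem w v α s t h hs := by
    rw [mem_ofPred_eq] at h ⊢
    refine lt_of_le_of_lt ?_ h
    simp only [cost, List.map_append, List.map_cons, List.sum_append, List.sum_cons, List.map_nil,
      List.sum_nil, add_zero]
    gcongr
    exact le_add_right (by gcongr)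
  extend_mem u hu α := by
    -- The `+ 1` avoids division by zero and keeps the increase of the cost strictly below what
    -- remains of `ρ`.
    have hpos : 0 < (ρ - cost M u) / (M α + 1) := div_pos (tsub_pos_of_lt hu) (by positivity)
    refine ⟨_, hpos, ?_⟩
    simp only [cost, List.map_append, List.map_cons, List.sum_append, List.sum_cons, List.map_nil,
      List.sum_nil, add_zero, mem_ofPred_eq]
    change cost M u + _ < ρ
    have : M α * ((ρ - cost M u) / (M α + 1)) < ρ - cost M u := by
      rw [← mul_div_assoc, div_lt_iff₀ (by positivity), mul_comm]
      exact mul_lt_mul_of_pos_left (by simp) (tsub_pos_of_lt hu)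
    exact lt_tsub_iff_left.1 this
  perturb_mem u hu := by
    -- Lengthening every piece by at most `δ` raises the cost by at most `K * δ`.
    set K : ℝ≥0 := (u.map fun a => M a.1).sum with hK
    have hpos : 0 < (ρ - cost M u) / (K + 1) := div_pos (tsub_pos_of_lt hu) (by positivity)
    refine ⟨_, hpos, fun v hv => ?_⟩
    have key : ∀ (δ : ℝ≥0) (u v : Input U), List.Forall₂ (fun a b => b.1 = a.1 ∧ b.2 ≤ a.2 + δ) u v →
        cost M v ≤ cost M u + (u.map fun a => M a.1).sum * δ := by
      intro δ u v huv
      induction huv with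
      | nil => simp [cost]
      | @cons a b l₁ l₂ hab _ ih =>
        simp only [cost, List.map_cons, List.sum_cons] at ih ⊢
        rw [hab.1]
        calc _ ≤ M a.1 * (a.2 + δ) + ((l₁.map fun a => M a.1 * a.2).sum +
              (l₁.map fun a => M a.1).sum * δ) := by gcongr; exact hab.2
          _ = _ := by ring
    refine (key _ u v hv).trans_lt ?_
    rw [← hK]
    have : K * ((ρ - cost M u) / (K + 1)) < ρ - cost M u := by
      rw [← mul_div_assoc, div_lt_iff₀ (by positivity), mul_comm]
      exact mul_lt_mul_of_pos_left (by simp) (tsub_pos_of_lt hu)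
    exact lt_tsub_iff_left.1 this

namespace ControlSystem

variable {S : ControlSystem U n r} {u v : Input U} {x y : ℝ → Fin n → ℝ}

/-- The distance bound is part of the induction: it puts the ball of radius `M α * t` around the
current state inside the large ball, so the next arc exists, and by the triangle inequality it is
renewed. -/
theorem exists_isTrajectory_of_cost (hf : ∀ α, AnalyticOnNhd ℝ (S.f α) S.X) {ρ : ℝ≥0}
    (hρ : Metric.closedBall S.x₀ ρ ⊆ S.X) {M : U → ℝ≥0}
    (hM : ∀ α, ∀ z ∈ Metric.closedBall S.x₀ ρ, ‖S.f α z‖ ≤ M α) (hu : cost M u ≤ ρ) :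
    ∃ x, S.IsTrajectory u x ∧ dist (x (duration u)) S.x₀ ≤ cost M u := by
  induction u using List.reverseRecOn with
  | nil =>
    refine ⟨fun _ => S.x₀, isTrajectory_nil.2 ⟨rfl, hρ (Metric.mem_closedBall_self ρ.2)⟩, ?_⟩
    simp
  | append_singleton u a ih =>
    have hcost : cost M (u ++ [a]) = cost M u + M a.1 * a.2 := by simp [cost]
    rw [hcost] at hu
    obtain ⟨x, hx, hxd⟩ := ih (le_self_add.trans hu)
    have hsub : Metric.closedBall (x (duration u)) (M a.1 * a.2 : ℝ≥0) ⊆ Metric.closedBall S.x₀ ρ := by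
      refine Metric.closedBall_subset_closedBall' ?_
      calc _ ≤ ((M a.1 * a.2 : ℝ≥0) : ℝ) + cost M u := by gcongr
        _ ≤ ρ := by rw [add_comm]; exact_mod_cast hu
    obtain ⟨y, hy0, hy⟩ := exists_isSolution (f := S.f a.1) (z := x (duration u))
      (ρ := M a.1 * a.2) (M := M a.1) (T := a.2) a.2.2 ((hf a.1).mono (hsub.trans hρ))
      (fun w hw => hM a.1 w (hsub hw)) (by simp)
    obtain ⟨z, hz, hzy⟩ := hx.glue (hy.mono_set (hsub.trans hρ)) hy0
    refine ⟨z, hz, ?_⟩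
    rw [duration_append, duration_singleton, hzy, hcost]
    have := hy.mem a.2 ⟨a.2.2, le_rfl⟩
    calc dist (y a.2) S.x₀ ≤ dist (y a.2) (x (duration u)) + dist (x (duration u)) S.x₀ :=
          dist_triangle _ _ _
      _ ≤ (M a.1 * a.2 : ℝ≥0) + cost M u := add_le_add this hxd
      _ = _ := by push_cast; ring

theorem IsNashSystem.analytic_f (hS : S.IsNashSystem) (α : U) : AnalyticOnNhd ℝ (S.f α) S.X :=
  (hS.nash_f α).analyticOnNhd

/-- A union of admissible sets is admissible provided the family is non-empty. Bounds for the `f α`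
on a closed ball around `x₀` supply one member; they may depend on `α`, as `U` need not be compact.
-/
theorem IsNashSystem.isAdmissible_inputs (hS : S.IsNashSystem) : IsAdmissible S.inputs := by
  refine IsAdmissible.sUnion ?_ fun A hA => hA.1
  obtain ⟨ρ, hρ, hball⟩ := Metric.nhds_basis_closedBall.mem_iff.1 (hS.isOpen.mem_nhds hS.mem_x₀)
  have hM : ∀ α, ∃ M : ℝ≥0, ∀ z ∈ Metric.closedBall S.x₀ ρ, ‖S.f α z‖ ≤ M := by
    intro α
    obtain ⟨C, hC⟩ := (isCompact_closedBall S.x₀ ρ).exists_bound_of_continuousOn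
      ((hS.analytic_f α).continuousOn.mono hball)
    exact ⟨C.toNNReal, fun z hz => (hC z hz).trans (Real.le_coe_toNNReal C)⟩
  choose M hM using hM
  lift ρ to ℝ≥0 using hρ.le
  refine ⟨_, isAdmissible_cost_lt M (ρ := ρ) (by exact_mod_cast hρ), fun u hu => ?_⟩
  obtain ⟨x, hx, -⟩ := exists_isTrajectory_of_cost hS.analytic_f hball hM (le_of_lt hu)
  exact hx.hasUniqueTrajectory hS.analytic_f

theorem hasUniqueTrajectory_of_mem (hu : u ∈ S.inputs) : S.HasUniqueTrajectory u := by
  obtain ⟨A, hA, hu⟩ := hu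
  exact hA.2 u hu

theorem isTrajectory_traj (hu : u ∈ S.inputs) : S.IsTrajectory u (S.traj u) := by
  obtain ⟨x, hx, -⟩ := hasUniqueTrajectory_of_mem hu
  have h : ∃ x, S.IsTrajectory u x := ⟨x, hx⟩
  rw [traj, dif_pos h]
  exact h.choose_spec

theorem traj_eqOn (hu : u ∈ S.inputs) (hx : S.IsTrajectory u x) :
    EqOn (S.traj u) x (Icc 0 (duration u)) := by
  obtain ⟨y, hy, h⟩ := hasUniqueTrajectory_of_mem hu
  exact (h _ (isTrajectory_traj hu)).trans (h _ hx).symm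

theorem endState_eq (hu : u ∈ S.inputs) (hx : S.IsTrajectory u x) :
    S.endState u = x (duration u) := traj_eqOn hu hx (right_mem_Icc.2 (duration_nonneg u))

theorem endState_mem (hu : u ∈ S.inputs) : S.endState u ∈ S.X :=
  (isTrajectory_traj hu).mem _ (right_mem_Icc.2 (duration_nonneg u))

theorem reachable_subset : S.reachable ⊆ S.X := by
  rintro _ ⟨u, hu, rfl⟩
  exact endState_mem hu

theorem IsNashSystem.endState_nil (hS : S.IsNashSystem) : S.endState ([] : Input U) = S.x₀ :=
  (isTrajectory_traj hS.isAdmissible_inputs.empty_mem).init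

/-- The curve along which the state moves when an input is prolonged. -/
theorem IsNashSystem.exists_curve (hS : S.IsNashSystem) {α : U} {t : ℝ≥0}
    (h : u ++ [(α, t)] ∈ S.inputs) : ∃ γ : ℝ → Fin n → ℝ, IsSolution (S.f α) S.X γ 0 t ∧
      γ 0 = S.endState u ∧ (∀ s : ℝ≥0, s ≤ t → γ s = S.endState (u ++ [(α, s)])) ∧
      ∀ s ∈ Icc (0 : ℝ) t, γ s = S.traj (u ++ [(α, t)]) (duration u + s) := by
  have hT := isTrajectory_append_singleton.1 (isTrajectory_traj h)
  refine ⟨fun s => S.traj (u ++ [(α, t)]) (s + duration u), ?_, ?_, ?_, ?_⟩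
  · refine IsSolution.comp_add ?_
    simpa [add_comm] using hT.2
  · beta_reduce
    rw [zero_add]
    exact (endState_eq (hS.isAdmissible_inputs.prefix_mem h) hT.1).symm
  · intro s hs
    have hmem := hS.isAdmissible_inputs.restrict_mem u [] α s t h hs
    have : S.IsTrajectory (u ++ [(α, s)]) (S.traj (u ++ [(α, t)])) :=
      isTrajectory_append_singleton.2 ⟨hT.1, hT.2.mono (by gcongr)⟩
    rw [endState_eq hmem this, duration_append, duration_singleton, add_comm]
  · intro s _
    simp only [add_comm]

end ControlSystem

/-! ### Lie derivatives and functions vanishing on the reachable set -/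

/-- The derivative of `g` along the vector field `f`. -/
noncomputable def lieDeriv (f : (Fin n → ℝ) → (Fin n → ℝ)) (g : (Fin n → ℝ) → ℝ)
    (x : Fin n → ℝ) : ℝ := fderiv ℝ g x (f x)

section

variable {f : (Fin n → ℝ) → (Fin n → ℝ)} {g : (Fin n → ℝ) → ℝ} {X : Set (Fin n → ℝ)}
  {γ : ℝ → Fin n → ℝ} {a b c : ℝ}

theorem analyticOnNhd_lieDeriv (hg : AnalyticOnNhd ℝ g X) (hf : AnalyticOnNhd ℝ f X) :
    AnalyticOnNhd ℝ (lieDeriv f g) X := fun x hx =>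
  ((ContinuousLinearMap.apply ℝ ℝ).analyticAt_bilinear (f x, fderiv ℝ g x)).comp₂ (hf x hx)
    (hg x hx).fderiv

theorem analyticOnNhd_iterate_lieDeriv (hg : AnalyticOnNhd ℝ g X) (hf : AnalyticOnNhd ℝ f X)
    (j : ℕ) : AnalyticOnNhd ℝ ((lieDeriv f)^[j] g) X := by
  induction j with
  | zero => exact hg
  | succ j ih =>
    rw [Function.iterate_succ_apply']
    exact analyticOnNhd_lieDeriv ih hf

theorem IsSolution.hasDerivWithinAt_comp (hγ : IsSolution f X γ a b) (hf : AnalyticOnNhd ℝ f X)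
    (hg : AnalyticOnNhd ℝ g X) {t : ℝ} (ht : t ∈ Icc a b) :
    HasDerivWithinAt (fun t => g (γ t)) (lieDeriv f g (γ t)) (Icc a b) t :=
  (hg _ (hγ.mem t ht)).differentiableAt.hasFDerivAt.comp_hasDerivWithinAt t
    (hγ.hasDerivWithinAt hf ht)

theorem IsSolution.analyticOn_comp (hγ : IsSolution f X γ a b) (hf : AnalyticOnNhd ℝ f X)
    (hg : AnalyticOnNhd ℝ g X) : AnalyticOn ℝ (fun t => g (γ t)) (Icc a b) :=
  hg.comp_analyticOn (hγ.analyticOn hf) hγ.mem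

/-- Two functions along a solution with the same derivatives at one point agree. -/
theorem IsSolution.eq_of_tower (hγ : IsSolution f X γ a b) (hf : AnalyticOnNhd ℝ f X)
    (hg : AnalyticOnNhd ℝ g X) (hc : c ∈ Icc a b) {F : ℕ → ℝ → ℝ}
    (hF : ∀ j, ∀ t ∈ Icc a b, HasDerivWithinAt (F j) (F (j + 1) t) (Icc a b) t)
    (hF0 : AnalyticOn ℝ (F 0) (Icc a b)) (h : ∀ j, F j c = ((lieDeriv f)^[j] g) (γ c)) :
    ∀ t ∈ Icc a b, F 0 t = g (γ t) := by
  rcases (hc.1.trans hc.2).eq_or_lt with rfl | hab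
  · intro t ht
    obtain rfl : t = c := by linarith [ht.1, ht.2, hc.1, hc.2]
    exact h 0
  intro t ht
  have := eq_zero_of_tower hab hc (g := fun j t => F j t - ((lieDeriv f)^[j] g) (γ t)) (fun j t ht => by
      refine (hF j t ht).sub ?_
      rw [Function.iterate_succ_apply']
      exact hγ.hasDerivWithinAt_comp hf (analyticOnNhd_iterate_lieDeriv hg hf j) ht) (fun j => by
      simp [h]) (hF0.sub (hγ.analyticOn_comp hf hg)) t ht
  exact sub_eq_zero.1 this

end

namespace ControlSystem

variable {S : ControlSystem U n r} {g : (Fin n → ℝ) → ℝ} {x : Fin n → ℝ}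

/-- All iterated derivatives of `g` along the vector fields of the system vanish at `x`. -/
def VanishesAt (S : ControlSystem U n r) (g : (Fin n → ℝ) → ℝ) (x : Fin n → ℝ) : Prop :=
  ∀ w : List U, (w.foldr (fun α g => lieDeriv (S.f α) g) g) x = 0

theorem VanishesAt.eq_zero (h : S.VanishesAt g x) : g x = 0 := h []

theorem analyticOnNhd_foldr (hf : ∀ α, AnalyticOnNhd ℝ (S.f α) S.X) (hg : AnalyticOnNhd ℝ g S.X)
    (w : List U) : AnalyticOnNhd ℝ (w.foldr (fun α g => lieDeriv (S.f α) g) g) S.X := by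
  induction w with
  | nil => exact hg
  | cons α w ih => exact analyticOnNhd_lieDeriv ih (hf α)

theorem foldr_replicate_append (α : U) (j : ℕ) (w : List U) :
    ((List.replicate j α ++ w).foldr (fun α g => lieDeriv (S.f α) g) g) =
      (lieDeriv (S.f α))^[j] (w.foldr (fun α g => lieDeriv (S.f α) g) g) := by
  induction j with
  | zero => rfl
  | succ j ih =>
    rw [Function.iterate_succ_apply', ← ih, List.replicate_succ, List.cons_append, List.foldr_cons]

/-- The vanishing of all derivatives propagates along trajectories, in both directions. -/
theorem VanishesAt.propagate (hf : ∀ α, AnalyticOnNhd ℝ (S.f α) S.X) (hg : AnalyticOnNhd ℝ g S.X)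
    {α : U} {γ : ℝ → Fin n → ℝ} {a b : ℝ} (hγ : IsSolution (S.f α) S.X γ a b) {c : ℝ}
    (hc : c ∈ Icc a b) (h : S.VanishesAt g (γ c)) {t : ℝ} (ht : t ∈ Icc a b) :
    S.VanishesAt g (γ t) := by
  intro w
  -- The derivatives along `γ` of the function belonging to `w` belong to the words with copies of
  -- `α` put in front, so they all vanish at `c`; comparison is with the zero tower.
  have := hγ.eq_of_tower (hf α) (analyticOnNhd_foldr hf hg w) hc (F := fun _ _ => 0)
    (fun j t _ => hasDerivWithinAt_const t _ _) analyticOn_const (fun j => by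
      rw [← foldr_replicate_append, h]) t ht
  exact this.symm

/-- Propagation backwards along each arc leads to `x₀`, propagation forwards leads from it, so the
property holds at all reachable states or at none. -/
theorem IsNashSystem.vanishesAt_endState_iff (hS : S.IsNashSystem) (hg : AnalyticOnNhd ℝ g S.X)
    {u : Input U} (hu : u ∈ S.inputs) : S.VanishesAt g (S.endState u) ↔ S.VanishesAt g S.x₀ := by
  induction u using List.reverseRecOn with
  | nil => rw [hS.endState_nil]
  | append_singleton u a ih =>
    rw [← ih (hS.isAdmissible_inputs.prefix_mem hu)]
    obtain ⟨γ, hγ, h0, h1, -⟩ := hS.exists_curve hu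
    have hl : (0 : ℝ) ∈ Icc (0 : ℝ) a.2 := left_mem_Icc.2 a.2.2
    have hr : (a.2 : ℝ) ∈ Icc (0 : ℝ) a.2 := right_mem_Icc.2 a.2.2
    rw [← h0, ← h1 a.2 le_rfl]
    exact ⟨fun h => h.propagate hS.analytic_f hg hγ hr hl,
      fun h => h.propagate hS.analytic_f hg hγ hl hr⟩

/-- A function which vanishes on the states reached after a prolongable set of inputs has vanishing
derivatives. -/
theorem IsNashSystem.vanishesAt_of_isProlongable (hS : S.IsNashSystem)
    (hg : AnalyticOnNhd ℝ g S.X) {u : Input U} {E : Set (Input U)} (hE : IsProlongable E)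
    (hEu : ∀ v ∈ E, u ++ v ∈ S.inputs) (h : ∀ v ∈ E, g (S.endState (u ++ v)) = 0) :
    S.VanishesAt g (S.endState u) := by
  intro w
  -- The claim is made for every `v ∈ E`, since taking one more derivative requires vanishing along
  -- a whole short arc and not just at `x_u`.
  suffices H : ∀ v ∈ E, (w.foldr (fun α g => lieDeriv (S.f α) g) g) (S.endState (u ++ v)) = 0 by
    simpa using H [] hE.nil_mem
  induction w with
  | nil => exact h
  | cons α w ih =>
    intro v hv
    obtain ⟨t, ht, hvt⟩ := hE.exists_prolong v hv α
    have hmem := hEu _ (hvt t le_rfl)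
    rw [← List.append_assoc] at hmem
    obtain ⟨γ, hγ, h0, h1, -⟩ := hS.exists_curve hmem
    have ht' : (0 : ℝ) < t := by exact_mod_cast ht
    have h2 := hγ.hasDerivWithinAt_comp (hS.analytic_f α) (analyticOnNhd_foldr hS.analytic_f hg w)
      (left_mem_Icc.2 ht'.le)
    have h3 : HasDerivWithinAt (fun s => (w.foldr (fun α g => lieDeriv (S.f α) g) g) (γ s)) 0
        (Icc 0 t) 0 := by
      refine (hasDerivWithinAt_const (0 : ℝ) (Icc (0 : ℝ) t) (0 : ℝ)).congr_of_mem ?_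
        (left_mem_Icc.2 ht'.le)
      intro s hs
      have := ih _ (hvt ⟨s, hs.1⟩ hs.2)
      rwa [← List.append_assoc, ← h1 ⟨s, hs.1⟩ hs.2] at this
    rw [h0] at h2
    exact (uniqueDiffOn_Icc ht' 0 (left_mem_Icc.2 ht'.le)).eq_deriv _ h2 h3

/-- The density principle: states reached after a prolongable set of continuations of a single input
detect the vanishing of an analytic function on the entire reachable set. -/
theorem IsNashSystem.eq_zero_on_reachable (hS : S.IsNashSystem)
    (hg : AnalyticOnNhd ℝ g S.X) {u : Input U} (hu : u ∈ S.inputs) {E : Set (Input U)}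
    (hE : IsProlongable E) (hEu : ∀ v ∈ E, u ++ v ∈ S.inputs)
    (h : ∀ v ∈ E, g (S.endState (u ++ v)) = 0) : ∀ x ∈ S.reachable, g x = 0 := by
  rintro _ ⟨v, hv, rfl⟩
  have h1 := (hS.vanishesAt_endState_iff hg hu).1 (hS.vanishesAt_of_isProlongable hg hE hEu h)
  exact ((hS.vanishesAt_endState_iff hg hv).2 h1).eq_zero

/-- The inputs after which the state of the system lies in an open set form a prolongable set. -/
theorem IsNashSystem.isProlongable_endState_mem (hS : S.IsNashSystem) {u : Input U}
    (hu : u ∈ S.inputs) {N : Set (Fin n → ℝ)} (hN : IsOpen N) (huN : S.endState u ∈ N) :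
    IsProlongable {v | u ++ v ∈ S.inputs ∧ S.endState (u ++ v) ∈ N} where
  nil_mem := by simpa using ⟨hu, huN⟩
  exists_prolong v hv α := by
    obtain ⟨t, ht, h⟩ := hS.isAdmissible_inputs.exists_extend hv.1 α
    obtain ⟨γ, hγ, h0, h1, -⟩ := hS.exists_curve (h t le_rfl)
    have ht' : (0 : ℝ) < t := by exact_mod_cast ht
    have hc := hγ.cont 0 (left_mem_Icc.2 ht'.le)
    have hev : ∀ᶠ s in nhdsWithin 0 (Icc (0 : ℝ) t), γ s ∈ N :=
      hc.eventually (hN.mem_nhds (by rw [h0]; exact hv.2))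
    obtain ⟨δ, hδ, hball⟩ := Metric.mem_nhdsWithin_iff.1 hev
    lift δ to ℝ≥0 using le_of_lt hδ
    refine ⟨min t (δ / 2), lt_min ht (by have : 0 < δ := by exact_mod_cast hδ
                                         positivity), fun s hs => ?_⟩
    have hst : s ≤ t := hs.trans (min_le_left _ _)
    have hsδ : s ≤ δ / 2 := hs.trans (min_le_right _ _)
    rw [mem_ofPred_eq, ← List.append_assoc]
    refine ⟨h s hst, ?_⟩
    rw [← h1 s hst]
    refine hball ⟨?_, s.2, hst⟩
    rw [mem_ball_zero_iff, Real.norm_of_nonneg s.coe_nonneg]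
    have : (s : ℝ) ≤ (δ : ℝ) / 2 := by exact_mod_cast hsδ
    linarith

/-- Functions vanishing on the reachable set form a prime ideal. -/
theorem IsNashSystem.prime (hS : S.IsNashSystem) {g h : (Fin n → ℝ) → ℝ}
    (hg : AnalyticOnNhd ℝ g S.X) (hh : AnalyticOnNhd ℝ h S.X)
    (hgh : ∀ x ∈ S.reachable, g x * h x = 0) :
    (∀ x ∈ S.reachable, g x = 0) ∨ ∀ x ∈ S.reachable, h x = 0 := by
  by_contra! H
  obtain ⟨⟨_, ⟨u, hu, rfl⟩, hx⟩, y, hy, hhy⟩ := H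
  -- Near a reachable state where `g ≠ 0` the other factor must vanish, and the inputs keeping the
  -- state there are prolongable.
  refine hhy (hS.eq_zero_on_reachable hh hu
    (hS.isProlongable_endState_mem hu (N := S.X ∩ g ⁻¹' {0}ᶜ) ?_ ⟨endState_mem hu, hx⟩)
    (fun v hv => hv.1) (fun v hv => ?_) y hy)
  · exact hg.continuousOn.isOpen_inter_preimage hS.isOpen isOpen_compl_singleton
  · exact (mul_eq_zero.1 (hgh _ ⟨_, hv.1, rfl⟩)).resolve_left hv.2.2

end ControlSystem

/-! ### Semi-algebraic functions are algebraic -/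

section Algebraic

variable {X R : Set (Fin n → ℝ)} {g : (Fin n → ℝ) → ℝ}

/-- Products of polynomial functions vanish on `R` only if one of the factors does. -/
def PolyPrime (R : Set (Fin n → ℝ)) : Prop :=
  ∀ P Q : MvPolynomial (Fin n) ℝ,
    (∀ x ∈ R, MvPolynomial.eval x P * MvPolynomial.eval x Q = 0) →
      (∀ x ∈ R, MvPolynomial.eval x P = 0) ∨ ∀ x ∈ R, MvPolynomial.eval x Q = 0

/-- A real number `y` that is a root of neither specialized polynomial reduces the claim to the
values at `y`, which are polynomials in `x` alone. -/
theorem PolyPrime.polynomial (hR : PolyPrime R) {p q : Polynomial (MvPolynomial (Fin n) ℝ)}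
    (hp : ∃ x ∈ R, p.map (MvPolynomial.eval x) ≠ 0)
    (hq : ∃ x ∈ R, q.map (MvPolynomial.eval x) ≠ 0) :
    ∃ x ∈ R, (p * q).map (MvPolynomial.eval x) ≠ 0 := by
  obtain ⟨x₀, hx₀, hp⟩ := hp
  obtain ⟨x₁, hx₁, hq⟩ := hq
  obtain ⟨y, hy⟩ : ∃ y, ((p.map (MvPolynomial.eval x₀)) * (q.map (MvPolynomial.eval x₁))).eval y ≠ 0 := by
    by_contra! H
    exact mul_ne_zero hp hq (Polynomial.funext fun y => by simp [H y])
  have key : ∀ (x : Fin n → ℝ) (p : Polynomial (MvPolynomial (Fin n) ℝ)),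
      (p.map (MvPolynomial.eval x)).eval y =
        MvPolynomial.eval x (p.eval (MvPolynomial.C y)) := fun x p => by
    rw [← Polynomial.eval₂_at_apply, MvPolynomial.eval_C, Polynomial.eval_map]
  rw [Polynomial.eval_mul, key, key] at hy
  by_contra! H
  rcases hR (p.eval (MvPolynomial.C y)) (q.eval (MvPolynomial.C y)) (fun x hx => by
    rw [← key, ← key, ← Polynomial.eval_mul, ← Polynomial.map_mul, H x hx, Polynomial.eval_zero])
    with h | h
  · exact left_ne_zero_of_mul hy (h x₀ hx₀)
  · exact right_ne_zero_of_mul hy (h x₁ hx₁)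

/-- A polynomial, seen as a polynomial in its last variable. -/
noncomputable def lastPoly (P : MvPolynomial (Fin (n + 1)) ℝ) :
    Polynomial (MvPolynomial (Fin n) ℝ) :=
  MvPolynomial.aeval (Fin.snoc (fun i => Polynomial.C (MvPolynomial.X i)) Polynomial.X :
    Fin (n + 1) → Polynomial (MvPolynomial (Fin n) ℝ)) P

theorem eval_map_lastPoly (P : MvPolynomial (Fin (n + 1)) ℝ) (x : Fin n → ℝ) (y : ℝ) :
    ((lastPoly P).map (MvPolynomial.eval x)).eval y =
      MvPolynomial.eval (Fin.snoc x y : Fin (n + 1) → ℝ) P := by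
  induction P using MvPolynomial.induction_on with
  | C a => simp [lastPoly, Polynomial.algebraMap_apply]
  | add p q hp hq => rw [map_add, ← hp, ← hq]; simp [lastPoly]
  | mul_X p i hp =>
    rw [map_mul, ← hp]
    refine Fin.lastCases ?_ (fun j => ?_) i <;> simp [lastPoly]

/-- A semi-algebraic function is algebraic over the polynomials. -/
theorem exists_polynomial_of_isSemialgebraic (hg : IsSemialgebraic (graphOver X g)) (hRX : R ⊆ X)
    (hne : R.Nonempty) (hR : PolyPrime R) :
    ∃ p : Polynomial (MvPolynomial (Fin n) ℝ),
      (∀ x ∈ R, (p.map (MvPolynomial.eval x)).eval (g x) = 0) ∧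
        ∃ x ∈ R, p.map (MvPolynomial.eval x) ≠ 0 := by
  classical
  obtain ⟨C, hC⟩ := hg
  -- From each piece of the graph one equation is selected that does not vanish identically over
  -- `R`, or `1` if there is none; the product of the selected polynomials is the required one.
  have hchoose : ∀ c : Finset (MvPolynomial (Fin (n + 1)) ℝ) × Finset (MvPolynomial (Fin (n + 1)) ℝ),
      ∃ p : Polynomial (MvPolynomial (Fin n) ℝ), (∃ x ∈ R, p.map (MvPolynomial.eval x) ≠ 0) ∧
        ((∃ P ∈ c.1, ∃ x ∈ R, (lastPoly P).map (MvPolynomial.eval x) ≠ 0) →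
          ∃ P ∈ c.1, p = lastPoly P) := by
    intro c
    by_cases h : ∃ P ∈ c.1, ∃ x ∈ R, (lastPoly P).map (MvPolynomial.eval x) ≠ 0
    · obtain ⟨P, hP, hx⟩ := h
      exact ⟨_, hx, fun _ => ⟨P, hP, rfl⟩⟩
    · obtain ⟨x, hx⟩ := hne
      exact ⟨1, ⟨x, hx, by simp⟩, fun h' => absurd h' h⟩
  choose p hp1 hp2 using hchoose
  refine ⟨∏ c ∈ C, p c, fun x hx => ?_, Finset.prod_induction p
    (fun p => ∃ x ∈ R, p.map (MvPolynomial.eval x) ≠ 0) (fun _ _ => hR.polynomial) ?_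
    fun c _ => hp1 c⟩
  · have hmem : ∀ y, y = g x ↔ ∃ c ∈ C,
        (∀ P ∈ c.1, ((lastPoly P).map (MvPolynomial.eval x)).eval y = 0) ∧
        ∀ Q ∈ c.2, 0 < ((lastPoly Q).map (MvPolynomial.eval x)).eval y := by
      intro y
      simp only [eval_map_lastPoly]
      have : (Fin.snoc x y : Fin (n + 1) → ℝ) ∈ graphOver X g ↔ y = g x := by
        simp [graphOver, hRX hx]
      rw [← this, hC]
      rfl
    obtain ⟨c, hc, h1, h2⟩ := (hmem (g x)).1 rfl
    rw [Polynomial.map_prod, Polynomial.eval_prod]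
    refine Finset.prod_eq_zero hc ?_
    by_cases h : ∃ P ∈ c.1, ∃ x ∈ R, (lastPoly P).map (MvPolynomial.eval x) ≠ 0
    · obtain ⟨P, hP, hpP⟩ := hp2 c h
      rw [hpP]
      exact h1 P hP
    -- If all equations of the piece through `g x` are trivial over `R`, only strict inequalities
    -- restrict `y` there. They define an open subset of `ℝ`, but the graph has a single point over
    -- `x`.
    · push Not at h
      have hopen : IsOpen {y : ℝ | ∀ Q ∈ c.2, 0 < ((lastPoly Q).map (MvPolynomial.eval x)).eval y} := by
        have : {y : ℝ | ∀ Q ∈ c.2, 0 < ((lastPoly Q).map (MvPolynomial.eval x)).eval y} =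
            ⋂ Q ∈ c.2, {y : ℝ | 0 < ((lastPoly Q).map (MvPolynomial.eval x)).eval y} := by
          ext; simp
        rw [this]
        exact isOpen_biInter_finset fun Q _ =>
          isOpen_lt continuous_const (Polynomial.continuous _)
      have hsub : {y : ℝ | ∀ Q ∈ c.2, 0 < ((lastPoly Q).map (MvPolynomial.eval x)).eval y} ⊆
          {g x} := fun y hy =>
        (hmem y).2 ⟨c, hc, fun P hP => by rw [h P hP x hx, Polynomial.eval_zero], hy⟩
      have heq : {y : ℝ | ∀ Q ∈ c.2, 0 < ((lastPoly Q).map (MvPolynomial.eval x)).eval y} =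
          {g x} := hsub.antisymm (singleton_subset_iff.2 h2)
      rw [heq] at hopen
      exact absurd hopen (not_isOpen_singleton _)
  · obtain ⟨x, hx⟩ := hne
    exact ⟨x, hx, by simp⟩

end Algebraic

/-! ### The quotient of the ring of Nash functions by a vanishing ideal -/

section Quotient

variable {X R : Set (Fin n → ℝ)}

theorem exists_isNash_of_mem_nashRing (hX : IsSemialgebraic X) {g : X → ℝ} (hg : g ∈ nashRing X) :
    ∃ g', IsNash X g' ∧ g = fun x : X => g' x := by
  refine Algebra.adjoin_induction (fun g hg => hg) (fun c => ?_) ?_ ?_ hg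
  · refine ⟨fun _ => c, by simpa using isNash_eval hX (MvPolynomial.C c), ?_⟩
    ext x
    simp
  · rintro _ _ _ _ ⟨a, ha, rfl⟩ ⟨b, hb, rfl⟩
    exact ⟨_, ha.add hb, rfl⟩
  · rintro _ _ _ _ ⟨a, ha, rfl⟩ ⟨b, hb, rfl⟩
    exact ⟨_, ha.mul hb, rfl⟩

theorem exists_mk_toRing (hX : IsSemialgebraic X) (a : nashRing X ⧸ vanishingIdeal X R) :
    ∃ (g : (Fin n → ℝ) → ℝ) (hg : IsNash X g), a = Ideal.Quotient.mk _ hg.toRing := by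
  obtain ⟨b, rfl⟩ := Ideal.Quotient.mk_surjective a
  obtain ⟨g, hg, h⟩ := exists_isNash_of_mem_nashRing hX b.2
  exact ⟨g, hg, congrArg _ (Subtype.ext h)⟩

/-- Evaluation of the classes modulo the vanishing ideal of `R` at the points of `R`. -/
noncomputable def evalQuot (hRX : R ⊆ X) : (nashRing X ⧸ vanishingIdeal X R) →ₐ[ℝ] (R → ℝ) :=
  Ideal.Quotient.liftₐ (vanishingIdeal X R)
    ((AlgHom.pi fun x =>
      Pi.evalAlgHom ℝ (fun _ : X => ℝ) ⟨x.1, hRX x.2⟩).comp (nashRing X).val)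
    (fun a ha => by
      ext x
      exact ha ⟨x.1, hRX x.2⟩ x.2)

theorem evalQuot_toRing (hRX : R ⊆ X) {g : (Fin n → ℝ) → ℝ} (hg : IsNash X g) (x : R) :
    evalQuot hRX (Ideal.Quotient.mk _ hg.toRing) x = g x := rfl

theorem evalQuot_injective (hRX : R ⊆ X) : Function.Injective (evalQuot hRX) := by
  rw [injective_iff_map_eq_zero]
  intro a ha
  obtain ⟨b, rfl⟩ := Ideal.Quotient.mk_surjective a
  refine Ideal.Quotient.eq_zero_iff_mem.2 fun x hx => ?_
  exact congrFun ha ⟨x, hx⟩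

theorem evalQuot_comp_aeval (hRX : R ⊆ X) {ι : Type*} {t : ι → (Fin n → ℝ) → ℝ}
    (ht : ∀ i, IsNash X (t i)) (x : R) :
    ((Pi.evalRingHom (fun _ : R => ℝ) x).comp (evalQuot hRX).toRingHom).comp
      (MvPolynomial.aeval (fun i => Ideal.Quotient.mk (vanishingIdeal X R) (ht i).toRing) :
        MvPolynomial ι ℝ →ₐ[ℝ] _).toRingHom = MvPolynomial.eval fun i => t i x :=
  MvPolynomial.ringHom_ext (fun c => by simp) fun i => by simp [evalQuot_toRing]

theorem aeval_quot_eq_zero_iff (hRX : R ⊆ X) {ι : Type*} {t : ι → (Fin n → ℝ) → ℝ}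
    (ht : ∀ i, IsNash X (t i)) (P : MvPolynomial ι ℝ) :
    MvPolynomial.aeval (fun i => Ideal.Quotient.mk (vanishingIdeal X R) (ht i).toRing) P = 0 ↔
      ∀ x ∈ R, MvPolynomial.eval (fun i => t i x) P = 0 := by
  rw [← map_eq_zero_iff (evalQuot hRX) (evalQuot_injective hRX), funext_iff, Subtype.forall]
  refine forall₂_congr fun x hx => ?_
  rw [← evalQuot_comp_aeval hRX ht ⟨x, hx⟩]
  rfl

end Quotient

/-! ### Transcendence bases and relations of minimal degree -/

theorem isAlgebraic_adjoin_of_polynomial {ι B : Type*} [CommRing B] [Algebra ℝ B] {a : ι → B}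
    {b : B} (p : Polynomial (MvPolynomial ι ℝ))
    (hp : p.map (MvPolynomial.aeval a : MvPolynomial ι ℝ →ₐ[ℝ] B).toRingHom ≠ 0)
    (hb : (p.map (MvPolynomial.aeval a : MvPolynomial ι ℝ →ₐ[ℝ] B).toRingHom).eval b = 0) :
    IsAlgebraic (Algebra.adjoin ℝ (range a)) b := by
  set φ : MvPolynomial ι ℝ →ₐ[ℝ] Algebra.adjoin ℝ (range a) :=
    MvPolynomial.aeval fun i => ⟨a i, Algebra.subset_adjoin ⟨i, rfl⟩⟩ with hφ
  have hcomp : (algebraMap (Algebra.adjoin ℝ (range a)) B).comp φ.toRingHom =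
      (MvPolynomial.aeval a : MvPolynomial ι ℝ →ₐ[ℝ] B).toRingHom := by
    refine MvPolynomial.ringHom_ext (fun c => ?_) fun i => ?_
    · simp [hφ, ← IsScalarTower.algebraMap_apply]
    · simp [hφ]
  rw [← hcomp, ← Polynomial.map_map] at hp hb
  refine ⟨p.map φ.toRingHom, fun h => hp (by rw [h, Polynomial.map_zero]), ?_⟩
  rw [Polynomial.aeval_def, ← Polynomial.eval_map, hb]

/-- An algebra of semi-algebraic functions on `R` which contains the coordinates has a transcendence
basis consisting of coordinates. -/
theorem exists_isTranscendenceBasis_coord {B : Type*} [CommRing B] [Algebra ℝ B]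
    {X R : Set (Fin n → ℝ)} (ev : B →ₐ[ℝ] (R → ℝ)) (hev : Function.Injective ev)
    (hRX : R ⊆ X) (hne : R.Nonempty) (hR : PolyPrime R) (hB : ∀ a b : B, a * b = 0 → a = 0 ∨ b = 0)
    (hg : ∀ b : B, ∃ g, IsNash X g ∧ ∀ x : R, ev b x = g x) (π : Fin n → B)
    (hπ : ∀ i x, ev (π i) x = x.1 i) :
    ∃ (d : ℕ) (idx : Fin d → Fin n), IsTranscendenceBasis ℝ fun k => π (idx k) := by
  have h0 : Nontrivial B := by
    obtain ⟨x, hx⟩ := hne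
    refine ⟨0, 1, fun h => ?_⟩
    have := congrFun (congrArg ev h) ⟨x, hx⟩
    simp at this
  have hzero : NoZeroDivisors B := ⟨fun {a b} => hB a b⟩
  have halg : Algebra.IsAlgebraic (Algebra.adjoin ℝ (range π)) B := by
    refine ⟨fun b => ?_⟩
    obtain ⟨g, hg, hgb⟩ := hg b
    obtain ⟨p, hp, x₀, hx₀, hpx⟩ := exists_polynomial_of_isSemialgebraic hg.2 hRX hne hR
    have hcomp : ∀ x : R, ((Pi.evalRingHom (fun _ : R => ℝ) x).comp ev.toRingHom).comp
        (MvPolynomial.aeval π : MvPolynomial (Fin n) ℝ →ₐ[ℝ] B).toRingHom =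
          MvPolynomial.eval x.1 := fun x =>
      MvPolynomial.ringHom_ext (fun c => by simp) fun i => by simp [hπ]
    refine isAlgebraic_adjoin_of_polynomial p (fun h => hpx ?_) (hev ?_)
    · rw [← hcomp ⟨x₀, hx₀⟩, ← Polynomial.map_map, h, Polynomial.map_zero]
    · ext x
      have h1 := hp x.1 x.2
      rw [← hcomp x, ← Polynomial.map_map, ← hgb] at h1
      rw [map_zero, Pi.zero_apply, ← h1]
      exact (Polynomial.eval_map_apply ((Pi.evalRingHom (fun _ : R => ℝ) x).comp
        ev.toRingHom) _).symm
  obtain ⟨t, ht, hbasis⟩ := exists_isTranscendenceBasis_subset (R := ℝ) (range π)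
  have hfin : Finite t := ((finite_range _).subset ht).to_subtype
  obtain ⟨d, ⟨e⟩⟩ := Finite.exists_equiv_fin t
  choose idx hidx using fun k => ht (e.symm k).2
  refine ⟨d, idx, ?_⟩
  convert hbasis.comp_equiv e.symm using 1
  ext k
  exact hidx k

/-- Every element is algebraic over a transcendence basis, so adjoining `b` destroys independence.
-/
theorem exists_relation_of_isTranscendenceBasis {B : Type*} [CommRing B] [Algebra ℝ B]
    {t : Fin d → B} (ht : IsTranscendenceBasis ℝ t) (b : B) :
    ∃ P : MvPolynomial (Option (Fin d)) ℝ,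
      MvPolynomial.aeval (fun o : Option (Fin d) => o.elim b t) P = 0 ∧ P ≠ 0 := by
  have hind : ¬ AlgebraicIndependent ℝ _ :=
    fun h => (ht.1.option_iff_transcendental b).1 h (ht.isAlgebraic.isAlgebraic b)
  rw [algebraicIndependent_iff] at hind
  push Not at hind
  exact hind

namespace ControlSystem

variable {S : ControlSystem U n r} {Φ : (Fin n → ℝ) → (Fin d → ℝ)}

theorem IsNashSystem.x₀_mem_reachable (hS : S.IsNashSystem) : S.x₀ ∈ S.reachable :=
  ⟨[], hS.isAdmissible_inputs.empty_mem, hS.endState_nil.symm⟩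

theorem IsNashSystem.isPrime (hS : S.IsNashSystem) :
    (vanishingIdeal S.X S.reachable).IsPrime where
  ne_top' h := by
    have : (1 : nashRing S.X) ∈ vanishingIdeal S.X S.reachable := h ▸ Submodule.mem_top
    exact one_ne_zero (this ⟨S.x₀, hS.mem_x₀⟩ hS.x₀_mem_reachable)
  mem_or_mem' {a b} hab := by
    obtain ⟨g, hg, hga⟩ := exists_isNash_of_mem_nashRing hS.isSemialgebraic a.2
    obtain ⟨h, hh, hhb⟩ := exists_isNash_of_mem_nashRing hS.isSemialgebraic b.2
    refine (hS.prime hg.1 hh.1 fun x hx => ?_).imp (fun H x hx => ?_) fun H x hx => ?_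
    · have := hab ⟨x, reachable_subset hx⟩ hx
      rw [← congrFun hga ⟨x, reachable_subset hx⟩, ← congrFun hhb ⟨x, reachable_subset hx⟩]
      exact this
    · rw [hga]
      exact H x hx
    · rw [hhb]
      exact H x hx

theorem IsNashSystem.polyPrime (hS : S.IsNashSystem) : PolyPrime S.reachable := fun P Q h =>
  hS.prime (isNash_eval hS.isSemialgebraic P).1 (isNash_eval hS.isSemialgebraic Q).1 h

theorem IsNashSystem.exists_stepOne (hS : S.IsNashSystem) :
    ∃ (d : ℕ) (Φ : (Fin n → ℝ) → (Fin d → ℝ)), S.StepOne Φ := by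
  have hprime := hS.isPrime
  obtain ⟨d, idx, h⟩ := exists_isTranscendenceBasis_coord
    (B := nashRing S.X ⧸ vanishingIdeal S.X S.reachable)
    (evalQuot (X := S.X) (R := S.reachable) reachable_subset)
    (evalQuot_injective (X := S.X) (R := S.reachable) reachable_subset) reachable_subset ⟨_, hS.x₀_mem_reachable⟩ hS.polyPrime
    (fun a b => by
      obtain ⟨a, rfl⟩ := Ideal.Quotient.mk_surjective a
      obtain ⟨b, rfl⟩ := Ideal.Quotient.mk_surjective b
      rw [← map_mul, Ideal.Quotient.eq_zero_iff_mem, Ideal.Quotient.eq_zero_iff_mem,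
        Ideal.Quotient.eq_zero_iff_mem]
      exact hprime.mem_or_mem)
    (fun b => by
      obtain ⟨g, hg, rfl⟩ := exists_mk_toRing hS.isSemialgebraic b
      exact ⟨g, hg, fun _ => rfl⟩)
    (fun i => Ideal.Quotient.mk (vanishingIdeal S.X S.reachable)
      (isNash_coord hS.isSemialgebraic i).toRing) (fun i x => rfl)
  exact ⟨d, fun x k => x (idx k), fun k => isNash_coord hS.isSemialgebraic (idx k), h⟩

/-- Algebraic independence in its geometric form: `Φ` maps the reachable set onto a Zariski dense
subset of `ℝᵈ`. -/
theorem StepOne.eq_zero (h : S.StepOne Φ) {c : MvPolynomial (Fin d) ℝ}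
    (hc : ∀ x ∈ S.reachable, MvPolynomial.eval (Φ x) c = 0) : c = 0 := by
  obtain ⟨hΦ, hbasis⟩ := h
  exact algebraicIndependent_iff.1 hbasis.1 c ((aeval_quot_eq_zero_iff reachable_subset hΦ c).2 hc)

theorem StepOne.exists_isRelation (hS : S.IsNashSystem) (h : S.StepOne Φ) (i : Fin n) :
    ∃ Q, S.IsRelation Φ i Q := by
  obtain ⟨hΦ, hbasis⟩ := h
  have := hS.isPrime
  have hi := isNash_coord hS.isSemialgebraic i
  obtain ⟨P, hP, hP0⟩ := exists_relation_of_isTranscendenceBasis hbasis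
    (Ideal.Quotient.mk (vanishingIdeal S.X S.reachable) hi.toRing)
  refine ⟨MvPolynomial.rename (finSuccEquiv d).symm P, fun h => hP0 ?_, fun x hx => ?_⟩
  · exact (map_eq_zero_iff _ (MvPolynomial.rename_injective _ (finSuccEquiv d).symm.injective)).1 h
  · have ht : ∀ o : Option (Fin d), IsNash S.X fun x => o.elim (x i) (Φ x) := by
      rintro (_ | k)
      · exact hi
      · exact hΦ k
    have h1 : (fun o : Option (Fin d) => o.elim
          (Ideal.Quotient.mk (vanishingIdeal S.X S.reachable) hi.toRing)
          fun i => Ideal.Quotient.mk (vanishingIdeal S.X S.reachable) (hΦ i).toRing) =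
        fun o => Ideal.Quotient.mk (vanishingIdeal S.X S.reachable) (ht o).toRing := by
      ext (_ | k) <;> rfl
    rw [h1, aeval_quot_eq_zero_iff reachable_subset ht] at hP
    rw [MvPolynomial.eval_rename, ← hP x hx]
    congr 2
    ext (_ | k) <;> simp

theorem StepOne.exists_stepTwoPoly (hS : S.IsNashSystem) (h : S.StepOne Φ)
    (deg : MvPolynomial (Fin (d + 1)) ℝ → ℕ) : ∃ Q, S.StepTwoPoly Φ deg Q := by
  have : ∀ i, ∃ Q, S.IsRelation Φ i Q ∧ ∀ Q', S.IsRelation Φ i Q' → deg Q ≤ deg Q' := fun i => by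
    obtain ⟨Q, hQ, hmin⟩ := (measure deg).wf.has_min {Q | S.IsRelation Φ i Q}
      (h.exists_isRelation hS i)
    exact ⟨Q, hQ, fun Q' hQ' => not_lt.1 (hmin Q' hQ')⟩
  choose Q hQ using this
  exact ⟨Q, hQ⟩

end ControlSystem

/-! ### Derivatives of minimal relations, and the choice of the input -/

theorem degreeOf_pderiv_lt {k : ℕ} {Q : MvPolynomial (Fin k) ℝ} {i : Fin k}
    (hQ : MvPolynomial.pderiv i Q ≠ 0) :
    MvPolynomial.degreeOf i (MvPolynomial.pderiv i Q) < MvPolynomial.degreeOf i Q := by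
  have hmem : ∀ s ∈ (MvPolynomial.pderiv i Q).support, s + Finsupp.single i 1 ∈ Q.support := by
    intro s hs
    rw [MvPolynomial.mem_support_iff, MvPolynomial.coeff_pderiv] at hs
    exact MvPolynomial.mem_support_iff.2 (left_ne_zero_of_mul hs)
  have hle : ∀ s ∈ (MvPolynomial.pderiv i Q).support, s i < MvPolynomial.degreeOf i Q := by
    intro s hs
    have := MvPolynomial.monomial_le_degreeOf i (hmem s hs)
    rw [Finsupp.add_apply, Finsupp.single_eq_same] at this
    exact this
  obtain ⟨s, hs⟩ := MvPolynomial.support_nonempty.2 hQ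
  exact (MvPolynomial.degreeOf_lt_iff ((Nat.zero_le _).trans_lt (hle s hs))).2 hle

theorem totalDegree_pderiv_lt {k : ℕ} {Q : MvPolynomial (Fin k) ℝ} {i : Fin k}
    (hQ : MvPolynomial.pderiv i Q ≠ 0) :
    (MvPolynomial.pderiv i Q).totalDegree < Q.totalDegree := by
  have hle : ∀ s ∈ (MvPolynomial.pderiv i Q).support,
      (s.sum fun _ e => e) < Q.totalDegree := by
    intro s hs
    rw [MvPolynomial.mem_support_iff, MvPolynomial.coeff_pderiv] at hs
    have := MvPolynomial.le_totalDegree (MvPolynomial.mem_support_iff.2 (left_ne_zero_of_mul hs))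
    rw [Finsupp.sum_add_index' (by simp) (by simp), Finsupp.sum_single_index rfl] at this
    exact this
  obtain ⟨s, hs⟩ := MvPolynomial.support_nonempty.2 hQ
  rw [MvPolynomial.totalDegree, Finset.sup_lt_iff ((Nat.zero_le _).trans_lt (hle s hs))]
  exact hle

namespace ControlSystem

variable {S : ControlSystem U n r} {Φ : (Fin n → ℝ) → (Fin d → ℝ)}
  {Q : Fin n → MvPolynomial (Fin (d + 1)) ℝ}

/-- In characteristic zero `∂Q/∂T = 0` means that `T` does not occur in `Q`, which would make `Q` a
relation among the components of `Φ` alone. -/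
theorem StepOne.pderiv_ne_zero (h : S.StepOne Φ) {i : Fin n} {Q : MvPolynomial (Fin (d + 1)) ℝ}
    (hQ : S.IsRelation Φ i Q) : MvPolynomial.pderiv 0 Q ≠ 0 := by
  intro h0
  have hdeg : (MvPolynomial.finSuccEquiv ℝ d Q).natDegree = 0 := by
    rw [MvPolynomial.natDegree_finSuccEquiv, ← Nat.le_zero, MvPolynomial.degreeOf_le_iff]
    intro s hs
    by_contra! hpos
    have h1 : MvPolynomial.coeff (s - Finsupp.single 0 1) (MvPolynomial.pderiv 0 Q) = 0 := by
      rw [h0, MvPolynomial.coeff_zero]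
    have h2 : s - Finsupp.single 0 1 + Finsupp.single 0 1 = s :=
      tsub_add_cancel_of_le (by simpa using Nat.succ_le_of_lt hpos)
    rw [MvPolynomial.coeff_pderiv, h2] at h1
    refine mul_ne_zero (MvPolynomial.mem_support_iff.1 hs) ?_ h1
    positivity
  obtain ⟨c, hc⟩ := Polynomial.natDegree_eq_zero.1 hdeg
  have hc0 : c = 0 := h.eq_zero fun x hx => by
    have := hQ.2 x hx
    rwa [MvPolynomial.eval_eq_eval_mv_eval', ← hc, Polynomial.map_C, Polynomial.eval_C] at this
  rw [hc0, Polynomial.C_0, eq_comm, map_eq_zero_iff _ (MvPolynomial.finSuccEquiv ℝ d).injective] at hc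
  exact hQ.1 hc

theorem isNash_eval_cons (hX : IsSemialgebraic S.X) (hΦ : IsNashMap S.X Φ) (i : Fin n)
    (P : MvPolynomial (Fin (d + 1)) ℝ) :
    IsNash S.X fun x => MvPolynomial.eval (Fin.cons (x i) (Φ x) : Fin (d + 1) → ℝ) P := by
  refine (isNash_eval (X := univ) (isSemialgebraic_iff.2 ⟨∅, by simp⟩) P).comp
    (G := fun x => (Fin.cons (x i) (Φ x) : Fin (d + 1) → ℝ)) ?_ hX (mapsTo_univ _ _)
  intro k
  refine Fin.cases ?_ (fun k => ?_) k
  · exact isNash_coord hX i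
  · exact hΦ k

/-- The derivative is non-zero of smaller degree, so minimality forbids it to be a relation.
Primality gives a reachable state where all `n` derivatives are non-zero together, and the density
principle, applied to the prolongable set of inputs in `A` shorter than `ε`, yields such a state
after a short input. -/
theorem StepTwoPoly.exists_stepTwoInput {A : Set (Input U)} (hS : S.IsNashSystem)
    (hA : IsAdmissible A) (h : S.StepOne Φ) {deg : MvPolynomial (Fin (d + 1)) ℝ → ℕ}
    (hdeg : deg = MvPolynomial.totalDegree ∨ deg = MvPolynomial.degreeOf 0)
    (hQ : S.StepTwoPoly Φ deg Q) {ε : ℝ} (hε : 0 < ε) : ∃ u, S.StepTwoInput A Φ Q ε u := by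
  obtain ⟨hΦ, -⟩ := id h
  have hnash := fun i => isNash_eval_cons hS.isSemialgebraic hΦ i (MvPolynomial.pderiv 0 (Q i))
  have hne : ∀ i, ∃ x ∈ S.reachable, MvPolynomial.eval
      (Fin.cons (x i) (Φ x) : Fin (d + 1) → ℝ) (MvPolynomial.pderiv 0 (Q i)) ≠ 0 := by
    intro i
    by_contra! H
    have h0 := h.pderiv_ne_zero (hQ i).1
    have hle := (hQ i).2 _ ⟨h0, H⟩
    refine hle.not_gt ?_
    rcases hdeg with rfl | rfl
    · exact totalDegree_pderiv_lt h0
    · exact degreeOf_pderiv_lt h0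
  have hprod : (AnalyticOnNhd ℝ (fun x => ∏ i, MvPolynomial.eval
        (Fin.cons (x i) (Φ x) : Fin (d + 1) → ℝ) (MvPolynomial.pderiv 0 (Q i))) S.X) ∧
      ∃ x ∈ S.reachable, ∏ i, MvPolynomial.eval
        (Fin.cons (x i) (Φ x) : Fin (d + 1) → ℝ) (MvPolynomial.pderiv 0 (Q i)) ≠ 0 := by
    have := Finset.prod_induction (s := Finset.univ) (fun i x => MvPolynomial.eval
        (Fin.cons (x i) (Φ x) : Fin (d + 1) → ℝ) (MvPolynomial.pderiv 0 (Q i)))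
      (fun g => AnalyticOnNhd ℝ g S.X ∧ ∃ x ∈ S.reachable, g x ≠ 0) ?_ ?_ ?_
    · simpa only [Finset.prod_apply, ← Finset.prod_fn] using this
    · rintro g₁ g₂ ⟨h1, h2⟩ ⟨h3, h4⟩
      refine ⟨h1.mul h3, ?_⟩
      by_contra! H
      rcases hS.prime h1 h3 H with H' | H'
      · obtain ⟨x, hx, hgx⟩ := h2
        exact hgx (H' x hx)
      · obtain ⟨x, hx, hgx⟩ := h4
        exact hgx (H' x hx)
    · exact ⟨analyticOnNhd_const, S.x₀, hS.x₀_mem_reachable, one_ne_zero⟩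
    · exact fun i _ => ⟨(hnash i).1, hne i⟩
  obtain ⟨han, x₀, hx₀, hgx₀⟩ := hprod
  by_contra! H
  have hAS := hA.inter hS.isAdmissible_inputs
  refine hgx₀ (hS.eq_zero_on_reachable han hS.isAdmissible_inputs.empty_mem
    (E := {v | v ∈ A ∩ S.inputs ∧ duration v < ε}) ⟨⟨hAS.empty_mem, by simpa [duration_nil] using hε⟩, ?_⟩
    (fun v hv => hv.1.2) (fun v hv => ?_) x₀ hx₀)
  · rintro v ⟨hv, hvε⟩ α
    obtain ⟨t, ht, hvt⟩ := hAS.isProlongable.exists_prolong v hv α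
    have hpos : 0 < ((ε - duration v) / 2).toNNReal := Real.toNNReal_pos.2 (by linarith)
    refine ⟨min t ((ε - duration v) / 2).toNNReal, lt_min ht hpos, fun s hs =>
      ⟨hvt s (hs.trans (min_le_left _ _)), ?_⟩⟩
    have h1 : (s : ℝ) ≤ (ε - duration v) / 2 := by
      have := NNReal.coe_le_coe.2 (hs.trans (min_le_right _ _))
      rwa [Real.coe_toNNReal _ (by linarith)] at this
    rw [duration_append, duration_singleton]
    linarith
  · by_contra hne
    exact H v ⟨hv.1, hv.2, fun i => Finset.prod_ne_zero_iff.1 hne i (Finset.mem_univ i)⟩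

end ControlSystem

/-! ### Nash functions vanishing along reachable states -/

theorem eq_zero_of_mul_eq_zero {V : Set (Fin d → ℝ)} (hV : IsOpen V) (hVc : IsPreconnected V)
    {f g : (Fin d → ℝ) → ℝ} (hf : AnalyticOnNhd ℝ f V) (hg : AnalyticOnNhd ℝ g V)
    (hfg : ∀ z ∈ V, f z * g z = 0) : (∀ z ∈ V, f z = 0) ∨ ∀ z ∈ V, g z = 0 := by
  by_contra! H
  obtain ⟨⟨z, hz, hfz⟩, z', hz', hgz'⟩ := H
  refine hgz' (hg.eqOn_zero_of_preconnected_of_eventuallyEq_zero hVc hz ?_ hz')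
  filter_upwards [(hf z hz).continuousAt.eventually_ne hfz, hV.mem_nhds hz] with w hw hwV
  exact (mul_eq_zero.1 (hfg w hwV)).resolve_left hw

theorem analyticOnNhd_eval_map {V : Set (Fin d → ℝ)} {g : (Fin d → ℝ) → ℝ}
    (hg : AnalyticOnNhd ℝ g V) (p : Polynomial (MvPolynomial (Fin d) ℝ)) :
    AnalyticOnNhd ℝ (fun z => (p.map (MvPolynomial.eval z)).eval (g z)) V := by
  simp only [Polynomial.eval_map, Polynomial.eval₂_eq_sum_range]
  exact Finset.analyticOnNhd_fun_sum _ fun i _ =>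
    ((AnalyticOnNhd.eval_mvPolynomial _).mono (subset_univ _)).mul (hg.pow i)

/-- The zero set of a non-zero Nash function on a connected set is contained in the zero set of a
non-zero polynomial. -/
theorem IsNash.exists_polynomial_zeros {V : Set (Fin d → ℝ)} (hV : IsOpen V)
    (hVc : IsConnected V) {g : (Fin d → ℝ) → ℝ} (hg : IsNash V g) (h0 : ∃ z ∈ V, g z ≠ 0) :
    ∃ q : MvPolynomial (Fin d) ℝ, q ≠ 0 ∧ ∀ z ∈ V, g z = 0 → MvPolynomial.eval z q = 0 := by
  have hprime := fun f₁ f₂ => eq_zero_of_mul_eq_zero hV hVc.isPreconnected (f := f₁) (g := f₂)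
  have hPoly : ∀ P : MvPolynomial (Fin d) ℝ, AnalyticOnNhd ℝ (fun z => MvPolynomial.eval z P) V :=
    fun P => (AnalyticOnNhd.eval_mvPolynomial P).mono (subset_univ _)
  obtain ⟨p, hp, z₁, -, hz₁⟩ := exists_polynomial_of_isSemialgebraic hg.2 subset_rfl hVc.nonempty
    fun P Q h => hprime _ _ (hPoly P) (hPoly Q) h
  have hp0 : p ≠ 0 := by
    rintro rfl
    simp at hz₁
  -- Splitting off the power of the main variable makes the constant coefficient non-zero. The split
  -- factor becomes a power of `g` and cancels by the identity theorem; at a zero of `g` the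
  -- remaining equation says that the constant coefficient vanishes.
  obtain ⟨p', hpp', hp'⟩ := Polynomial.exists_eq_pow_rootMultiplicity_mul_and_not_dvd p hp0 0
  rw [Polynomial.dvd_iff_isRoot, Polynomial.IsRoot.def, ← Polynomial.coeff_zero_eq_eval_zero] at hp'
  refine ⟨p'.coeff 0, hp', fun z hz hgz => ?_⟩
  have := (hprime _ _ (hg.1.pow (p.rootMultiplicity 0)) (analyticOnNhd_eval_map hg.1 p')
    (fun z hz => by
      have h1 := hp z hz
      rw [hpp', Polynomial.map_mul, Polynomial.eval_mul] at h1
      simpa using h1)).resolve_left (fun H => by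
      obtain ⟨z, hz, hgz⟩ := h0
      exact pow_ne_zero _ hgz (H z hz)) z hz
  rwa [hgz, ← Polynomial.coeff_zero_eq_eval_zero, Polynomial.coeff_map] at this

namespace ControlSystem

variable {S : ControlSystem U n r} {Φ : (Fin n → ℝ) → (Fin d → ℝ)}

theorem StepOne.isNashMap (h : S.StepOne Φ) : IsNashMap S.X Φ := h.choose

/-- Since `g` lives on `V` only, `g ∘ Φ` need not be analytic on `X`. A polynomial vanishing
wherever `g` does is defined globally, and the density principle applies to its composite with `Φ`.
-/
theorem StepOne.eq_zero_of_comp (hS : S.IsNashSystem) (h : S.StepOne Φ) {u : Input U}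
    (hu : u ∈ S.inputs) {V : Set (Fin d → ℝ)} (hV : IsOpen V) (hVc : IsConnected V)
    {g : (Fin d → ℝ) → ℝ} (hg : IsNash V g) {E : Set (Input U)} (hE : IsProlongable E)
    (hEu : ∀ v ∈ E, u ++ v ∈ S.inputs) (hEV : ∀ v ∈ E, Φ (S.endState (u ++ v)) ∈ V)
    (h0 : ∀ v ∈ E, g (Φ (S.endState (u ++ v))) = 0) : ∀ z ∈ V, g z = 0 := by
  by_contra! H
  obtain ⟨q, hq, hqV⟩ := hg.exists_polynomial_zeros hV hVc H
  refine hq (h.eq_zero (hS.eq_zero_on_reachable ?_ hu hE hEu fun v hv =>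
    hqV _ (hEV v hv) (h0 v hv)))
  exact (AnalyticOnNhd.eval_mvPolynomial q).comp h.isNashMap.analyticOnNhd (mapsTo_univ _ _)

end ControlSystem

/-! ### Solving the implicit equations -/

theorem hasDerivAt_eval_cons (Q : MvPolynomial (Fin (d + 1)) ℝ) (z : Fin d → ℝ) (y : ℝ) :
    HasDerivAt (fun y => MvPolynomial.eval (Fin.cons y z : Fin (d + 1) → ℝ) Q)
      (MvPolynomial.eval (Fin.cons y z : Fin (d + 1) → ℝ) (MvPolynomial.pderiv 0 Q)) y := by
  induction Q using MvPolynomial.induction_on with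
  | C a => simpa using hasDerivAt_const y a
  | add p q hp hq =>
    simp only [map_add]
    exact hp.add hq
  | mul_X p i hp =>
    have hX : HasDerivAt (fun y => (Fin.cons y z : Fin (d + 1) → ℝ) i)
        (MvPolynomial.eval (Fin.cons y z : Fin (d + 1) → ℝ)
          (MvPolynomial.pderiv 0 (MvPolynomial.X i))) y := by
      refine Fin.cases ?_ (fun k => ?_) i
      · simpa using hasDerivAt_id' y
      · simpa [MvPolynomial.pderiv_X_of_ne (Fin.succ_ne_zero k)] using hasDerivAt_const y (z k)
    simp only [MvPolynomial.pderiv_mul, map_add, map_mul, MvPolynomial.eval_X]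
    exact hp.mul hX

/-- One unknown suffices: the `i`-th equation involves only the `i`-th coordinate, so the system
decouples and its Jacobian is diagonal. -/
theorem exists_implicit {Q : MvPolynomial (Fin (d + 1)) ℝ} {z₀ : Fin d → ℝ} {y₀ : ℝ}
    (h0 : MvPolynomial.eval (Fin.cons y₀ z₀ : Fin (d + 1) → ℝ) Q = 0)
    (h1 : MvPolynomial.eval (Fin.cons y₀ z₀ : Fin (d + 1) → ℝ) (MvPolynomial.pderiv 0 Q) ≠ 0) :
    ∃ ψ : (Fin d → ℝ) → ℝ, AnalyticAt ℝ ψ z₀ ∧ ψ z₀ = y₀ ∧ ∀ᶠ v in nhds (z₀, y₀),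
      (MvPolynomial.eval (Fin.cons v.2 v.1 : Fin (d + 1) → ℝ) Q = 0 ↔ ψ v.1 = v.2) := by
  set F : (Fin d → ℝ) × ℝ → ℝ :=
    fun v => MvPolynomial.eval (Fin.cons v.2 v.1 : Fin (d + 1) → ℝ) Q with hF
  have hFan : AnalyticAt ℝ F (z₀, y₀) := by
    have hcons : AnalyticAt ℝ (fun v : (Fin d → ℝ) × ℝ => (Fin.cons v.2 v.1 : Fin (d + 1) → ℝ))
        (z₀, y₀) := by
      rw [analyticAt_pi_iff]
      intro k
      refine Fin.cases ?_ (fun k => ?_) k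
      · exact analyticAt_snd
      · exact ((ContinuousLinearMap.proj k : (Fin d → ℝ) →L[ℝ] ℝ).analyticAt _).comp analyticAt_fst
    exact AnalyticAt.comp (g := fun x => MvPolynomial.eval x Q)
      (AnalyticOnNhd.eval_mvPolynomial Q _ (mem_univ _)) hcons
  have hder : (fderiv ℝ F (z₀, y₀) ∘L .inr ℝ (Fin d → ℝ) ℝ) =
      ContinuousLinearMap.toSpanSingleton ℝ
        (MvPolynomial.eval (Fin.cons y₀ z₀ : Fin (d + 1) → ℝ) (MvPolynomial.pderiv 0 Q)) := by
    have h2 : HasFDerivAt (fun y : ℝ => (z₀, y)) (ContinuousLinearMap.inr ℝ (Fin d → ℝ) ℝ) y₀ :=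
      hasFDerivAt_prodMk_right z₀ y₀
    have h3 := HasFDerivAt.comp (g := F) (x := y₀) hFan.differentiableAt.hasFDerivAt h2
    exact h3.unique (hasDerivAt_eval_cons Q z₀ y₀).hasFDerivAt
  have hinv : (fderiv ℝ F (z₀, y₀) ∘L .inr ℝ (Fin d → ℝ) ℝ).IsInvertible := by
    rw [hder]
    refine ⟨ContinuousLinearEquiv.unitsEquivAut ℝ (Units.mk0 _ h1), ?_⟩
    ext
    simp
  have hcd : ContDiffAt ℝ ⊤ F (z₀, y₀) := hFan.contDiffAt
  refine ⟨hcd.implicitFunction (by simp) hinv,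
    (hcd.contDiffAt_implicitFunction (by simp) hinv).analyticAt,
    hcd.implicitFunction_apply_self (by simp) hinv, ?_⟩
  have := hcd.eventually_apply_eq_iff_implicitFunction (by simp) hinv
  rwa [show F (z₀, y₀) = 0 from h0] at this

theorem definedBySigns_ball (c : Fin n → ℝ) {δ : ℝ} (hδ : 0 < δ) :
    DefinedBySigns (Metric.ball c δ) := by
  have : Metric.ball c δ = {x | ∀ i, c i - δ < x i ∧ x i < c i + δ} := by
    ext x
    simp only [Metric.mem_ball, dist_pi_lt_iff hδ, Real.dist_eq, abs_lt, mem_ofPred_eq]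
    exact forall_congr' fun i => ⟨fun h => ⟨by linarith [h.1], by linarith [h.2]⟩,
      fun h => ⟨by linarith [h.1], by linarith [h.2]⟩⟩
  rw [this]
  exact .forall_fintype fun i => (DefinedBySigns.lt (.const _) (.coord i)).and
    (.lt (.coord i) (.const _))

namespace ControlSystem

variable {S : ControlSystem U n r} {Φ : (Fin n → ℝ) → (Fin d → ℝ)}
  {Q : Fin n → MvPolynomial (Fin (d + 1)) ℝ} {A : Set (Input U)} {ε : ℝ} {u : Input U}

/-- In a small box around `x_u` the equations determine `x` from `Φ x`, and every reachable state
satisfies them; hence `G` recovers reachable states from their images. -/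
theorem StepTwoInput.exists_stepThree (hS : S.IsNashSystem) (h : S.StepOne Φ)
    (hQ : ∀ i, S.IsRelation Φ i (Q i)) (hu : S.StepTwoInput A Φ Q ε u) :
    ∃ V W G, S.StepThree Φ u V W G ∧ IsImplicitSolution Q V W G := by
  have huS := hu.mem.2
  set x₀ := S.endState u with hx₀
  set z₀ := Φ x₀ with hz₀
  have hx₀R : x₀ ∈ S.reachable := ⟨u, huS, rfl⟩
  choose ψ hψan hψ0 hψ using fun i => exists_implicit ((hQ i).2 x₀ hx₀R) (hu.pderiv_ne i)
  obtain ⟨ρ, hρ, hρX, hρψ⟩ : ∃ ρ > 0, Metric.ball x₀ ρ ⊆ S.X ∧ ∀ i, ∀ z ∈ Metric.ball z₀ ρ,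
      ∀ y ∈ Metric.ball (x₀ i) ρ,
        (MvPolynomial.eval (Fin.cons y z : Fin (d + 1) → ℝ) (Q i) = 0 ↔ ψ i z = y) := by
    choose e he hball using fun i => Metric.eventually_nhds_iff_ball.1 (hψ i)
    obtain ⟨e', he', hball'⟩ := Metric.isOpen_iff.1 hS.isOpen x₀ (reachable_subset hx₀R)
    have h1 : ∀ᶠ ρ in nhdsWithin (0 : ℝ) (Ioi 0), (∀ i, ρ < e i) ∧ ρ < e' ∧ ρ ∈ Ioi (0 : ℝ) :=
      (Filter.eventually_all.2 fun i => (eventually_lt_nhds (he i)).filter_mono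
        nhdsWithin_le_nhds).and (((eventually_lt_nhds he').filter_mono nhdsWithin_le_nhds).and
        self_mem_nhdsWithin)
    obtain ⟨ρ, hρe, hρe', hρ⟩ := h1.exists
    refine ⟨ρ, hρ, (Metric.ball_subset_ball hρe'.le).trans hball', fun i z hz y hy =>
      hball i (z, y) ?_⟩
    rw [← ball_prod_same]
    exact ⟨Metric.ball_subset_ball (hρe i).le hz, Metric.ball_subset_ball (hρe i).le hy⟩
  -- The radius of `V` is chosen after `ρ`, so that `G` is analytic on `V` and takes values in the
  -- box where solutions are unique.
  obtain ⟨δ, hδ, hδψ⟩ : ∃ δ > 0, ∀ z ∈ Metric.ball z₀ δ, z ∈ Metric.ball z₀ ρ ∧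
      ∀ i, AnalyticAt ℝ (ψ i) z ∧ ψ i z ∈ Metric.ball (x₀ i) ρ := by
    have h1 : ∀ᶠ z in nhds z₀, z ∈ Metric.ball z₀ ρ := Metric.ball_mem_nhds z₀ hρ
    have h2 : ∀ i, ∀ᶠ z in nhds z₀, ψ i z ∈ Metric.ball (x₀ i) ρ := fun i => by
      have := (hψan i).continuousAt.eventually (Metric.ball_mem_nhds _ hρ)
      rwa [hψ0 i] at this
    exact Metric.eventually_nhds_iff_ball.1 (h1.and
      (Filter.eventually_all.2 fun i => (hψan i).eventually_analyticAt.and (h2 i)))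
  set V := Metric.ball z₀ δ with hV
  set G : (Fin d → ℝ) → (Fin n → ℝ) := fun z i => ψ i z with hG
  have hVS : IsSemialgebraic V := isSemialgebraic_iff.2 (definedBySigns_ball z₀ hδ)
  have hGN : MapsTo G V (Metric.ball x₀ ρ) := fun z hz =>
    (dist_pi_lt_iff hρ).2 fun i => ((hδψ z hz).2 i).2
  have hsol : ∀ z ∈ V, ∀ q ∈ Metric.ball x₀ ρ,
      (∀ i, MvPolynomial.eval (Fin.cons (q i) z : Fin (d + 1) → ℝ) (Q i) = 0) ↔ q = G z := by
    intro z hz q hq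
    rw [funext_iff]
    refine forall_congr' fun i => ?_
    rw [hρψ i z (hδψ z hz).1 (q i) ((dist_pi_lt_iff hρ).1 hq i), eq_comm]
  have hGnash : IsNashMap V G := by
    refine fun i => ⟨fun z hz => ((hδψ z hz).2 i).1, isSemialgebraic_graphOver ?_⟩
    -- Over `V` the graph of `ψ i` is cut out by `Q i = 0` and the bounds on the last variable,
    -- since the equation has just one root within the box.
    have h1 : DefinedBySigns {w : Fin (d + 1) → ℝ | (fun j => w (Fin.castSucc j)) ∈ V ∧
        (x₀ i - ρ < w (Fin.last d) ∧ w (Fin.last d) < x₀ i + ρ) ∧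
          MvPolynomial.eval (Fin.cons (w (Fin.last d)) fun j => w (Fin.castSucc j) :
            Fin (d + 1) → ℝ) (Q i) = 0} := by
      refine (DefinedBySigns.mem hVS fun j => .coord _).and (((DefinedBySigns.lt (.const _)
        (.coord _)).and (.lt (.coord _) (.const _))).and (.eq (PolyFun.eval_comp
          (F := fun j w => (Fin.cons (w (Fin.last d)) fun j => w (Fin.castSucc j) :
            Fin (d + 1) → ℝ) j) (fun j => ?_) _) (.const 0)))
      refine Fin.cases ?_ (fun k => ?_) j
      · exact .coord _
      · exact .coord _
    convert h1 using 3 with w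
    refine and_congr_right fun hw => ?_
    have hmem : ∀ y, (x₀ i - ρ < y ∧ y < x₀ i + ρ) ↔ y ∈ Metric.ball (x₀ i) ρ := fun y => by
      rw [Real.ball_eq_Ioo, mem_Ioo]
    rw [hmem]
    constructor
    · intro hy
      have : w (Fin.last d) ∈ Metric.ball (x₀ i) ρ := hy ▸ ((hδψ _ hw).2 i).2
      exact ⟨this, (hρψ i _ (hδψ _ hw).1 _ this).2 hy.symm⟩
    · exact fun hy => ((hρψ i _ (hδψ _ hw).1 _ hy.1).1 hy.2).symm
  have hΦ := h.isNashMap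
  set W := Metric.ball x₀ ρ ∩ Φ ⁻¹' V with hW
  have hWo : IsOpen W := (hΦ.analyticOnNhd.continuousOn.mono hρX).isOpen_inter_preimage
    Metric.isOpen_ball Metric.isOpen_ball
  have hx₀W : x₀ ∈ W := ⟨Metric.mem_ball_self hρ, Metric.mem_ball_self hδ⟩
  have hWG : ∀ x ∈ S.reachable, x ∈ W → G (Φ x) = x := fun x hx hxW =>
    ((hsol (Φ x) hxW.2 x hxW.1).1 fun i => (hQ i).2 x hx).symm
  -- Needed for `G` to take values in `W`. The Nash function `Φ ∘ G - id` vanishes at `Φ x` for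
  -- reachable `x ∈ W`, as `G (Φ x) = x`, and those points are dense enough.
  have hΦG : ∀ z ∈ V, Φ (G z) = z := by
    intro z hz
    ext k
    have hnash : IsNash V fun z => Φ (G z) k + (-1) * z k :=
      ((hΦ k).comp hGnash hVS fun z hz => hρX (hGN hz)).add
        ((show IsNash V fun _ => -1 by simpa using isNash_eval hVS (MvPolynomial.C (-1))).mul (isNash_coord hVS k))
    have := h.eq_zero_of_comp hS huS Metric.isOpen_ball
      ⟨⟨z₀, Metric.mem_ball_self hδ⟩, (convex_ball z₀ δ).isPreconnected⟩ hnash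
      (hS.isProlongable_endState_mem huS hWo hx₀W) (fun v hv => hv.1) (fun v hv => hv.2.2)
      (fun v hv => by
        rw [hWG _ ⟨_, hv.1, rfl⟩ hv.2]
        ring) z hz
    linarith
  refine ⟨V, W, G, ⟨Metric.isOpen_ball, hVS,
    ⟨⟨z₀, Metric.mem_ball_self hδ⟩, (convex_ball z₀ δ).isPreconnected⟩, hWo, ?_,
    fun q hq => hρX hq.1, hGnash, fun z hz => ⟨hGN hz, ?_⟩, Metric.mem_ball_self hδ, hx₀W, ?_⟩,
    fun z hz q hq => hsol z hz q hq.1⟩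
  · refine isSemialgebraic_iff.2 ?_
    have h1 := (definedBySigns_ball x₀ hρ).and (DefinedBySigns.ex_fin (k := d) (ι := Fin n)
      (p := fun q z => (∀ k, (fun j => q j) ∈ S.X ∧ z k = Φ (fun j => q j) k) ∧ (fun k => z k) ∈ V)
      ((DefinedBySigns.forall_fintype fun k => .mem_graph (hΦ k).2 (fun j => .coord _)
        (.coord _)).and (.mem hVS fun j => .coord _)))
    refine (congrArg DefinedBySigns ?_).mpr h1
    ext q
    refine and_congr_right fun hq => ⟨fun hqV => ⟨Φ q, fun k => ⟨hρX hq, rfl⟩, hqV⟩, ?_⟩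
    rintro ⟨z, hz, hzV⟩
    have : z = Φ q := funext fun k => (hz k).2
    rw [mem_preimage, ← this]
    exact hzV
  · rw [mem_preimage, hΦG z hz]
    exact hz
  · intro v hv hstay
    have hmem : S.endState (u ++ v) ∈ W := by
      have := hstay (duration v) (right_mem_Icc.2 (duration_nonneg v))
      rwa [← duration_append] at this
    exact ⟨hmem.2, hWG _ ⟨_, hv, rfl⟩ hmem⟩

end ControlSystem

/-! ### Functions of the switching times -/

/-- The switching times `t ∈ [0,∞)ᵏ` for which `(α₁,t₁)⋯(α_k,t_k)` is in `B`. -/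
def timeDomain {k : ℕ} (B : Set (Input U)) (α : Fin k → U) : Set (Fin k → ℝ) :=
  {t | (∀ i, 0 ≤ t i) ∧ word α t ∈ B}

theorem word_succ {k : ℕ} (α : Fin (k + 1) → U) (t : Fin (k + 1) → ℝ) :
    word α t = word (fun i => α (Fin.castSucc i)) (fun i => t (Fin.castSucc i)) ++
      [(α (Fin.last k), (t (Fin.last k)).toNNReal)] := by
  rw [word, List.ofFn_succ_last]
  rfl

theorem word_snoc {k : ℕ} (α : Fin (k + 1) → U) (t : Fin k → ℝ) (s : ℝ) :
    word α (Fin.snoc t s : Fin (k + 1) → ℝ) =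
      word (fun i => α (Fin.castSucc i)) t ++ [(α (Fin.last k), s.toNNReal)] := by
  rw [word_succ]
  simp

theorem word_getElem (v : Input U) :
    word (fun i : Fin v.length => (v[i]).1) (fun i => ((v[i]).2 : ℝ)) = v := by
  simp [word]

/-- Perturbation of the times places a full-dimensional box containing `t` inside the domain.
Derivatives within the domain are thus well defined also on the faces where some time is zero. -/
theorem IsAdmissible.uniqueDiffOn_timeDomain {B : Set (Input U)} (hB : IsAdmissible B) {k : ℕ}
    (α : Fin k → U) : UniqueDiffOn ℝ (timeDomain B α) := by
  intro t ht
  obtain ⟨δ, hδ, h⟩ := hB.perturb_mem _ ht.2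
  have hδ' : (0 : ℝ) < δ := by exact_mod_cast hδ
  have hsub : univ.pi (fun i => Icc 0 (t i + δ)) ⊆ timeDomain B α := by
    refine fun s hs => ⟨fun i => (hs i (mem_univ i)).1, h _ ?_⟩
    rw [List.forall₂_iff_get]
    refine ⟨by simp [word], fun i h₁ h₂ => ?_⟩
    have hi : i < k := by simpa [word] using h₁
    simp only [word, List.get_eq_getElem, List.getElem_ofFn, true_and]
    have := Real.toNNReal_le_toNNReal (hs ⟨i, hi⟩ (mem_univ _)).2
    rwa [Real.toNNReal_add (ht.1 _) hδ'.le, Real.toNNReal_coe] at this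
  refine UniqueDiffWithinAt.mono ?_ hsub
  exact UniqueDiffOn.univ_pi (fun i => uniqueDiffOn_Icc (by linarith [ht.1 i])) t
    fun i _ => ⟨ht.1 i, by linarith⟩

section

variable {k : ℕ} {D : Set (Fin (k + 1) → ℝ)} {Ψ : (Fin (k + 1) → ℝ) → ℝ}

/-- Iterated derivatives within `D` with respect to the last variable. -/
noncomputable def lastDeriv (D : Set (Fin (k + 1) → ℝ)) (Ψ : (Fin (k + 1) → ℝ) → ℝ) :
    ℕ → (Fin (k + 1) → ℝ) → ℝ
  | 0 => Ψ
  | j + 1 => fun t => fderivWithin ℝ (lastDeriv D Ψ j) D t (Pi.single (Fin.last k) 1)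

theorem analyticOn_lastDeriv (hD : UniqueDiffOn ℝ D) (hΨ : AnalyticOn ℝ Ψ D) (j : ℕ) :
    AnalyticOn ℝ (lastDeriv D Ψ j) D := by
  induction j with
  | zero => exact hΨ
  | succ j ih =>
    exact ((ContinuousLinearMap.apply ℝ ℝ
      (Pi.single (Fin.last k) 1 : Fin (k + 1) → ℝ)).analyticOnNhd univ).comp_analyticOn
      (ih.fderivWithin hD) (mapsTo_univ _ _)

theorem hasDerivAt_snoc (t : Fin k → ℝ) (s : ℝ) :
    HasDerivAt (fun s => (Fin.snoc t s : Fin (k + 1) → ℝ)) (Pi.single (Fin.last k) 1) s := by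
  rw [hasDerivAt_pi]
  intro i
  refine Fin.lastCases ?_ (fun i => ?_) i
  · simpa using hasDerivAt_id' s
  · simpa [(Fin.castSucc_lt_last i).ne] using hasDerivAt_const s (t i)

theorem hasDerivWithinAt_lastDeriv (hD : UniqueDiffOn ℝ D) (hΨ : AnalyticOn ℝ Ψ D) (j : ℕ)
    {t : Fin k → ℝ} {I : Set ℝ} (hI : ∀ s ∈ I, (Fin.snoc t s : Fin (k + 1) → ℝ) ∈ D) {s : ℝ}
    (hs : s ∈ I) : HasDerivWithinAt (fun s => lastDeriv D Ψ j (Fin.snoc t s))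
      (lastDeriv D Ψ (j + 1) (Fin.snoc t s)) I s :=
  ((analyticOn_lastDeriv hD hΨ j).differentiableOn _ (hI s hs)).hasFDerivWithinAt
    |>.comp_hasDerivWithinAt s (hasDerivAt_snoc t s).hasDerivWithinAt hI

theorem analyticOn_snoc_left (t : Fin k → ℝ) (I : Set ℝ) :
    AnalyticOn ℝ (fun s => (Fin.snoc t s : Fin (k + 1) → ℝ)) I := by
  refine AnalyticOnNhd.analyticOn (analyticOnNhd_pi_iff.2 fun i => ?_)
  refine Fin.lastCases ?_ (fun i => ?_) i
  · simpa using analyticOnNhd_id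
  · simpa using analyticOnNhd_const

theorem analyticOn_snoc_right (s : ℝ) (D : Set (Fin k → ℝ)) :
    AnalyticOn ℝ (fun t => (Fin.snoc t s : Fin (k + 1) → ℝ)) D := by
  refine AnalyticOnNhd.analyticOn (analyticOnNhd_pi_iff.2 fun i => ?_)
  refine Fin.lastCases ?_ (fun i => ?_) i
  · simpa using analyticOnNhd_const
  · simp only [Fin.snoc_castSucc]
    exact (ContinuousLinearMap.proj i : (Fin k → ℝ) →L[ℝ] ℝ).analyticOnNhd D

end

namespace ControlSystem

/-- An analytic function of the switching times which is an output of the system after a prolongable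
set of inputs is this output everywhere. -/
theorem IsNashSystem.eq_output {S : ControlSystem U n r} (hS : S.IsNashSystem)
    {B E : Set (Input U)} (hB : IsAdmissible B) (hBS : B ⊆ S.inputs) (hE : IsProlongable E)
    (hEB : E ⊆ B) {k : ℕ} (α : Fin k → U) {Ψ : (Fin k → ℝ) → ℝ} {H : (Fin n → ℝ) → ℝ}
    (hΨ : AnalyticOn ℝ Ψ (timeDomain B α)) (hH : AnalyticOnNhd ℝ H S.X)
    (h : ∀ t ∈ timeDomain B α, word α t ∈ E → Ψ t = H (S.endState (word α t))) :
    ∀ t ∈ timeDomain B α, Ψ t = H (S.endState (word α t)) := by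
  -- `H` must vary, because the induction hypothesis is applied to its iterated Lie derivatives.
  induction k generalizing H with
  | zero => exact fun t ht => h t ht (by simpa [word] using hE.nil_mem)
  | succ k ih =>
    intro t ht
    set a := α (Fin.last k)
    set α' : Fin k → U := fun i => α (Fin.castSucc i)
    set D := timeDomain B α with hDdef
    have hD : UniqueDiffOn ℝ D := hB.uniqueDiffOn_timeDomain α
    have hsnoc : ∀ (t : Fin k → ℝ) (s : ℝ), (Fin.snoc t s : Fin (k + 1) → ℝ) ∈ D ↔
        ((∀ i, 0 ≤ t i) ∧ 0 ≤ s) ∧ word α' t ++ [(a, s.toNNReal)] ∈ B := fun t s => by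
      rw [hDdef, timeDomain, mem_ofPred_eq, word_snoc, Fin.forall_fin_succ']
      simp only [Fin.snoc_castSucc, Fin.snoc_last]
      exact Iff.rfl
    have hzero : MapsTo (fun t : Fin k → ℝ => (Fin.snoc t 0 : Fin (k + 1) → ℝ))
        (timeDomain B α') D := by
      intro t ht
      obtain ⟨s, -, hs⟩ := hB.exists_extend ht.2 a
      exact (hsnoc t 0).2 ⟨⟨ht.1, le_rfl⟩, by simpa using hs 0 zero_le⟩
    set t' : Fin k → ℝ := fun i => t (Fin.castSucc i)
    set τ := t (Fin.last k)
    have htt : t = Fin.snoc t' τ := (Fin.snoc_init_self t).symm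
    have hτ : 0 ≤ τ := ht.1 _
    have hw : word α t = word α' t' ++ [(a, τ.toNNReal)] := word_succ α t
    have htB := ht.2
    rw [hw] at htB
    have hI : ∀ s ∈ Icc 0 τ, (Fin.snoc t' s : Fin (k + 1) → ℝ) ∈ D := fun s hs =>
      (hsnoc t' s).2 ⟨⟨fun i => ht.1 _, hs.1⟩,
        hB.restrict_mem _ [] a _ _ htB (Real.toNNReal_le_toNNReal hs.2)⟩
    obtain ⟨γ, hγ, h0, h1, -⟩ := hS.exists_curve (hBS htB)
    rw [Real.coe_toNNReal τ hτ] at hγ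
    have hend : S.endState (word α t) = γ τ := by
      rw [hw, ← h1 _ le_rfl, Real.coe_toNNReal τ hτ]
    rw [hend, htt]
    -- With the other times fixed, both sides are analytic in the last time, so it is enough to
    -- compare all derivatives at last time `0`.
    refine hγ.eq_of_tower (hS.analytic_f a) hH (left_mem_Icc.2 hτ)
      (F := fun j s => lastDeriv D Ψ j (Fin.snoc t' s))
      (fun j s hs => hasDerivWithinAt_lastDeriv hD hΨ j hI hs)
      (hΨ.comp (analyticOn_snoc_left t' _) hI) (fun j => ?_) τ (right_mem_Icc.2 hτ)
    rw [h0]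
    -- These derivatives at last time `0` are analytic functions of the remaining `k` times, to be
    -- matched with Lie derivatives of `H`.
    refine ih α' (Ψ := fun t => lastDeriv D Ψ j (Fin.snoc t 0))
      ((analyticOn_lastDeriv hD hΨ j).comp (analyticOn_snoc_right 0 _) hzero)
      (analyticOnNhd_iterate_lieDeriv hH (hS.analytic_f a) j) (fun t ht htE => ?_) t'
      ⟨fun i => ht.1 _, hB.prefix_mem htB⟩
    obtain ⟨t₀, ht₀, hE₀⟩ := hE.exists_prolong _ htE a
    have ht₀' : (0 : ℝ) < t₀ := by exact_mod_cast ht₀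
    obtain ⟨γ, hγ, h0, h1, -⟩ := hS.exists_curve (hBS (hEB (hE₀ t₀ le_rfl)))
    have hI : ∀ s ∈ Icc (0 : ℝ) t₀, (Fin.snoc t s : Fin (k + 1) → ℝ) ∈ D := fun s hs =>
      (hsnoc t s).2 ⟨⟨ht.1, hs.1⟩, hEB (hE₀ _ (Real.toNNReal_le_iff_le_coe.2 hs.2))⟩
    -- After an input of `E` the identity holds along a short arc by hypothesis and may be
    -- differentiated there repeatedly.
    have key : ∀ j, ∀ s ∈ Icc (0 : ℝ) t₀,
        lastDeriv D Ψ j (Fin.snoc t s) = ((lieDeriv (S.f a))^[j] H) (γ s) := by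
      intro j
      induction j with
      | zero =>
        intro s hs
        have hs' : s.toNNReal ≤ t₀ := Real.toNNReal_le_iff_le_coe.2 hs.2
        have hws := word_snoc α t s
        have h2 := h _ (hI s hs) (by rw [hws]; exact hE₀ _ hs')
        have h3 := h1 _ hs'
        rw [Real.coe_toNNReal s hs.1] at h3
        rw [hws, ← h3] at h2
        exact h2
      | succ j ihj =>
        intro s hs
        refine (uniqueDiffOn_Icc ht₀' s hs).eq_deriv _
          ((hasDerivWithinAt_lastDeriv hD hΨ j hI hs).congr_of_mem (fun s hs => (ihj s hs).symm) hs) ?_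
        rw [Function.iterate_succ_apply']
        exact hγ.hasDerivWithinAt_comp (hS.analytic_f a)
          (analyticOnNhd_iterate_lieDeriv hH (hS.analytic_f a) j) hs
    rw [← h0]
    exact key j 0 (left_mem_Icc.2 ht₀'.le)

end ControlSystem

/-- Shifting a response map by an input in its domain gives a response map. -/
theorem IsResponseMap.shift {A : Set (Input U)} {p : Input U → Fin r → ℝ} (hp : IsResponseMap A p)
    (u : Input U) : IsResponseMap (shiftDomain A u) (NashReach.shift p u) := by
  intro k hk α j
  set αu : Fin u.length → U := fun i => (u[i]).1
  set tu : Fin u.length → ℝ := fun i => ((u[i]).2 : ℝ)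
  have hword : ∀ t, word (Fin.append αu α) (Fin.append tu t) = u ++ word α t := by
    intro t
    have : (fun i => (Fin.append αu α i, ((Fin.append tu t i).toNNReal))) =
        Fin.append (fun i => (αu i, (tu i).toNNReal)) (fun i => (α i, (t i).toNNReal)) := by
      ext i : 1
      refine Fin.addCases (fun i => ?_) (fun i => ?_) i <;> simp
    rw [word, this, List.ofFn_fin_append]
    congr 1
    exact word_getElem u
  have hcomp := (hp (u.length + k) (by omega) (Fin.append αu α) j).comp
    (t := {t | (∀ i, 0 ≤ t i) ∧ word α t ∈ shiftDomain A u})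
    (g := fun t => Fin.append tu t) ?_ ?_
  · refine hcomp.congr fun t ht => ?_
    simp only [Function.comp_apply, hword]
    rfl
  · refine AnalyticOnNhd.analyticOn (analyticOnNhd_pi_iff.2 fun i => ?_)
    refine Fin.addCases (fun i => ?_) (fun i => ?_) i
    · simpa using analyticOnNhd_const
    · simp only [Fin.append_right]
      exact (ContinuousLinearMap.proj i : (Fin k → ℝ) →L[ℝ] ℝ).analyticOnNhd _
  · intro t ht
    refine ⟨fun i => ?_, by rw [hword]; exact ht.2.2⟩
    refine Fin.addCases (fun i => ?_) (fun i => ?_) i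
    · simp [tu]
    · simpa using ht.1 i

/-! ### The reduced system -/

theorem IsNash.congr {X : Set (Fin n → ℝ)} (hX : IsOpen X) {f g : (Fin n → ℝ) → ℝ}
    (hf : IsNash X f) (h : EqOn f g X) : IsNash X g := by
  refine ⟨hf.1.congr hX h, ?_⟩
  have : graphOver X g = graphOver X f := by
    ext z
    exact and_congr_right fun hz => by rw [h hz]
  rw [this]
  exact hf.2

/-- Writes the reduced vector field through partial derivatives of the components of `Φ`, which are
known to be Nash. -/
theorem fderiv_apply_eq_sum {Φ : (Fin n → ℝ) → (Fin d → ℝ)} {x : Fin n → ℝ}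
    (hΦ : DifferentiableAt ℝ Φ x) (w : Fin n → ℝ) (i : Fin d) :
    fderiv ℝ Φ x w i = ∑ j, partialDeriv j (fun x => Φ x i) x * w j := by
  have h1 : fderiv ℝ Φ x w i = fderiv ℝ (fun x => Φ x i) x w := by
    rw [fderiv_pi fun i => differentiableAt_pi.1 hΦ i]
    rfl
  rw [h1]
  conv_lhs => rw [pi_eq_sum_univ' w]
  rw [map_sum]
  refine Finset.sum_congr rfl fun j _ => ?_
  rw [map_smul, smul_eq_mul, mul_comm, partialDeriv]

namespace ControlSystem

variable {S : ControlSystem U n r} {Φ : (Fin n → ℝ) → (Fin d → ℝ)} {A : Set (Input U)} {u : Input U}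
  {V : Set (Fin d → ℝ)} {W : Set (Fin n → ℝ)} {G : (Fin d → ℝ) → (Fin n → ℝ)}

theorem StepThree.isNashSystem_reduced (hS : S.IsNashSystem) (hΦ : IsNashMap S.X Φ)
    (h3 : S.StepThree Φ u V W G) : (S.reduced Φ u V G).IsNashSystem where
  isOpen := h3.isOpen_V
  isConnected := h3.isConnected_V
  isSemialgebraic := h3.isSemialgebraic_V
  nash_f α i := by
    have hmaps : MapsTo G V S.X := fun z hz => h3.subset_W (h3.mapsTo_G hz)
    have hsum : IsNash V fun z => ∑ j, partialDeriv j (fun x => Φ x i) (G z) * S.f α (G z) j :=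
      IsNash.sum _ h3.isSemialgebraic_V fun j _ =>
        (((hΦ i).partialDeriv hS.isOpen j).comp h3.nash_G h3.isSemialgebraic_V hmaps).mul
          ((hS.nash_f α j).comp h3.nash_G h3.isSemialgebraic_V hmaps)
    refine hsum.congr h3.isOpen_V fun z hz => (fderiv_apply_eq_sum ?_ _ i).symm
    exact (hΦ.analyticOnNhd _ (hmaps hz)).differentiableAt
  nash_h i := (hS.nash_h i).comp h3.nash_G h3.isSemialgebraic_V
    fun z hz => h3.subset_W (h3.mapsTo_G hz)
  mem_x₀ := h3.mem_V

theorem IsNashSystem.traj_append_singleton (hS : S.IsNashSystem) {w : Input U} {α : U} {s : ℝ≥0}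
    (hw : w ++ [(α, s)] ∈ S.inputs) : (∀ τ ∈ Icc 0 (duration w),
      S.traj (w ++ [(α, s)]) τ = S.traj w τ) ∧ ∀ σ : ℝ≥0, σ ≤ s →
        S.traj (w ++ [(α, s)]) (duration w + σ) = S.endState (w ++ [(α, σ)]) := by
  constructor
  · intro τ hτ
    exact (traj_eqOn (hS.isAdmissible_inputs.prefix_mem hw) (isTrajectory_traj hw).of_append hτ).symm
  · intro σ hσ
    obtain ⟨γ, -, -, h1, h2⟩ := hS.exists_curve hw
    rw [← h2 σ ⟨σ.2, hσ⟩, h1 σ hσ]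

/-- Inputs along which the reduced system follows the given one inside `W`. -/
def following (S : ControlSystem U n r) (Φ : (Fin n → ℝ) → (Fin d → ℝ)) (u : Input U)
    (V : Set (Fin d → ℝ)) (W : Set (Fin n → ℝ)) (G : (Fin d → ℝ) → (Fin n → ℝ)) :
    Set (Input U) :=
  {v | (u ++ v ∈ S.inputs ∧ v ∈ (S.reduced Φ u V G).inputs) ∧
    (∀ t ∈ Icc 0 (duration v), S.traj (u ++ v) (duration u + t) ∈ W) ∧
      (S.reduced Φ u V G).endState v = Φ (S.endState (u ++ v))}

/-- While the state stays in `W`, `G ∘ Φ` fixes it, and the chain rule turns its image under `Φ`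
into a solution of the reduced equation. Openness of `W` leaves room for a short arc with any input
value, and uniqueness identifies the image with the reduced trajectory. -/
theorem StepThree.isProlongable_following (hS : S.IsNashSystem) (hΦ : IsNashMap S.X Φ)
    (hu : u ∈ S.inputs) (h3 : S.StepThree Φ u V W G) : IsProlongable (following S Φ u V W G) := by
  have hR := h3.isNashSystem_reduced hS hΦ
  refine ⟨⟨⟨by simpa using hu, hR.isAdmissible_inputs.empty_mem⟩, ?_, ?_⟩, ?_⟩
  · intro t ht
    rw [duration_nil, Icc_self] at ht
    obtain rfl : t = 0 := ht
    simpa [endState] using h3.mem_W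
  · rw [hR.endState_nil, List.append_nil]
    rfl
  · rintro v ⟨⟨hv, hvR⟩, hstay, hend⟩ α
    have hvW : S.endState (u ++ v) ∈ W := by
      have := hstay (duration v) (right_mem_Icc.2 (duration_nonneg v))
      rwa [← duration_append] at this
    obtain ⟨t₁, ht₁, h₁⟩ := (hS.isProlongable_endState_mem hv h3.isOpen_W hvW).exists_prolong []
      (by simpa using ⟨hv, hvW⟩) α
    obtain ⟨t₂, ht₂, h₂⟩ := hR.isAdmissible_inputs.exists_extend hvR α
    set t := min t₁ t₂
    have hmem : ∀ s ≤ t, u ++ v ++ [(α, s)] ∈ S.inputs ∧ S.endState (u ++ v ++ [(α, s)]) ∈ W :=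
      fun s hs => by simpa using h₁ s (hs.trans (min_le_left _ _))
    have hstay' : ∀ s ≤ t, ∀ τ ∈ Icc 0 (duration (v ++ [(α, s)])),
        S.traj (u ++ (v ++ [(α, s)])) (duration u + τ) ∈ W := by
      intro s hs τ hτ
      rw [duration_append, duration_singleton] at hτ
      obtain ⟨htr₁, htr₂⟩ := hS.traj_append_singleton (hmem s hs).1
      rw [← List.append_assoc]
      rcases le_total τ (duration v) with hle | hle
      · rw [htr₁ _ ⟨add_nonneg (duration_nonneg u) hτ.1, by rw [duration_append]; linarith⟩]
        exact hstay τ ⟨hτ.1, hle⟩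
      · obtain ⟨σ, hσ⟩ : ∃ σ : ℝ≥0, (σ : ℝ) = τ - duration v := ⟨⟨_, sub_nonneg.2 hle⟩, rfl⟩
        have hσs : σ ≤ s := NNReal.coe_le_coe.1 (by linarith [hτ.2])
        have h := htr₂ σ hσs
        rw [duration_append, hσ, add_assoc, add_sub_cancel] at h
        rw [h]
        exact (hmem σ (hσs.trans hs)).2
    obtain ⟨γ, hγ, hγ0, hγ1, -⟩ := hS.exists_curve (hmem t le_rfl).1
    obtain ⟨β, hβ, hβ0, hβ1, -⟩ := hR.exists_curve (h₂ t (min_le_right _ _))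
    have hsec : ∀ s ∈ Icc (0 : ℝ) t, Φ (γ s) ∈ V ∧ G (Φ (γ s)) = γ s := by
      intro s hs
      have hst : (⟨s, hs.1⟩ : ℝ≥0) ≤ t := hs.2
      have hs1 := hγ1 ⟨s, hs.1⟩ hst
      have := h3.section_G (v ++ [(α, ⟨s, hs.1⟩)])
        (by rw [← List.append_assoc]; exact (hmem _ hst).1) (hstay' _ hst)
      rw [← List.append_assoc, ← hs1] at this
      exact this
    have hsol : IsSolution ((S.reduced Φ u V G).f α) V (fun s => Φ (γ s)) 0 t := by
      refine ⟨hΦ.analyticOnNhd.continuousOn.comp hγ.cont hγ.mem, fun s hs => (hsec s hs).1,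
        fun s hs => ?_⟩
      have hs' := Ioo_subset_Icc_self hs
      have hd := (hΦ.analyticOnNhd _ (hγ.mem s hs')).differentiableAt.hasFDerivAt.comp_hasDerivAt s
        (hγ.deriv s hs)
      change HasDerivAt _ (fderiv ℝ Φ (G (Φ (γ s))) (S.f α (G (Φ (γ s))))) s
      rw [(hsec s hs').2]
      exact hd
    have heq := hβ.eqOn hsol (hR.analytic_f α) (by rw [hβ0, hend, hγ0])
    refine ⟨t, lt_min ht₁ ht₂, fun s hs => ⟨⟨?_, h₂ s (hs.trans (min_le_right _ _))⟩, hstay' s hs, ?_⟩⟩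
    · rw [← List.append_assoc]
      exact (hmem s hs).1
    · rw [← List.append_assoc, ← hβ1 s hs, ← hγ1 s hs]
      exact heq ⟨s.2, hs⟩

/-- The reduced system reaches `Φ (x_uv)` for all following inputs `v`, and these points already
suffice to annihilate a Nash function on `V`. -/
theorem StepThree.isSemialgReachable (hS : S.IsNashSystem) (h : S.StepOne Φ) (hu : u ∈ S.inputs)
    (h3 : S.StepThree Φ u V W G) : (S.reduced Φ u V G).IsSemialgReachable := by
  intro g hg hzero
  refine h.eq_zero_of_comp hS hu h3.isOpen_V h3.isConnected_V hg
    (h3.isProlongable_following hS h.isNashMap hu) (fun v hv => hv.1.1)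
    (fun v hv => (h3.section_G v hv.1.1 hv.2.1).1) fun v hv => ?_
  rw [← hv.2.2]
  exact hzero _ ⟨v, hv.1.2, rfl⟩

/-- An input common to `p_u` and the reduced system need not keep the original state in `W`, nor
even be an input of `S` after `u`. The identity is therefore read off on following inputs only and
extended by analyticity in the switching times. -/
theorem StepThree.isLocalRealization {p : Input U → Fin r → ℝ} (hS : S.IsLocalRealization A p)
    (hΦ : IsNashMap S.X Φ) (hu : u ∈ A ∩ S.inputs) (h3 : S.StepThree Φ u V W G) :
    (S.reduced Φ u V G).IsLocalRealization (shiftDomain A u) (shift p u) := by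
  have hR := h3.isNashSystem_reduced hS.nash hΦ
  have hAu := hS.admissible.shiftDomain hu.1
  have hp := hS.response.shift u
  refine ⟨hAu, hp, hR, fun v hv => ?_⟩
  have hE := (h3.isProlongable_following hS.nash hΦ hu.2).inter hAu.isProlongable
  have hEp : ∀ v ∈ following S Φ u V W G ∩ shiftDomain A u,
      shift p u v = S.h (G ((S.reduced Φ u V G).endState v)) := by
    rintro v ⟨hv, hvA⟩
    rw [hv.2.2, (h3.section_G v hv.1.1 hv.2.1).2]
    exact hS.realizes _ ⟨hvA.2, hv.1.1⟩
  -- The empty input is separate: response maps are assumed analytic only for a positive number of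
  -- pieces.
  rcases v.eq_nil_or_concat with rfl | ⟨w, a, hw⟩
  · exact hEp [] hE.nil_mem
  · have hpos : 0 < v.length := by simp [hw]
    ext j
    have hmem : (fun i : Fin v.length => ((v[i]).2 : ℝ)) ∈
        timeDomain (shiftDomain A u ∩ (S.reduced Φ u V G).inputs) fun i => (v[i]).1 :=
      ⟨fun i => (v[i]).2.2, by rw [word_getElem]; exact hv⟩
    have := hR.eq_output (hAu.inter hR.isAdmissible_inputs) inter_subset_right hE
      (fun w hw => ⟨hw.2, hw.1.1.2⟩) (fun i : Fin v.length => (v[i]).1)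
      ((hp v.length hpos _ j).mono fun t ht => ⟨ht.1, ht.2.1⟩) (hR.nash_h j).1
      (fun t ht htE => congrFun (hEp _ htE) j) _ hmem
    rwa [word_getElem] at this

end ControlSystem

end NashReach
theorem mainTheorem2 {m n r : ℕ} {U : Set (Fin m → ℝ)}
    (A : Set (NashReach.Input U)) (p : NashReach.Input U → Fin r → ℝ)
    (S : NashReach.ControlSystem U n r) (hS : S.IsLocalRealization A p)
    (ε : ℝ) (hε : 0 < ε) :
    -- step 1 can be carried out
    (∃ (d : ℕ) (Φ : (Fin n → ℝ) → (Fin d → ℝ)), S.StepOne Φ) ∧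
    -- whatever is chosen in step 1, and whichever degree is minimized
    ∀ (d : ℕ) (Φ : (Fin n → ℝ) → (Fin d → ℝ)), S.StepOne Φ →
    ∀ deg : MvPolynomial (Fin (d + 1)) ℝ → ℕ,
      (deg = MvPolynomial.totalDegree ∨ deg = MvPolynomial.degreeOf 0) →
      -- step 2 can be carried out
      (∃ Q, S.StepTwoPoly Φ deg Q) ∧
      ∀ Q, S.StepTwoPoly Φ deg Q →
        (∃ u, S.StepTwoInput A Φ Q ε u) ∧
        -- whatever is chosen in step 2, step 3 can be carried out
        ∀ u, S.StepTwoInput A Φ Q ε u →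
          (∃ V W G, S.StepThree Φ u V W G ∧
            NashReach.ControlSystem.IsImplicitSolution Q V W G) ∧
          -- whatever is chosen in step 3, the result of step 4 has the required properties
          ∀ V W G, S.StepThree Φ u V W G →
            (S.reduced Φ u V G).IsLocalRealization
              (NashReach.shiftDomain A u) (NashReach.shift p u) ∧
            (S.reduced Φ u V G).IsSemialgReachable := by
  have hN := hS.nash
  refine ⟨hN.exists_stepOne, fun d Φ hΦ deg hdeg => ⟨hΦ.exists_stepTwoPoly hN deg, fun Q hQ =>
    ⟨hQ.exists_stepTwoInput hN hS.admissible hΦ hdeg hε, fun u hu =>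
      ⟨hu.exists_stepThree hN hΦ fun i => (hQ i).1, fun V W G h3 =>
        ⟨h3.isLocalRealization hS hΦ.isNashMap hu.mem, h3.isSemialgReachable hN hΦ hu.mem.2⟩⟩⟩⟩⟩
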